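/- Let $\lambda\in\mathbb R$ (in the physical problem $\lambda=gh/c^2>0$). Let $\zeta:\mathbb R\to\mathbb R$ be continuous with $1+\zeta>0$, let $D_\zeta=\{(x,y): 0\le y\le 1+\zeta(x)\}$, and let $\varphi$ be weakly differentiable in the interior of $D_\zeta$ with $\iint_{D_\zeta}\big[(\varphi_x-1)^2+\varphi_y^2\big]\,dx\,dy<\infty$. Consider, whenever the integrals converge absolutely, $$\mathcal H(\varphi,\zeta)=\iint_{D_\zeta}\Big[\tfrac12\big(|\nabla\varphi|^2-1\big)+\lambda (y-1)_+\Big]dx\,dy ,\qquad \widetilde{\mathcal H}(\varphi,\zeta)=\iint_{D_\zeta}\tfrac12\big(|\nabla\varphi|^2-1\big)\,dx\,dy+\frac\lambda2\int_{\mathbb R}\zeta^2\,dx ,$$ which coincide when both are defined and $\zeta\ge 0$. A variation is given by $\theta,\eta\in C_c^\infty(\mathbb R^2)$ with $\theta(x,0)=0$ for all $x$; with $T_\varepsilon(x,y)=(x,y+\varepsilon\theta(x,y))$ (bijective for small $\varepsilon$) it defines the family $\zeta_\varepsilon(x)=\zeta(x)+\varepsilon\theta(x,1+\zeta(x))$,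 $\varphi_\varepsilon=(\varphi+\varepsilon\eta)\circ T_\varepsilon^{-1}$, so that $T_\varepsilon(D_\zeta)=D_{\zeta_\varepsilon}$. The pair $(\varphi,\zeta)$ is critical for a functional (satisfies its Euler--Lagrange equations) if its derivative along each such family at $\varepsilon=0$ exists and is zero, and it is a local minimizer if along each such family the value at $(\varphi,\zeta)$ is at most the value at $(\varphi_\varepsilon,\zeta_\varepsilon)$ for all small $\varepsilon$. Theorem. Let $(\varphi,\zeta)$ be as above, with $\widetilde{\mathcal H}(\varphi,\zeta)$ defined. (1) If $(\varphi,\zeta)$ is a critical point or a local minimizer of $\widetilde{\mathcal H}$, then $\varphi$ is harmonic in the interior of $D_\zeta$ (after modification on a null set). (2) Suppose moreover that $\zeta\in C^1$ and that $\varphi$ has second weak derivatives which are square integrable on $D_\zeta\cap\{|x|\le R\}$ for every $R$. Then $(\varphi,\zeta)$ is a critical point of $\widetilde{\mathcal H}$ if and only if it solves Euler's equations for a traveling irrotational gravity wave in the moving frame: $\Delta\varphi=0$ in the interior of $D_\zeta$, $\varphi_y=0$ on $y=0$, and on the free surface $y=1+\zeta(x)$ the kinematic and Bernoulli conditions $$\varphi_y=\varphi_x\,\zeta_x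 ,\qquad \tfrac12\big(\varphi_x^2+\varphi_y^2\big)+\lambda\zeta=\tfrac12$$ hold, the boundary conditions being understood for the traces of $\nabla\varphi$ at almost every $x$. In particular every local minimizer of $\widetilde{\mathcal H}$ with this regularity satisfies all these equations. (3) If $\mathcal H(\varphi,\zeta)$ is defined, the statements (1) and (2) hold for $\mathcal H$ in place of $\widetilde{\mathcal H}$, with $\lambda\zeta$ replaced by $\lambda\max(\zeta,0)$ in the Bernoulli condition; in particular they hold unchanged if $\zeta\ge0$. -/

import Mathlib

open scoped ContDiff

noncomputable section

namespace WaterWave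

open MeasureTheory Filter Topology

/-- The fluid domain `D_ζ = {(x, y) : 0 ≤ y ≤ 1 + ζ x}`. -/
def fluidDomain (ζ : ℝ → ℝ) : Set (ℝ × ℝ) :=
  {z | 0 ≤ z.2 ∧ z.2 ≤ 1 + ζ z.1}

/-- `g` is a weak (distributional) gradient of `f` on the open set `Ω`. -/
def HasWeakGrad (Ω : Set (ℝ × ℝ)) (f : ℝ × ℝ → ℝ) (g : ℝ × ℝ → ℝ × ℝ) : Prop :=
  LocallyIntegrableOn f Ω ∧ LocallyIntegrableOn g Ω ∧
    ∀ ψ : ℝ × ℝ → ℝ, ContDiff ℝ ∞ ψ → HasCompactSupport ψ → tsupport ψ ⊆ Ω →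
      (∫ z in Ω, f z * fderiv ℝ ψ z (1, 0) = -∫ z in Ω, (g z).1 * ψ z) ∧
      (∫ z in Ω, f z * fderiv ℝ ψ z (0, 1) = -∫ z in Ω, (g z).2 * ψ z)

open Classical in
/-- The weak gradient `(φ_x, φ_y)` on the interior of `D_ζ`. It is determined up to a null set;
the value is `0` if there is none. -/
def grad (ζ : ℝ → ℝ) (φ : ℝ × ℝ → ℝ) : ℝ × ℝ → ℝ × ℝ :=
  if h : ∃ g, HasWeakGrad (interior (fluidDomain ζ)) φ g then h.choose else fun _ => 0

/-- Admissible pairs: `ζ` is continuous, the fluid layer has positive depth everywhere, `φ` is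
weakly differentiable inside the fluid and `∬ (φ_x - 1)² + φ_y² < ∞`. -/
structure Admissible (φ : ℝ × ℝ → ℝ) (ζ : ℝ → ℝ) : Prop where
  continuous_surface : Continuous ζ
  depth_pos : ∀ x, 0 < 1 + ζ x
  exists_grad : ∃ g, HasWeakGrad (interior (fluidDomain ζ)) φ g
  finite_energy :
    IntegrableOn (fun z => ((grad ζ φ z).1 - 1) ^ 2 + (grad ζ φ z).2 ^ 2) (fluidDomain ζ)

/-- The renormalized kinetic energy density `½ ((∇φ)² - 1)`. -/
def kineticDensity (φ : ℝ × ℝ → ℝ) (ζ : ℝ → ℝ) (z : ℝ × ℝ) : ℝ :=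
  (1 / 2) * ((grad ζ φ z).1 ^ 2 + (grad ζ φ z).2 ^ 2 - 1)

/-- The energy density `½ ((∇φ)² - 1) + lam (y - 1)₊`. -/
def energyDensity (lam : ℝ) (φ : ℝ × ℝ → ℝ) (ζ : ℝ → ℝ) (z : ℝ × ℝ) : ℝ :=
  kineticDensity φ ζ z + lam * max (z.2 - 1) 0

/-- `H(φ, ζ) = ∬_{D_ζ} ½ ((∇φ)² - 1) + lam (y - 1)₊ dx dy`. -/
def hamiltonian (lam : ℝ) (φ : ℝ × ℝ → ℝ) (ζ : ℝ → ℝ) : ℝ :=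
  ∫ z in fluidDomain ζ, energyDensity lam φ ζ z

/-- The integral defining `hamiltonian lam φ ζ` converges absolutely. -/
def HamiltonianFinite (lam : ℝ) (φ : ℝ × ℝ → ℝ) (ζ : ℝ → ℝ) : Prop :=
  IntegrableOn (energyDensity lam φ ζ) (fluidDomain ζ)

/-- The form `∬_{D_ζ} ½ ((∇φ)² - 1) dx dy + (lam / 2) ∫ ζ² dx` of the Hamiltonian. It is the same
functional as `hamiltonian` on surfaces of elevation `ζ ≥ 0`. -/
def hamiltonianSq (lam : ℝ) (φ : ℝ × ℝ → ℝ) (ζ : ℝ → ℝ) : ℝ :=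
  (∫ z in fluidDomain ζ, kineticDensity φ ζ z) + lam / 2 * ∫ x, ζ x ^ 2

/-- The integrals defining `hamiltonianSq` at `(φ, ζ)` converge absolutely. -/
def HamiltonianSqFinite (φ : ℝ × ℝ → ℝ) (ζ : ℝ → ℝ) : Prop :=
  IntegrableOn (kineticDensity φ ζ) (fluidDomain ζ) ∧ Integrable (fun x => ζ x ^ 2)

/-- A smooth compactly supported variation of a pair `(φ, ζ)`: a vertical displacement `θ` of the
fluid particles, which leaves the bottom fixed, and a variation `η` of the potential. -/
structure Variation where
  θ : ℝ × ℝ → ℝ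
  η : ℝ × ℝ → ℝ
  smooth_θ : ContDiff ℝ ∞ θ
  smooth_η : ContDiff ℝ ∞ η
  compact_θ : HasCompactSupport θ
  compact_η : HasCompactSupport η
  bottom_fixed : ∀ x, θ (x, 0) = 0

namespace Variation

/-- The deformation `T_ε (x, y) = (x, y + ε θ(x, y))` of the plane, bijective for small `ε`. -/
def deform (V : Variation) (ε : ℝ) (z : ℝ × ℝ) : ℝ × ℝ :=
  (z.1, z.2 + ε * V.θ z)

/-- The free surface `ζ_ε`, with `T_ε (D_ζ) = D_{ζ_ε}` for small `ε`; thus `δζ (x) = θ(x, 1 + ζ x)`,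
which is an arbitrary test function of `x` if `θ` is. -/
def surface (V : Variation) (ζ : ℝ → ℝ) (ε : ℝ) (x : ℝ) : ℝ :=
  ζ x + ε * V.θ (x, 1 + ζ x)

/-- The potential `φ_ε = (φ + ε η) ∘ T_ε⁻¹` on `D_{ζ_ε}`. -/
def potential (V : Variation) (φ : ℝ × ℝ → ℝ) (ε : ℝ) (z : ℝ × ℝ) : ℝ :=
  φ (Function.invFun (V.deform ε) z) + ε * V.η (Function.invFun (V.deform ε) z)

end Variation

/-- `(φ, ζ)` satisfies the Euler–Lagrange equations of `H`: the first variation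
`d/dε H(φ_ε, ζ_ε)` at `ε = 0` exists and vanishes for every variation. -/
def IsCritical (H : (ℝ × ℝ → ℝ) → (ℝ → ℝ) → ℝ) (φ : ℝ × ℝ → ℝ) (ζ : ℝ → ℝ) : Prop :=
  ∀ V : Variation, HasDerivAt (fun ε => H (V.potential φ ε) (V.surface ζ ε)) 0 0

/-- `(φ, ζ)` is a local minimizer of `H`: along every one-parameter family `(φ_ε, ζ_ε)`,
one has `H(φ, ζ) ≤ H(φ_ε, ζ_ε)` for all small `ε`. -/
def IsLocalMinimizer (H : (ℝ × ℝ → ℝ) → (ℝ → ℝ) → ℝ) (φ : ℝ × ℝ → ℝ) (ζ : ℝ → ℝ) : Prop :=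
  ∀ V : Variation, ∀ᶠ ε in 𝓝 (0 : ℝ), H φ ζ ≤ H (V.potential φ ε) (V.surface ζ ε)

/-- `φ` coincides almost everywhere in the interior of `D_ζ` with a harmonic function. -/
def IsHarmonicInside (φ : ℝ × ℝ → ℝ) (ζ : ℝ → ℝ) : Prop :=
  ∃ h : ℂ → ℝ,
    InnerProductSpace.HarmonicOnNhd h {w : ℂ | (w.re, w.im) ∈ interior (fluidDomain ζ)} ∧
    ∀ᵐ z : ℝ × ℝ, z ∈ interior (fluidDomain ζ) → φ z = h (Complex.mk z.1 z.2)

/-- `φ` has second weak derivatives which are square integrable on the bounded parts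
`D_ζ ∩ {|x| ≤ R}` of the fluid (`φ` itself behaves like `x` at infinity and is never in
`L²(D_ζ)`). -/
def IsH2 (φ : ℝ × ℝ → ℝ) (ζ : ℝ → ℝ) : Prop :=
  ∃ g₁ g₂ : ℝ × ℝ → ℝ × ℝ,
    HasWeakGrad (interior (fluidDomain ζ)) (fun z => (grad ζ φ z).1) g₁ ∧
    HasWeakGrad (interior (fluidDomain ζ)) (fun z => (grad ζ φ z).2) g₂ ∧
    ∀ R : ℝ, IntegrableOn
      (fun z => (g₁ z).1 ^ 2 + (g₁ z).2 ^ 2 + (g₂ z).1 ^ 2 + (g₂ z).2 ^ 2)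
      (fluidDomain ζ ∩ {z | |z.1| ≤ R})

/-- `τ` is the trace of `w` on the free surface `y = 1 + ζ x`: for almost every `x`, it is the
limit of the averages of `w` over the vertical segment of length `s` below `(x, 1 + ζ x)`. -/
def HasSurfaceTrace (ζ : ℝ → ℝ) (w : ℝ × ℝ → ℝ) (τ : ℝ → ℝ) : Prop :=
  ∀ᵐ x : ℝ, (∀ᶠ s in 𝓝[>] (0 : ℝ),
      IntervalIntegrable (fun y => w (x, y)) volume (1 + ζ x - s) (1 + ζ x)) ∧
    Tendsto (fun s => s⁻¹ * ∫ y in (1 + ζ x - s)..(1 + ζ x), w (x, y)) (𝓝[>] 0) (𝓝 (τ x))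

/-- `τ` is the trace of `w` on the bottom `y = 0`. -/
def HasBottomTrace (w : ℝ × ℝ → ℝ) (τ : ℝ → ℝ) : Prop :=
  ∀ᵐ x : ℝ, (∀ᶠ s in 𝓝[>] (0 : ℝ), IntervalIntegrable (fun y => w (x, y)) volume 0 s) ∧
    Tendsto (fun s => s⁻¹ * ∫ y in (0 : ℝ)..s, w (x, y)) (𝓝[>] 0) (𝓝 (τ x))

/-- The free surface conditions of a traveling wave in the moving frame: the kinematic condition
`φ_y = φ_x ζ_x` and the Bernoulli condition `½ (φ_x² + φ_y²) + lam κ = ½` at almost every point of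
the surface, in the sense of traces. Bernoulli's equation of gravity waves has `κ = ζ`. -/
def SurfaceConditions (lam : ℝ) (φ : ℝ × ℝ → ℝ) (ζ κ : ℝ → ℝ) : Prop :=
  ∃ p q : ℝ → ℝ,
    HasSurfaceTrace ζ (fun z => (grad ζ φ z).1) p ∧
    HasSurfaceTrace ζ (fun z => (grad ζ φ z).2) q ∧
    (∀ᵐ x : ℝ, q x = p x * deriv ζ x) ∧
    (∀ᵐ x : ℝ, (p x ^ 2 + q x ^ 2) / 2 + lam * κ x = 1 / 2)

/-- Euler's equations of a traveling irrotational gravity wave in the moving frame: `φ` is harmonic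
in the fluid, `φ_y = 0` on the bottom, and the free surface conditions hold. -/
def EulerEquations (lam : ℝ) (φ : ℝ × ℝ → ℝ) (ζ κ : ℝ → ℝ) : Prop :=
  IsHarmonicInside φ ζ ∧ HasBottomTrace (fun z => (grad ζ φ z).2) (fun _ => 0) ∧
    SurfaceConditions lam φ ζ κ

end WaterWave

end

noncomputable section

namespace WaterWave

open MeasureTheory Filter Topology

/-! Pulling a varied pair back by `T_ε` puts the whole family on the fixed domain `D_ζ`: the area
element becomes `1 + ε θ_y`, and `∇φ + ε ∇η` is transformed by the inverse of a shear. The kinetic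
integrand is then an explicit rational function of `ε`. Its remainder after first order is at most
`C ε² (1 + |∇φ|²)` and vanishes off the compact support of the variation, where the finite energy
makes the bound integrable (`kinetic_remainder`, `exists_kineticRemainder_bound`). The potential
energy integrates in `y` to a function of the surface alone. So the derivative along every family
exists and equals `∬ [φ_x η_x + φ_y η_y + ½ θ_y (φ_x² - φ_y² - 1) - θ_x φ_x φ_y] + λ ∫ κ δζ`, with
`κ = max ζ 0` or `κ = ζ` according to the functional. Being critical means that this linear
expression vanishes for all `θ`, `η`, and a local minimizer is critical by Fermat's rule.

Inside the fluid, `θ = 0` and `η` supported away from the boundary give `∬ φ Δη = 0`, and Weyl's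
lemma (`IsWeaklyHarmonic.exists_harmonic`) supplies a harmonic representative. Its proof averages
`φ` against a radial kernel built as the Laplacian of a regularized logarithm. Kernels of two radii
differ by the Laplacian of a test function, so the averages do not depend on the radius.

On the boundary, the velocity `(P, Q)` has vanishing divergence and curl. The second derivatives
being square integrable, `PQ` and `P² - Q²` have integrable first derivatives, hence limits along
almost every vertical segment. Green's formula (`RegularInside.green`) turns the first variation
into `∫ (q - ζ' p) η - ∫ q₀ η(x, 0) + ∫ (½ (p² - q² - 1) + ζ' p q + λ κ) θ` (`kineticVariation_eq`,
`firstVariation_eq`). For `η` the area terms cancel because the divergence vanishes, for `θ` because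
`∂ₓ(PQ) = ½ ∂_y(P² - Q²)`. The values of `η` and `θ` on the surface and of `η` on the bottom can be
prescribed independently, so the three integrands vanish separately. The first two are the kinematic
and bottom conditions. Substituting `ζ' p = q` into the third gives Bernoulli's equation. -/

/-- The open fluid domain `{(x, y) : 0 < y < 1 + ζ x}`. -/
def fluidInterior (ζ : ℝ → ℝ) : Set (ℝ × ℝ) :=
  {z | 0 < z.2 ∧ z.2 < 1 + ζ z.1}

/-! ### The fluid domain up to null sets -/

theorem isOpen_fluidInterior {ζ : ℝ → ℝ} (hζ : Continuous ζ) : IsOpen (fluidInterior ζ) :=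
  (isOpen_lt continuous_const continuous_snd).inter
    (isOpen_lt continuous_snd (continuous_const.add (hζ.comp continuous_fst)))

theorem isClosed_fluidDomain {ζ : ℝ → ℝ} (hζ : Continuous ζ) : IsClosed (fluidDomain ζ) :=
  (isClosed_le continuous_const continuous_snd).inter
    (isClosed_le continuous_snd (continuous_const.add (hζ.comp continuous_fst)))

theorem fluidInterior_subset (ζ : ℝ → ℝ) : fluidInterior ζ ⊆ fluidDomain ζ :=
  fun _ h => ⟨h.1.le, h.2.le⟩

/-- A point of the interior has a short vertical segment around it inside the domain; moving down
and up along it makes both inequalities strict. -/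
theorem interior_fluidDomain {ζ : ℝ → ℝ} (hζ : Continuous ζ) :
    interior (fluidDomain ζ) = fluidInterior ζ := by
  apply Set.Subset.antisymm
  · intro z hz
    have h : ∀ᶠ y in 𝓝 z.2, (z.1, y) ∈ fluidDomain ζ := by
      have hc : ContinuousAt (fun y : ℝ => (z.1, y)) z.2 := by fun_prop
      exact hc (mem_interior_iff_mem_nhds.1 hz)
    obtain ⟨δ, hδ, hball⟩ := Metric.eventually_nhds_iff.1 h
    have h1 := hball (y := z.2 - δ / 2) (by
      rw [Real.dist_eq, sub_sub_cancel_left, abs_neg, abs_of_pos (by linarith)]; linarith)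
    have h2 := hball (y := z.2 + δ / 2) (by
      rw [Real.dist_eq, add_sub_cancel_left, abs_of_pos (by linarith)]; linarith)
    refine ⟨?_, ?_⟩
    · have := h1.1
      simp only at this
      linarith
    · have := h2.2
      simp only at this
      linarith
  · exact interior_maximal (fluidInterior_subset ζ) (isOpen_fluidInterior hζ)

/-- Every vertical slice of the difference has at most two points, so Fubini's theorem applies. -/
theorem fluidDomain_ae_eq {ζ : ℝ → ℝ} (hζ : Continuous ζ) :
    fluidDomain ζ =ᵐ[volume] fluidInterior ζ := by
  have hm : MeasurableSet (fluidDomain ζ \ fluidInterior ζ) :=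
    (isClosed_fluidDomain hζ).measurableSet.diff (isOpen_fluidInterior hζ).measurableSet
  have h0 : volume (fluidDomain ζ \ fluidInterior ζ) = 0 := by
    rw [Measure.volume_eq_prod, Measure.measure_prod_null hm]
    refine Eventually.of_forall fun x => ?_
    refine measure_mono_null (t := {0, 1 + ζ x}) ?_ (Set.Finite.measure_zero (by simp) _)
    rintro y ⟨⟨h1, h2⟩, h3⟩
    simp only [fluidInterior, Set.mem_ofPred_eq, not_and, not_lt] at h3 h1 h2
    rcases h1.eq_or_lt with h | h
    · exact Or.inl h.symm
    · exact Or.inr (le_antisymm h2 (h3 h))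
  exact (ae_le_set.2 h0).antisymm (LE.le.eventuallyLE (fluidInterior_subset ζ))

theorem restrict_fluidDomain {ζ : ℝ → ℝ} (hζ : Continuous ζ) :
    (volume : Measure (ℝ × ℝ)).restrict (fluidDomain ζ) = volume.restrict (fluidInterior ζ) :=
  Measure.restrict_congr_set (fluidDomain_ae_eq hζ)

/-! ### Weak gradients -/

/-- Multiplication by a continuous function with compact support `K` turns integrability on `Ω ∩ K`
into integrability on `Ω`. -/
theorem IntegrableOn.mul_hasCompactSupport {Ω : Set (ℝ × ℝ)} (hΩ : MeasurableSet Ω)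
    {d ψ : ℝ × ℝ → ℝ} (hψ : Continuous ψ) (hc : HasCompactSupport ψ)
    (hd : IntegrableOn d (Ω ∩ tsupport ψ)) : IntegrableOn (fun z => d z * ψ z) Ω := by
  have h := hd.mul_continuousOn_of_subset (g' := ψ) hψ.continuousOn
    (hΩ.inter (isClosed_tsupport ψ).measurableSet) hc Set.inter_subset_right
  refine h.of_forall_sdiff_eq_zero hΩ fun z hz => ?_
  rw [image_eq_zero_of_notMem_tsupport (fun hh => hz.2 ⟨hz.1, hh⟩), mul_zero]

theorem LocallyIntegrableOn.mul_hasCompactSupport {Ω : Set (ℝ × ℝ)} (hΩ : MeasurableSet Ω)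
    {d ψ : ℝ × ℝ → ℝ} (hd : LocallyIntegrableOn d Ω) (hψ : Continuous ψ)
    (hc : HasCompactSupport ψ) (hs : tsupport ψ ⊆ Ω) :
    IntegrableOn (fun z => d z * ψ z) Ω :=
  IntegrableOn.mul_hasCompactSupport hΩ hψ hc
    ((hd.integrableOn_compact_subset hs hc).mono_set Set.inter_subset_right)

theorem LocallyIntegrableOn.fst {Ω : Set (ℝ × ℝ)} {g : ℝ × ℝ → ℝ × ℝ}
    (hg : LocallyIntegrableOn g Ω) : LocallyIntegrableOn (fun z => (g z).1) Ω := fun z hz => by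
  obtain ⟨s, hs, hi⟩ := hg z hz
  exact ⟨s, hs, Integrable.fst hi⟩

theorem LocallyIntegrableOn.snd {Ω : Set (ℝ × ℝ)} {g : ℝ × ℝ → ℝ × ℝ}
    (hg : LocallyIntegrableOn g Ω) : LocallyIntegrableOn (fun z => (g z).2) Ω := fun z hz => by
  obtain ⟨s, hs, hi⟩ := hg z hz
  exact ⟨s, hs, Integrable.snd hi⟩

theorem setIntegral_eq_integral_of_tsupport_subset {Ω : Set (ℝ × ℝ)} {d ψ : ℝ × ℝ → ℝ}
    (hs : tsupport ψ ⊆ Ω) : ∫ z in Ω, d z * ψ z = ∫ z, d z * ψ z := by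
  refine setIntegral_eq_integral_of_forall_compl_eq_zero fun z hz => ?_
  rw [image_eq_zero_of_notMem_tsupport (fun hh => hz (hs hh)), mul_zero]

/-- Two locally integrable functions with the same distribution agree almost everywhere. -/
theorem ae_eq_of_forall_integral_mul_eq {Ω : Set (ℝ × ℝ)} (hΩ : IsOpen Ω) {d d' : ℝ × ℝ → ℝ}
    (hd : LocallyIntegrableOn d Ω) (hd' : LocallyIntegrableOn d' Ω)
    (h : ∀ ψ : ℝ × ℝ → ℝ, ContDiff ℝ ∞ ψ → HasCompactSupport ψ → tsupport ψ ⊆ Ω →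
      ∫ z in Ω, d z * ψ z = ∫ z in Ω, d' z * ψ z) : d =ᵐ[volume.restrict Ω] d' := by
  have h0 : ∀ᵐ z, z ∈ Ω → (d - d') z = 0 := by
    refine hΩ.ae_eq_zero_of_integral_contDiff_smul_eq_zero (hd.sub hd') fun ψ h1 h2 h3 => ?_
    have e := h ψ h1 h2 h3
    rw [← sub_eq_zero, ← integral_sub
      (LocallyIntegrableOn.mul_hasCompactSupport hΩ.measurableSet hd h1.continuous h2 h3)
      (LocallyIntegrableOn.mul_hasCompactSupport hΩ.measurableSet hd' h1.continuous h2 h3)] at e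
    simp only [← sub_mul] at e
    rw [setIntegral_eq_integral_of_tsupport_subset (d := fun z => d z - d' z) h3] at e
    simpa [mul_comm] using e
  rw [Filter.EventuallyEq, ae_restrict_iff' hΩ.measurableSet]
  filter_upwards [h0] with z hz hzΩ
  exact sub_eq_zero.1 (hz hzΩ)

/-- This makes the choice in the definition of `grad` harmless: any weak gradient computed by hand
agrees with it almost everywhere. -/
theorem HasWeakGrad.ae_eq {Ω : Set (ℝ × ℝ)} (hΩ : IsOpen Ω) {f : ℝ × ℝ → ℝ}
    {g g' : ℝ × ℝ → ℝ × ℝ} (h : HasWeakGrad Ω f g) (h' : HasWeakGrad Ω f g') :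
    g =ᵐ[volume.restrict Ω] g' := by
  have h1 := ae_eq_of_forall_integral_mul_eq hΩ (LocallyIntegrableOn.fst h.2.1)
    (LocallyIntegrableOn.fst h'.2.1) fun ψ a b c =>
      neg_injective ((h.2.2 ψ a b c).1.symm.trans (h'.2.2 ψ a b c).1)
  have h2 := ae_eq_of_forall_integral_mul_eq hΩ (LocallyIntegrableOn.snd h.2.1)
    (LocallyIntegrableOn.snd h'.2.1) fun ψ a b c =>
      neg_injective ((h.2.2 ψ a b c).2.symm.trans (h'.2.2 ψ a b c).2)
  filter_upwards [h1, h2] with z e1 e2 using Prod.ext e1 e2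

theorem grad_spec {φ : ℝ × ℝ → ℝ} {ζ : ℝ → ℝ}
    (h : ∃ g, HasWeakGrad (interior (fluidDomain ζ)) φ g) :
    HasWeakGrad (interior (fluidDomain ζ)) φ (grad ζ φ) := by
  rw [grad, dif_pos h]
  exact h.choose_spec

theorem HasWeakGrad.congr_left {Ω : Set (ℝ × ℝ)} {f f' : ℝ × ℝ → ℝ} {g : ℝ × ℝ → ℝ × ℝ}
    (hΩ : IsOpen Ω) (h : HasWeakGrad Ω f g) (hf : f =ᵐ[volume.restrict Ω] f') :
    HasWeakGrad Ω f' g := by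
  refine ⟨?_, h.2.1, fun ψ a b c => ?_⟩
  · rw [locallyIntegrableOn_iff hΩ.isLocallyClosed]
    intro k hk hkc
    refine (h.1.integrableOn_compact_subset hk hkc).congr ?_
    exact ae_restrict_of_ae_restrict_of_subset hk hf
  · have e : ∀ v : ℝ × ℝ, ∫ z in Ω, f' z * fderiv ℝ ψ z v = ∫ z in Ω, f z * fderiv ℝ ψ z v :=
      fun v => integral_congr_ae (hf.mono fun z hz => by simp only [hz])
    rw [e, e]
    exact h.2.2 ψ a b c

/-- The classical gradient `(∂ₓ h, ∂_y h)`. -/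
def classicalGrad (h : ℝ × ℝ → ℝ) (z : ℝ × ℝ) : ℝ × ℝ :=
  (fderiv ℝ h z (1, 0), fderiv ℝ h z (0, 1))

/-- A classical gradient is a weak gradient. -/
theorem hasWeakGrad_classicalGrad {Ω : Set (ℝ × ℝ)} (hΩ : IsOpen Ω) {h : ℝ × ℝ → ℝ}
    (hh : ContDiffOn ℝ 1 h Ω) : HasWeakGrad Ω h (classicalGrad h) := by
  have hd : ContinuousOn (fderiv ℝ h) Ω := hh.continuousOn_fderiv_of_isOpen hΩ le_rfl
  have hdv : ∀ v, ContinuousOn (fun z => fderiv ℝ h z v) Ω :=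
    fun v => hd.clm_apply continuousOn_const
  refine ⟨hh.continuousOn.locallyIntegrableOn hΩ.measurableSet,
    ((hdv _).prodMk (hdv _)).locallyIntegrableOn hΩ.measurableSet, fun ψ a b c => ?_⟩
  have key : ∀ v, ∫ z in Ω, h z * fderiv ℝ ψ z v = -∫ z in Ω, fderiv ℝ h z v * ψ z := by
    intro v
    have cs : HasCompactSupport fun z => fderiv ℝ ψ z v := b.fderiv_apply (𝕜 := ℝ) v
    have cc : Continuous fun z => fderiv ℝ ψ z v :=
      (a.continuous_fderiv (by simp)).clm_apply continuous_const
    have ts : tsupport (fun z => fderiv ℝ ψ z v) ⊆ tsupport ψ :=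
      tsupport_fderiv_apply_subset ℝ v
    have glob : ∀ {d χ : ℝ × ℝ → ℝ}, ContinuousOn d Ω → Continuous χ → HasCompactSupport χ →
        tsupport χ ⊆ Ω → Integrable (fun z => d z * χ z) := by
      intro d χ hd hχ hc hs
      rw [← integrableOn_univ]
      refine IntegrableOn.mul_hasCompactSupport MeasurableSet.univ hχ hc ?_
      rw [Set.univ_inter]
      exact (hd.mono hs).integrableOn_compact hc
    rw [setIntegral_eq_integral_of_tsupport_subset (ts.trans c),
      setIntegral_eq_integral_of_tsupport_subset c]
    -- Integration by parts takes place on the whole plane; `h` only has to be differentiable on the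
    -- support of `ψ`, which lies in `Ω`.
    refine integral_mul_fderiv_eq_neg_fderiv_mul_of_integrable (glob (hdv v) a.continuous b c)
      (glob hh.continuousOn cc cs (ts.trans c)) (glob hh.continuousOn a.continuous b c)
      (fun z hz => ?_) (fun z _ => a.differentiable (by simp) z)
    exact (hh.contDiffAt (hΩ.mem_nhds (c hz))).differentiableAt one_ne_zero
  exact ⟨key _, key _⟩

theorem HasWeakGrad.add_contDiff {Ω : Set (ℝ × ℝ)} (hΩ : IsOpen Ω) {f h : ℝ × ℝ → ℝ}
    {g : ℝ × ℝ → ℝ × ℝ} (H : HasWeakGrad Ω f g) (hh : ContDiffOn ℝ 1 h Ω) :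
    HasWeakGrad Ω (fun z => f z + h z) (fun z => g z + classicalGrad h z) := by
  have K := hasWeakGrad_classicalGrad hΩ hh
  refine ⟨H.1.add K.1, H.2.1.add K.2.1, fun ψ a b c => ?_⟩
  have cs : ∀ v, HasCompactSupport fun z => fderiv ℝ ψ z v := fun v => b.fderiv_apply (𝕜 := ℝ) v
  have cc : ∀ v, Continuous fun z => fderiv ℝ ψ z v := fun v =>
    (a.continuous_fderiv (by simp)).clm_apply continuous_const
  have ts : ∀ v, tsupport (fun z => fderiv ℝ ψ z v) ⊆ Ω := fun v =>
    (tsupport_fderiv_apply_subset ℝ v).trans c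
  have M := hΩ.measurableSet
  simp only [add_mul, Prod.fst_add, Prod.snd_add]
  rw [integral_add (LocallyIntegrableOn.mul_hasCompactSupport M H.1 (cc _) (cs _) (ts _))
      (LocallyIntegrableOn.mul_hasCompactSupport M K.1 (cc _) (cs _) (ts _)),
    integral_add (LocallyIntegrableOn.mul_hasCompactSupport M H.1 (cc _) (cs _) (ts _))
      (LocallyIntegrableOn.mul_hasCompactSupport M K.1 (cc _) (cs _) (ts _)),
    integral_add (LocallyIntegrableOn.mul_hasCompactSupport M (LocallyIntegrableOn.fst H.2.1)
      a.continuous b c) (LocallyIntegrableOn.mul_hasCompactSupport M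
        (LocallyIntegrableOn.fst K.2.1) a.continuous b c),
    integral_add (LocallyIntegrableOn.mul_hasCompactSupport M (LocallyIntegrableOn.snd H.2.1)
      a.continuous b c) (LocallyIntegrableOn.mul_hasCompactSupport M
        (LocallyIntegrableOn.snd K.2.1) a.continuous b c),
    (H.2.2 ψ a b c).1, (H.2.2 ψ a b c).2, (K.2.2 ψ a b c).1, (K.2.2 ψ a b c).2]
  constructor <;> ring

/-! ### Maps preserving vertical lines, and mixed derivatives -/

/-- The derivative `(dx, dy) ↦ (dx, a dx + b dy)` of a map preserving vertical lines. -/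
def shearDeriv (a b : ℝ) : ℝ × ℝ →L[ℝ] ℝ × ℝ :=
  (ContinuousLinearMap.fst ℝ ℝ ℝ).prod
    (a • ContinuousLinearMap.fst ℝ ℝ ℝ + b • ContinuousLinearMap.snd ℝ ℝ ℝ)

theorem det_shearDeriv (a b : ℝ) : (shearDeriv a b).det = b := by
  have h : shearDeriv a b = LinearMap.toContinuousLinearMap (Matrix.toLin (Module.Basis.finTwoProd ℝ)
      (Module.Basis.finTwoProd ℝ) !![1, 0; a, b]) := by
    ext <;> simp [shearDeriv, Matrix.toLin_finTwoProd_apply]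
  rw [h, LinearMap.det_toContinuousLinearMap, LinearMap.det_toLin]
  simp

/-- Every functional on the plane is determined by its two partial derivatives. -/
theorem clm_apply_eq (L : ℝ × ℝ →L[ℝ] ℝ) (v : ℝ × ℝ) :
    L v = v.1 * L (1, 0) + v.2 * L (0, 1) := by
  have h : v = v.1 • ((1, 0) : ℝ × ℝ) + v.2 • ((0, 1) : ℝ × ℝ) := by
    ext <;> simp
  conv_lhs => rw [h]
  rw [map_add, map_smul, map_smul, smul_eq_mul, smul_eq_mul]

/-- Serves both the deformation `T_ε` and the map flattening the fluid to a strip in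
`setIntegral_fderiv_fst`. -/
theorem hasFDerivAt_shear {m : ℝ × ℝ → ℝ} {z : ℝ × ℝ} (hm : DifferentiableAt ℝ m z) :
    HasFDerivAt (fun w : ℝ × ℝ => (w.1, m w))
      (shearDeriv (fderiv ℝ m z (1, 0)) (fderiv ℝ m z (0, 1))) z := by
  have h := (hasFDerivAt_fst (𝕜 := ℝ) (p := z)).prodMk hm.hasFDerivAt
  have e : shearDeriv (fderiv ℝ m z (1, 0)) (fderiv ℝ m z (0, 1)) =
      (ContinuousLinearMap.fst ℝ ℝ ℝ).prod (fderiv ℝ m z) := by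
    ext <;> simp [shearDeriv]
  rw [e]
  exact h

/-- Symmetry of second derivatives. -/
theorem fderiv_fderiv_apply_comm {f : ℝ × ℝ → ℝ} {z : ℝ × ℝ} (hf : ContDiffAt ℝ 2 f z)
    (u v : ℝ × ℝ) :
    fderiv ℝ (fun w => fderiv ℝ f w u) z v = fderiv ℝ (fun w => fderiv ℝ f w v) z u := by
  have hd : DifferentiableAt ℝ (fderiv ℝ f) z :=
    (hf.fderiv_right (m := 1) (by norm_num)).differentiableAt one_ne_zero
  have hs : IsSymmSndFDerivAt ℝ f z := hf.isSymmSndFDerivAt (by simp)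
  rw [fderiv_clm_apply hd (differentiableAt_const u), fderiv_clm_apply hd (differentiableAt_const v)]
  simpa using hs v u

/-! ### Transport of domains and weak gradients by the deformation -/

namespace Variation

variable (V : Variation) (ε : ℝ)

/-- The Jacobian determinant `1 + ε θ_y` of `T_ε`. -/
def jac (z : ℝ × ℝ) : ℝ := 1 + ε * fderiv ℝ V.θ z (0, 1)

/-- Smallness of `ε`, which makes `T_ε` a diffeomorphism of the plane. -/
def IsSmall : Prop := ∀ z, |ε * fderiv ℝ V.θ z (0, 1)| ≤ 1 / 2

variable {V ε}

/-- A uniform lower bound, not just positivity, is needed in order to bound the quotient term in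
`kinetic_remainder`. -/
theorem IsSmall.half_le_jac (h : V.IsSmall ε) (z : ℝ × ℝ) : 1 / 2 ≤ V.jac ε z := by
  have := (abs_le.1 (h z)).1
  simp only [jac]
  linarith

theorem IsSmall.jac_pos (h : V.IsSmall ε) (z : ℝ × ℝ) : 0 < V.jac ε z :=
  lt_of_lt_of_le (by norm_num) (h.half_le_jac z)

theorem contDiff_deform : ContDiff ℝ ∞ (V.deform ε) :=
  contDiff_fst.prodMk (contDiff_snd.add (contDiff_const.mul V.smooth_θ))

theorem contDiff_fderiv_apply {f : ℝ × ℝ → ℝ} (hf : ContDiff ℝ ∞ f) (v : ℝ × ℝ) :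
    ContDiff ℝ ∞ fun z => fderiv ℝ f z v :=
  (hf.fderiv_right (m := ∞) (by simp)).clm_apply contDiff_const

theorem contDiff_jac : ContDiff ℝ ∞ (V.jac ε) :=
  contDiff_const.add (contDiff_const.mul (contDiff_fderiv_apply V.smooth_θ _))

theorem differentiable_θ : Differentiable ℝ V.θ := V.smooth_θ.differentiable (by simp)

theorem differentiable_η : Differentiable ℝ V.η := V.smooth_η.differentiable (by simp)

theorem hasFDerivAt_deform (z : ℝ × ℝ) :
    HasFDerivAt (V.deform ε) (shearDeriv (ε * fderiv ℝ V.θ z (1, 0)) (V.jac ε z)) z := by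
  have hθ : DifferentiableAt ℝ (fun w => ε * V.θ w) z := (differentiable_θ z).const_mul ε
  have hm : DifferentiableAt ℝ (fun w : ℝ × ℝ => w.2 + ε * V.θ w) z :=
    differentiableAt_snd.add hθ
  have h := hasFDerivAt_shear hm
  have e : ∀ v, fderiv ℝ (fun w : ℝ × ℝ => w.2 + ε * V.θ w) z v = v.2 + ε * fderiv ℝ V.θ z v := by
    intro v
    rw [fderiv_fun_add differentiableAt_snd hθ, fderiv_const_mul (differentiable_θ z)]
    simp [fderiv_snd]
  rw [e, e] at h
  simp only [zero_add] at h
  exact h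

theorem IsSmall.strictMono (h : V.IsSmall ε) (x : ℝ) :
    StrictMono fun y => y + ε * V.θ (x, y) := by
  have hd : ∀ y, HasDerivAt (fun y => y + ε * V.θ (x, y)) (V.jac ε (x, y)) y := by
    intro y
    have h1 : HasDerivAt (fun y : ℝ => (x, y)) ((0 : ℝ), (1 : ℝ)) y :=
      (hasDerivAt_const y x).prodMk (hasDerivAt_id y)
    have h2 := (differentiable_θ (V := V) (x, y)).hasFDerivAt.comp_hasDerivAt y h1
    exact (hasDerivAt_id y).add (h2.const_mul ε)
  exact strictMono_of_deriv_pos fun y => (hd y).deriv ▸ h.jac_pos (x, y)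

theorem IsSmall.injective (h : V.IsSmall ε) : Function.Injective (V.deform ε) := by
  rintro ⟨x, y⟩ ⟨x', y'⟩ hxy
  simp only [deform, Prod.mk.injEq] at hxy
  obtain ⟨rfl, hy⟩ := hxy
  rw [(h.strictMono x).injective hy]

theorem exists_bound_θ : ∃ C, ∀ z, |V.θ z| ≤ C :=
  V.compact_θ.exists_bound_of_continuous V.smooth_θ.continuous

/-- On each vertical line the map is a bounded continuous perturbation of the identity, so the
intermediate value theorem applies, with no smallness of `ε`. -/
theorem surjective_deform : Function.Surjective (V.deform ε) := by
  rintro ⟨x, y⟩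
  obtain ⟨C, hC⟩ := V.exists_bound_θ
  have hb : ∀ y, |ε * V.θ (x, y)| ≤ |ε| * C := fun y => by
    rw [abs_mul]
    exact mul_le_mul_of_nonneg_left (hC _) (abs_nonneg _)
  have hc : Continuous fun y => y + ε * V.θ (x, y) := by
    have := V.smooth_θ.continuous
    fun_prop
  have hs : Function.Surjective fun y => y + ε * V.θ (x, y) := by
    refine hc.surjective ?_ ?_
    · exact tendsto_atTop_add_right_of_le _ (-(|ε| * C)) tendsto_id fun y => (abs_le.1 (hb y)).1
    · exact tendsto_atBot_add_right_of_ge _ (|ε| * C) tendsto_id fun y => (abs_le.1 (hb y)).2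
  obtain ⟨t, ht⟩ := hs y
  exact ⟨(x, t), Prod.ext rfl ht⟩

theorem IsSmall.invFun_deform (h : V.IsSmall ε) (z : ℝ × ℝ) :
    Function.invFun (V.deform ε) (V.deform ε z) = z :=
  Function.leftInverse_invFun h.injective z

/-- Points move by at most `|ε| sup |θ|`, so preimages of bounded sets are bounded. -/
theorem isCompact_preimage_deform {k : Set (ℝ × ℝ)} (hk : IsCompact k) :
    IsCompact (V.deform ε ⁻¹' k) := by
  obtain ⟨C, hC⟩ := V.exists_bound_θ
  refine Metric.isCompact_of_isClosed_isBounded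
    (hk.isClosed.preimage contDiff_deform.continuous) ?_
  obtain ⟨R, hR⟩ := hk.isBounded.exists_norm_le
  refine isBounded_iff_forall_norm_le.2 ⟨R + |ε| * C, fun z hz => ?_⟩
  have h1 := hR _ hz
  have h2 : ‖z - V.deform ε z‖ ≤ |ε| * C := by
    have hC0 : 0 ≤ |ε| * C := mul_nonneg (abs_nonneg _) ((abs_nonneg _).trans (hC z))
    refine norm_prod_le_iff.2 ⟨by simpa [deform] using hC0, ?_⟩
    simp only [deform, Prod.snd_sub, sub_add_cancel_left, norm_neg, Real.norm_eq_abs, abs_mul]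
    exact mul_le_mul_of_nonneg_left (hC z) (abs_nonneg _)
  calc ‖z‖ = ‖V.deform ε z + (z - V.deform ε z)‖ := by rw [add_sub_cancel]
    _ ≤ _ := (norm_add_le _ _).trans (add_le_add h1 h2)

/-- `T_ε` is increasing on each vertical line, fixes the bottom point and carries the surface point
to the new surface. -/
theorem IsSmall.image_fluidInterior (h : V.IsSmall ε) (ζ : ℝ → ℝ) :
    V.deform ε '' fluidInterior ζ = fluidInterior (V.surface ζ ε) := by
  have key : ∀ z, V.deform ε z ∈ fluidInterior (V.surface ζ ε) ↔ z ∈ fluidInterior ζ := by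
    rintro ⟨x, y⟩
    have h0 := (h.strictMono x).lt_iff_lt (a := 0) (b := y)
    have h1 := (h.strictMono x).lt_iff_lt (a := y) (b := 1 + ζ x)
    simp only [V.bottom_fixed, mul_zero, add_zero] at h0
    simp only [fluidInterior, deform, surface, Set.mem_ofPred_eq, h0, ← h1, add_assoc]
  ext w
  constructor
  · rintro ⟨z, hz, rfl⟩
    exact (key z).2 hz
  · intro hw
    obtain ⟨z, rfl⟩ := V.surjective_deform (ε := ε) w
    exact ⟨z, (key z).1 hw, rfl⟩

theorem continuous_surface {ζ : ℝ → ℝ} (hζ : Continuous ζ) : Continuous (V.surface ζ ε) := by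
  have := V.smooth_θ.continuous
  unfold surface
  fun_prop

theorem IsSmall.integrableOn_image (h : V.IsSmall ε) {E : Type*} [NormedAddCommGroup E]
    [NormedSpace ℝ E] {s : Set (ℝ × ℝ)} (hs : MeasurableSet s) (f : ℝ × ℝ → E) :
    IntegrableOn f (V.deform ε '' s) ↔ IntegrableOn (fun z => V.jac ε z • f (V.deform ε z)) s := by
  rw [integrableOn_image_iff_integrableOn_abs_det_fderiv_smul volume hs
    (fun z _ => (hasFDerivAt_deform z).hasFDerivWithinAt) h.injective.injOn]
  simp only [det_shearDeriv, abs_of_pos (h.jac_pos _)]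

theorem IsSmall.integral_image (h : V.IsSmall ε) {s : Set (ℝ × ℝ)} (hs : MeasurableSet s)
    (f : ℝ × ℝ → ℝ) :
    ∫ z in V.deform ε '' s, f z = ∫ z in s, V.jac ε z * f (V.deform ε z) := by
  rw [integral_image_eq_integral_abs_det_fderiv_smul volume hs
    (fun z _ => (hasFDerivAt_deform z).hasFDerivWithinAt) h.injective.injOn]
  simp only [det_shearDeriv, abs_of_pos (h.jac_pos _), smul_eq_mul]

variable (V ε) in
/-- The gradient of `f ∘ T_ε⁻¹` at `T_ε z`, if `g` is the gradient of `f`. -/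
def pushGrad (g : ℝ × ℝ → ℝ × ℝ) (z : ℝ × ℝ) : ℝ × ℝ :=
  ((g z).1 - ε * fderiv ℝ V.θ z (1, 0) / V.jac ε z * (g z).2, (g z).2 / V.jac ε z)

theorem fderiv_comp_deform {ψ : ℝ × ℝ → ℝ} (hψ : ContDiff ℝ ∞ ψ) (z v : ℝ × ℝ) :
    fderiv ℝ (fun w => ψ (V.deform ε w)) z v =
      v.1 * fderiv ℝ ψ (V.deform ε z) (1, 0) +
        (ε * fderiv ℝ V.θ z (1, 0) * v.1 + V.jac ε z * v.2) *
          fderiv ℝ ψ (V.deform ε z) (0, 1) := by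
  have h := ((hψ.differentiable (by simp) (V.deform ε z)).hasFDerivAt.comp z
    (hasFDerivAt_deform (V := V) (ε := ε) z)).fderiv
  have e : (fun w => ψ (V.deform ε w)) = ψ ∘ V.deform ε := rfl
  rw [e, h]
  exact clm_apply_eq (fderiv ℝ ψ (V.deform ε z)) (shearDeriv _ _ v)

theorem fderiv_mul_apply {f g : ℝ × ℝ → ℝ} {z : ℝ × ℝ} (hf : DifferentiableAt ℝ f z)
    (hg : DifferentiableAt ℝ g z) (v : ℝ × ℝ) :
    fderiv ℝ (fun w => f w * g w) z v = f z * fderiv ℝ g z v + g z * fderiv ℝ f z v := by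
  rw [fderiv_fun_mul hf hg]
  simp

/-- The chain rule is proved by moving the test function, not by approximating `f`. After the change
of variables, `ψ ∘ T_ε` multiplied by the Jacobian or by `ε θ_x` is again a smooth test function on
`Ω`, so the weak gradient of `f` can be used directly. -/
theorem IsSmall.hasWeakGrad_comp_invFun (h : V.IsSmall ε) {Ω : Set (ℝ × ℝ)} (hΩ : IsOpen Ω)
    (hΩ' : IsOpen (V.deform ε '' Ω)) {f : ℝ × ℝ → ℝ} {g : ℝ × ℝ → ℝ × ℝ}
    (hf : HasWeakGrad Ω f g) :
    HasWeakGrad (V.deform ε '' Ω) (fun z => f (Function.invFun (V.deform ε) z))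
      (fun z => V.pushGrad ε g (Function.invFun (V.deform ε) z)) := by
  have Jc : Continuous (V.jac ε) := contDiff_jac.continuous
  have Tc : Continuous (V.deform ε) := contDiff_deform.continuous
  have θxc : Continuous fun z => fderiv ℝ V.θ z (1, 0) :=
    (contDiff_fderiv_apply V.smooth_θ _).continuous
  have pre : ∀ {k}, k ⊆ V.deform ε '' Ω → V.deform ε ⁻¹' k ⊆ Ω := by
    intro k hk z hz
    obtain ⟨w, hw, e⟩ := hk hz
    rwa [← h.injective e]
  have loc : ∀ {E : Type} [NormedAddCommGroup E] [NormedSpace ℝ E] (d : ℝ × ℝ → E),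
      (∀ k ⊆ Ω, IsCompact k → IntegrableOn (fun z => V.jac ε z • d z) k) →
      LocallyIntegrableOn (fun z => d (Function.invFun (V.deform ε) z)) (V.deform ε '' Ω) := by
    intro E _ _ d hd
    rw [locallyIntegrableOn_iff hΩ'.isLocallyClosed]
    intro k hk hkc
    rw [← Set.image_preimage_eq k (V.surjective_deform (ε := ε)),
      h.integrableOn_image (Tc.measurable hkc.measurableSet)]
    simp only [h.invFun_deform]
    exact hd _ (pre hk) (isCompact_preimage_deform hkc)
  refine ⟨loc _ fun k hk hkc => ?_, loc _ fun k hk hkc => ?_, fun ψ a b c => ?_⟩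
  · exact (hf.1.integrableOn_compact_subset hk hkc).continuousOn_smul Jc.continuousOn hkc
  · have i := hf.2.1.integrableOn_compact_subset hk hkc
    have i1 : IntegrableOn (fun z => (g z).1) k := Integrable.fst i
    have i2 : IntegrableOn (fun z => (g z).2) k := Integrable.snd i
    have e : (fun z => V.jac ε z • V.pushGrad ε g z) = fun z =>
        (V.jac ε z * (g z).1 - ε * fderiv ℝ V.θ z (1, 0) * (g z).2, (g z).2) := by
      funext z
      have := (h.jac_pos z).ne'
      ext
      · simp only [pushGrad, Prod.smul_mk, smul_eq_mul]
        field_simp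
      · simp only [pushGrad, Prod.smul_mk, smul_eq_mul]
        field_simp
    rw [e]
    exact Integrable.prodMk ((i1.continuousOn_mul Jc.continuousOn hkc).sub
      (i2.continuousOn_mul (continuous_const.mul θxc).continuousOn hkc)) i2
  · set ψ' : ℝ × ℝ → ℝ := fun w => ψ (V.deform ε w) with hψ'
    have s' : ContDiff ℝ ∞ ψ' := a.comp contDiff_deform
    have ts : tsupport ψ' ⊆ V.deform ε ⁻¹' tsupport ψ :=
      tsupport_comp_subset_preimage ψ Tc
    have sub : tsupport ψ' ⊆ Ω := ts.trans (pre c)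
    have c' : HasCompactSupport ψ' :=
      (isCompact_preimage_deform b).of_isClosed_subset (isClosed_tsupport _) ts
    have t1 := hf.2.2 (fun z => ψ' z * V.jac ε z) (s'.mul contDiff_jac) c'.mul_right
      ((tsupport_mul_subset_left).trans sub)
    have t2 := hf.2.2 (fun z => ψ' z * (ε * fderiv ℝ V.θ z (1, 0)))
      (s'.mul (contDiff_const.mul (contDiff_fderiv_apply V.smooth_θ _))) c'.mul_right
      ((tsupport_mul_subset_left).trans sub)
    have t3 := hf.2.2 ψ' s' c' sub
    have M := hΩ.measurableSet
    have int0 : ∀ {d χ : ℝ × ℝ → ℝ}, LocallyIntegrableOn d Ω → Continuous χ →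
        tsupport χ ⊆ tsupport ψ' → IntegrableOn (fun z => d z * χ z) Ω := fun hd hχ hs =>
      LocallyIntegrableOn.mul_hasCompactSupport M hd hχ
        (c'.of_isClosed_subset (isClosed_tsupport _) hs) (hs.trans sub)
    have int1 : ∀ {χ : ℝ × ℝ → ℝ} (v : ℝ × ℝ), ContDiff ℝ ∞ χ → tsupport χ ⊆ tsupport ψ' →
        IntegrableOn (fun z => f z * fderiv ℝ χ z v) Ω := fun v hχ hs =>
      int0 hf.1 (contDiff_fderiv_apply hχ v).continuous
        ((tsupport_fderiv_apply_subset ℝ v).trans hs)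
    have sJ := (contDiff_jac (V := V) (ε := ε))
    have sθ := (contDiff_fderiv_apply V.smooth_θ (1, 0))
    have sθ' := (contDiff_fderiv_apply V.smooth_θ (0, 1))
    -- The Piola identity: the Jacobian times a transported derivative is in divergence form,
    -- because the terms with `θ_xy` cancel.
    have p1 : ∀ z, V.jac ε z * fderiv ℝ ψ (V.deform ε z) (1, 0) =
        fderiv ℝ (fun z => ψ' z * V.jac ε z) z (1, 0) -
          fderiv ℝ (fun z => ψ' z * (ε * fderiv ℝ V.θ z (1, 0))) z (0, 1) := by
      intro z
      have d1 : DifferentiableAt ℝ ψ' z := s'.differentiable (by simp) z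
      have d2 : DifferentiableAt ℝ (V.jac ε) z := sJ.differentiable (by simp) z
      have d3 : DifferentiableAt ℝ (fun z => fderiv ℝ V.θ z (1, 0)) z :=
        sθ.differentiable (by simp) z
      have d4 : DifferentiableAt ℝ (fun z => fderiv ℝ V.θ z (0, 1)) z :=
        sθ'.differentiable (by simp) z
      have e1 : fderiv ℝ (V.jac ε) z (1, 0) =
          ε * fderiv ℝ (fun z => fderiv ℝ V.θ z (0, 1)) z (1, 0) := by
        have : V.jac ε = fun z => 1 + ε * fderiv ℝ V.θ z (0, 1) := rfl
        rw [this, fderiv_const_add, fderiv_const_mul d4]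
        simp
      rw [fderiv_mul_apply d1 d2, fderiv_mul_apply d1 (d3.const_mul ε), e1,
        fderiv_const_mul d3, smul_apply, smul_eq_mul,
        fderiv_fderiv_apply_comm ((contDiff_infty.1 V.smooth_θ 2).contDiffAt) (1, 0) (0, 1),
        fderiv_comp_deform a, fderiv_comp_deform a]
      ring
    have p2 : ∀ z, V.jac ε z * fderiv ℝ ψ (V.deform ε z) (0, 1) = fderiv ℝ ψ' z (0, 1) := by
      intro z
      rw [fderiv_comp_deform a]
      simp
    rw [h.integral_image M, h.integral_image M, h.integral_image M, h.integral_image M]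
    simp only [h.invFun_deform]
    constructor
    · calc ∫ z in Ω, V.jac ε z * (f z * fderiv ℝ ψ (V.deform ε z) (1, 0))
          = ∫ z in Ω, (f z * fderiv ℝ (fun z => ψ' z * V.jac ε z) z (1, 0) -
              f z * fderiv ℝ (fun z => ψ' z * (ε * fderiv ℝ V.θ z (1, 0))) z (0, 1)) := by
            congr 1
            funext z
            rw [mul_left_comm, p1, mul_sub]
        _ = -((∫ z in Ω, (g z).1 * (ψ' z * V.jac ε z)) -
              ∫ z in Ω, (g z).2 * (ψ' z * (ε * fderiv ℝ V.θ z (1, 0)))) := by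
            rw [integral_sub (int1 _ (s'.mul sJ) tsupport_mul_subset_left)
              (int1 _ (s'.mul (contDiff_const.mul sθ)) tsupport_mul_subset_left), t1.1, t2.2]
            ring
        _ = _ := by
            rw [← integral_sub (int0 (χ := fun z => ψ' z * V.jac ε z)
              (LocallyIntegrableOn.fst hf.2.1) (s'.continuous.mul sJ.continuous) tsupport_mul_subset_left)
              (int0 (χ := fun z => ψ' z * (ε * fderiv ℝ V.θ z (1, 0)))
              (LocallyIntegrableOn.snd hf.2.1)
              (s'.continuous.mul (continuous_const.mul sθ.continuous)) tsupport_mul_subset_left)]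
            congr 2
            funext z
            have := (h.jac_pos z).ne'
            simp only [pushGrad, hψ']
            field_simp
    · calc ∫ z in Ω, V.jac ε z * (f z * fderiv ℝ ψ (V.deform ε z) (0, 1))
          = ∫ z in Ω, f z * fderiv ℝ ψ' z (0, 1) := by
            congr 1
            funext z
            rw [mul_left_comm, p2]
        _ = _ := by
            rw [t3.2]
            congr 2
            funext z
            have := (h.jac_pos z).ne'
            simp only [pushGrad, hψ']
            field_simp

/-- The gradient `∇φ + ε ∇η` of the varied potential in the reference configuration. -/
def variedGrad (V : Variation) (ε : ℝ) (g : ℝ × ℝ → ℝ × ℝ) (z : ℝ × ℝ) : ℝ × ℝ :=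
  ((g z).1 + ε * fderiv ℝ V.η z (1, 0), (g z).2 + ε * fderiv ℝ V.η z (0, 1))

theorem IsSmall.hasWeakGrad_potential (h : V.IsSmall ε) {φ : ℝ × ℝ → ℝ} {ζ : ℝ → ℝ}
    {g : ℝ × ℝ → ℝ × ℝ} (hζ : Continuous ζ) (hφ : HasWeakGrad (fluidInterior ζ) φ g) :
    HasWeakGrad (fluidInterior (V.surface ζ ε)) (V.potential φ ε) (fun z =>
      V.pushGrad ε (V.variedGrad ε g) (Function.invFun (V.deform ε) z)) := by
  have hη : ContDiff ℝ 1 fun z => ε * V.η z :=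
    (contDiff_const.mul V.smooth_η).of_le (by simp)
  have h1 := hφ.add_contDiff (isOpen_fluidInterior hζ) hη.contDiffOn
  have e : (fun z => g z + classicalGrad (fun z => ε * V.η z) z) = V.variedGrad ε g := by
    funext z
    ext <;> simp [variedGrad, classicalGrad, fderiv_const_mul (differentiable_η z)]
  rw [e] at h1
  have h2 := h.hasWeakGrad_comp_invFun (isOpen_fluidInterior hζ)
    (by rw [h.image_fluidInterior]; exact isOpen_fluidInterior (continuous_surface hζ)) h1
  rw [h.image_fluidInterior] at h2
  exact h2

/-- The varied weak gradient, pulled back to the reference configuration. -/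
theorem IsSmall.grad_potential (h : V.IsSmall ε) {φ : ℝ × ℝ → ℝ} {ζ : ℝ → ℝ}
    (hadm : Admissible φ ζ) :
    grad (V.surface ζ ε) (V.potential φ ε) =ᵐ[volume.restrict (fluidInterior (V.surface ζ ε))]
      fun z => V.pushGrad ε (V.variedGrad ε (grad ζ φ)) (Function.invFun (V.deform ε) z) := by
  have hζ := hadm.continuous_surface
  have hζ' := continuous_surface (V := V) (ε := ε) hζ
  have h1 := grad_spec hadm.exists_grad
  rw [interior_fluidDomain hζ] at h1
  have h2 := h.hasWeakGrad_potential hζ h1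
  have h3 := grad_spec (φ := V.potential φ ε) (ζ := V.surface ζ ε)
    (by rw [interior_fluidDomain hζ']; exact ⟨_, h2⟩)
  rw [interior_fluidDomain hζ'] at h3
  exact h3.ae_eq (isOpen_fluidInterior hζ') h2

theorem eventually_isSmall (V : Variation) : ∀ᶠ ε in 𝓝 (0 : ℝ), V.IsSmall ε := by
  have hc : HasCompactSupport fun z => fderiv ℝ V.θ z (0, 1) :=
    V.compact_θ.fderiv_apply (𝕜 := ℝ) _
  obtain ⟨C, hC⟩ := hc.exists_bound_of_continuous (contDiff_fderiv_apply V.smooth_θ _).continuous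
  have hC0 : 0 ≤ C := (norm_nonneg _).trans (hC 0)
  have ht : Tendsto (fun ε : ℝ => |ε| * C) (𝓝 0) (𝓝 0) := by
    have : Continuous fun ε : ℝ => |ε| * C := by fun_prop
    simpa using this.tendsto 0
  filter_upwards [ht.eventually (eventually_le_nhds (by norm_num : (0 : ℝ) < 1 / 2))] with ε hε z
  rw [abs_mul]
  exact (mul_le_mul_of_nonneg_left (hC z) (abs_nonneg _)).trans hε

theorem potential_zero (V : Variation) (φ : ℝ × ℝ → ℝ) : V.potential φ 0 = φ := by
  have e : V.deform 0 = id := by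
    funext z
    simp [deform]
  funext z
  have hz : Function.invFun (id : ℝ × ℝ → ℝ × ℝ) z = z :=
    Function.leftInverse_invFun Function.injective_id z
  simp [potential, e, hz]

theorem surface_zero (V : Variation) (ζ : ℝ → ℝ) : V.surface ζ 0 = ζ := by
  funext x
  simp [surface]

end Variation

/-! ### Slices of the fluid domain -/

section Slices

variable {ζ : ℝ → ℝ} {f : ℝ × ℝ → ℝ}

theorem indicator_fluidInterior_apply (x : ℝ) :
    (fun y => (fluidInterior ζ).indicator f (x, y)) =
      (Set.Ioo 0 (1 + ζ x)).indicator fun y => f (x, y) := by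
  funext y
  simp only [Set.indicator, fluidInterior, Set.mem_ofPred_eq, Set.mem_Ioo]
  congr

theorem setIntegral_fluidInterior (hζ : Continuous ζ) (hf : IntegrableOn f (fluidInterior ζ)) :
    ∫ z in fluidInterior ζ, f z = ∫ x, ∫ y in Set.Ioo 0 (1 + ζ x), f (x, y) := by
  have M := (isOpen_fluidInterior hζ).measurableSet
  rw [← integral_indicator M, Measure.volume_eq_prod, integral_prod]
  · congr 1
    funext x
    rw [indicator_fluidInterior_apply, integral_indicator measurableSet_Ioo]
  · exact (integrable_indicator_iff M).2 hf

theorem ae_integrableOn_slice (hζ : Continuous ζ) (hf : IntegrableOn f (fluidInterior ζ)) :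
    ∀ᵐ x, IntegrableOn (fun y => f (x, y)) (Set.Ioo 0 (1 + ζ x)) := by
  have M := (isOpen_fluidInterior hζ).measurableSet
  have h : Integrable ((fluidInterior ζ).indicator f) (volume.prod volume) :=
    (integrable_indicator_iff M).2 hf
  filter_upwards [h.prod_right_ae] with x hx
  rw [indicator_fluidInterior_apply] at hx
  exact (integrable_indicator_iff measurableSet_Ioo).1 hx

theorem integrable_slice_integral (hζ : Continuous ζ) (hf : IntegrableOn f (fluidInterior ζ)) :
    Integrable fun x => ∫ y in Set.Ioo 0 (1 + ζ x), f (x, y) := by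
  have M := (isOpen_fluidInterior hζ).measurableSet
  have h : Integrable ((fluidInterior ζ).indicator f) (volume.prod volume) :=
    (integrable_indicator_iff M).2 hf
  refine h.integral_prod_left.congr (Eventually.of_forall fun x => ?_)
  simp only
  rw [indicator_fluidInterior_apply, integral_indicator measurableSet_Ioo]

/-- A property valid almost everywhere in the fluid is valid almost everywhere on almost every
vertical segment. -/
theorem ae_slice (hζ : Continuous ζ) {p : ℝ × ℝ → Prop}
    (hp : ∀ᵐ z ∂(volume.restrict (fluidInterior ζ)), p z) :
    ∀ᵐ x, ∀ᵐ y, y ∈ Set.Ioo 0 (1 + ζ x) → p (x, y) := by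
  rw [ae_restrict_iff' (isOpen_fluidInterior hζ).measurableSet, Measure.volume_eq_prod] at hp
  filter_upwards [Measure.ae_ae_of_ae_prod hp] with x hx
  filter_upwards [hx] with y hy hm
  exact hy ⟨hm.1, hm.2⟩

end Slices

/-! ### The expansion of the functionals along a variation -/

/-- A quadratic remainder estimate gives the derivative. -/
theorem hasDerivAt_zero_of_quadratic {F : ℝ → ℝ} {L C : ℝ}
    (h : ∀ᶠ ε in 𝓝 (0 : ℝ), |F ε - F 0 - ε * L| ≤ C * ε ^ 2) : HasDerivAt F L 0 := by
  rw [hasDerivAt_iff_isLittleO]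
  have h1 : (fun ε => F ε - F 0 - (ε - 0) • L) =O[𝓝 0] fun ε : ℝ => ε ^ 2 := by
    refine Asymptotics.IsBigO.of_bound C ?_
    filter_upwards [h] with ε hε
    simpa using hε
  refine h1.trans_isLittleO ?_
  simpa using (Asymptotics.isLittleO_pow_id (𝕜 := ℝ) (n := 2) (by norm_num))

/-- Here `(a, b) = ∇θ`, `(c, d) = ∇η` and `(p, q) = ∇φ` at one point. The bound must be linear in `1
+ p² + q²`, the only quantity whose integrability over the support of the variation is known. -/
theorem kinetic_remainder {a b c d p q ε M : ℝ} (hM : 1 ≤ M) (ha : |a| ≤ M) (hb : |b| ≤ M)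
    (hc : |c| ≤ M) (hd : |d| ≤ M) (hε : |ε| ≤ 1) (hJ : 1 / 2 ≤ 1 + ε * b) :
    |(1 + ε * b) * (1 / 2 * ((p + ε * c - ε * a / (1 + ε * b) * (q + ε * d)) ^ 2 +
        ((q + ε * d) / (1 + ε * b)) ^ 2 - 1)) - 1 / 2 * (p ^ 2 + q ^ 2 - 1) -
      ε * (p * c + q * d + 1 / 2 * (b * (p ^ 2 - q ^ 2 - 1) - 2 * a * p * q))| ≤
    15 * M ^ 4 * (1 + p ^ 2 + q ^ 2) * ε ^ 2 := by
  have hJ0 : (1 + ε * b) ≠ 0 := by linarith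
  have hM0 : 0 ≤ M := by linarith
  set S := 1 + p ^ 2 + q ^ 2 with hS
  have S1 : 1 ≤ S := by nlinarith [sq_nonneg p, sq_nonneg q]
  have S0 : 0 ≤ S := by linarith
  have hp : |p| ≤ S := by
    rw [abs_le]
    constructor <;> nlinarith [sq_nonneg q, sq_nonneg (p - 1), sq_nonneg (p + 1)]
  have hq : |q| ≤ S := by
    rw [abs_le]
    constructor <;> nlinarith [sq_nonneg p, sq_nonneg (q - 1), sq_nonneg (q + 1)]
  -- The expansion is exact: all terms of order zero and one cancel, and a single quotient by the
  -- Jacobian is left.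
  have key : (1 + ε * b) * (1 / 2 * ((p + ε * c - ε * a / (1 + ε * b) * (q + ε * d)) ^ 2 +
        ((q + ε * d) / (1 + ε * b)) ^ 2 - 1)) - 1 / 2 * (p ^ 2 + q ^ 2 - 1) -
      ε * (p * c + q * d + 1 / 2 * (b * (p ^ 2 - q ^ 2 - 1) - 2 * a * p * q)) =
      (b * c * p + (1 / 2) * (c * c * 1) + (1 / 2) * (ε * b * c * c) - a * d * p - a * c * q
        - ε * a * c * d + (1 / 2) * (d * d * 1) - b * d * q - (1 / 2) * (ε * b * d * d)
        + (1 / 2) * ((a ^ 2 + b ^ 2) / (1 + ε * b) * (q + ε * d) ^ 2)) * ε ^ 2 := by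
    field_simp
    ring
  rw [key, abs_mul, abs_of_nonneg (sq_nonneg ε)]
  refine mul_le_mul_of_nonneg_right ?_ (sq_nonneg ε)
  have t3 : ∀ {u v w : ℝ}, |u| ≤ M → |v| ≤ M → |w| ≤ S → |u * v * w| ≤ M ^ 4 * S := by
    intro u v w hu hv hw
    rw [abs_mul, abs_mul]
    calc |u| * |v| * |w| ≤ M * M * S := by gcongr
      _ = M ^ 2 * S := by ring
      _ ≤ M ^ 4 * S := by
        gcongr
        norm_num
  have t4 : ∀ {u v w : ℝ}, |u| ≤ M → |v| ≤ M → |w| ≤ M → |ε * u * v * w| ≤ M ^ 4 * S := by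
    intro u v w hu hv hw
    rw [abs_mul, abs_mul, abs_mul]
    calc |ε| * |u| * |v| * |w| ≤ 1 * M * M * M := by gcongr
      _ = M ^ 3 * 1 := by ring
      _ ≤ M ^ 4 * S := by
        gcongr
        norm_num
  have one_S : |(1 : ℝ)| ≤ S := by rwa [abs_one]
  have sq_le : ∀ {u : ℝ}, |u| ≤ M → u ^ 2 ≤ M ^ 2 := by
    intro u hu
    rw [← sq_abs]
    gcongr
  have t5 : |(a ^ 2 + b ^ 2) / (1 + ε * b) * (q + ε * d) ^ 2| ≤ 16 * (M ^ 4 * S) := by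
    rw [abs_of_nonneg (by positivity)]
    have u1 : (a ^ 2 + b ^ 2) / (1 + ε * b) ≤ 4 * M ^ 2 := by
      rw [div_le_iff₀ (by linarith)]
      linarith [sq_le ha, sq_le hb,
        mul_le_mul_of_nonneg_left hJ (by positivity : 0 ≤ 4 * M ^ 2)]
    have u2 : (ε * d) ^ 2 ≤ M ^ 2 := by
      rw [mul_pow]
      have : ε ^ 2 ≤ 1 := by rw [← sq_abs]; exact pow_le_one₀ (abs_nonneg _) hε
      calc ε ^ 2 * d ^ 2 ≤ 1 * M ^ 2 := by gcongr ?_ * ?_; exact sq_le hd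
        _ = M ^ 2 := one_mul _
    have hM2 : 1 ≤ M ^ 2 := one_le_pow₀ hM
    have u3 : (q + ε * d) ^ 2 ≤ 4 * (M ^ 2 * S) := by
      have e1 : q ^ 2 ≤ M ^ 2 * S := by
        calc q ^ 2 ≤ 1 * S := by rw [hS]; linarith [sq_nonneg p]
          _ ≤ M ^ 2 * S := by gcongr
      have e2 : M ^ 2 ≤ M ^ 2 * S := le_mul_of_one_le_right (sq_nonneg M) S1
      linarith [sq_nonneg (q - ε * d)]
    calc _ ≤ (4 * M ^ 2) * (4 * (M ^ 2 * S)) := by gcongr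
      _ = _ := by ring
  have b1 := abs_le.1 (t3 hb hc hp)
  have b2 := abs_le.1 (t3 hc hc one_S)
  have b3 := abs_le.1 (t4 hb hc hc)
  have b4 := abs_le.1 (t3 ha hd hp)
  have b5 := abs_le.1 (t3 ha hc hq)
  have b6 := abs_le.1 (t4 ha hc hd)
  have b7 := abs_le.1 (t3 hd hd one_S)
  have b8 := abs_le.1 (t3 hb hd hq)
  have b9 := abs_le.1 (t4 hb hd hd)
  have b10 := abs_le.1 t5
  -- The nine polynomial terms, with their factors `1` or `1/2`, contribute 7 and the quotient
  -- contributes half of 16; hence the constant 15.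
  rw [abs_le]
  constructor
  · linarith [b1.1, b2.1, b3.1, b4.2, b5.2, b6.2, b7.1, b8.2, b9.2, b10.1]
  · linarith [b1.2, b2.2, b3.2, b4.1, b5.1, b6.1, b7.2, b8.1, b9.1, b10.2]

theorem Admissible.hasWeakGrad {φ : ℝ × ℝ → ℝ} {ζ : ℝ → ℝ} (hadm : Admissible φ ζ) :
    HasWeakGrad (fluidInterior ζ) φ (grad ζ φ) := by
  have h := grad_spec hadm.exists_grad
  rwa [interior_fluidDomain hadm.continuous_surface] at h

theorem Admissible.aestronglyMeasurable_grad {φ : ℝ × ℝ → ℝ} {ζ : ℝ → ℝ} (hadm : Admissible φ ζ) :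
    AEStronglyMeasurable (grad ζ φ) (volume.restrict (fluidInterior ζ)) :=
  hadm.hasWeakGrad.2.1.aestronglyMeasurable

/-- The energy is finite on parts of the fluid of finite area. -/
theorem Admissible.integrableOn_sq {φ : ℝ × ℝ → ℝ} {ζ : ℝ → ℝ} (hadm : Admissible φ ζ)
    {s : Set (ℝ × ℝ)} (hs : s ⊆ fluidInterior ζ) (hfin : volume s < ⊤) :
    IntegrableOn (fun z => 1 + (grad ζ φ z).1 ^ 2 + (grad ζ φ z).2 ^ 2) s := by
  have h1 : IntegrableOn (fun z => ((grad ζ φ z).1 - 1) ^ 2 + (grad ζ φ z).2 ^ 2) s :=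
    hadm.finite_energy.mono_set (hs.trans (fluidInterior_subset ζ))
  -- The majorant is `3 + 2 ((p - 1)² + q²)`, which exceeds `1 + p² + q²` by `(p - 2)² + q²`.
  have h2 : IntegrableOn (fun _ : ℝ × ℝ => (3 : ℝ)) s := integrableOn_const hfin.ne
  have m : AEStronglyMeasurable (grad ζ φ) (volume.restrict s) :=
    hadm.aestronglyMeasurable_grad.mono_measure (Measure.restrict_mono_set _ hs)
  refine (h2.add (h1.const_mul 2)).mono' ?_ (Eventually.of_forall fun z => ?_)
  · exact (aestronglyMeasurable_const.add (m.fst.pow 2)).add (m.snd.pow 2)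
  · rw [Real.norm_eq_abs, abs_of_nonneg (by positivity)]
    simp only [Pi.add_apply]
    nlinarith [sq_nonneg ((grad ζ φ z).1 - 2), sq_nonneg (grad ζ φ z).2]

namespace Variation

variable (V : Variation)

/-- The kinetic energy density of the varied pair, pulled back to the reference configuration. -/
def pulledKinetic (ε : ℝ) (g : ℝ × ℝ → ℝ × ℝ) (z : ℝ × ℝ) : ℝ :=
  V.jac ε z * (1 / 2 * ((V.pushGrad ε (V.variedGrad ε g) z).1 ^ 2 +
    (V.pushGrad ε (V.variedGrad ε g) z).2 ^ 2 - 1))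

/-- The first variation of the kinetic energy density at a pair with velocity `g`. -/
def kineticVariationDensity (g : ℝ × ℝ → ℝ × ℝ) (z : ℝ × ℝ) : ℝ :=
  (g z).1 * fderiv ℝ V.η z (1, 0) + (g z).2 * fderiv ℝ V.η z (0, 1) +
    1 / 2 * (fderiv ℝ V.θ z (0, 1) * ((g z).1 ^ 2 - (g z).2 ^ 2 - 1) -
      2 * fderiv ℝ V.θ z (1, 0) * (g z).1 * (g z).2)

theorem exists_bound : ∃ M, 1 ≤ M ∧ ∀ z,
    |fderiv ℝ V.θ z (1, 0)| ≤ M ∧ |fderiv ℝ V.θ z (0, 1)| ≤ M ∧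
      |fderiv ℝ V.η z (1, 0)| ≤ M ∧ |fderiv ℝ V.η z (0, 1)| ≤ M := by
  have key : ∀ {f : ℝ × ℝ → ℝ}, ContDiff ℝ ∞ f → HasCompactSupport f → ∀ v,
      ∃ C, ∀ z, |fderiv ℝ f z v| ≤ C := fun hf hc v =>
    HasCompactSupport.exists_bound_of_continuous (hc.fderiv_apply (𝕜 := ℝ) v)
      (contDiff_fderiv_apply hf v).continuous
  obtain ⟨A, hA⟩ := key V.smooth_θ V.compact_θ (1, 0)
  obtain ⟨B, hB⟩ := key V.smooth_θ V.compact_θ (0, 1)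
  obtain ⟨C, hC⟩ := key V.smooth_η V.compact_η (1, 0)
  obtain ⟨D, hD⟩ := key V.smooth_η V.compact_η (0, 1)
  refine ⟨1 + |A| + |B| + |C| + |D|, ?_, fun z => ⟨?_, ?_, ?_, ?_⟩⟩
  · linarith [abs_nonneg A, abs_nonneg B, abs_nonneg C, abs_nonneg D]
  all_goals
    linarith [abs_nonneg A, abs_nonneg B, abs_nonneg C, abs_nonneg D, hA z, hB z, hC z, hD z,
      le_abs_self A, le_abs_self B, le_abs_self C, le_abs_self D]

/-- The set outside of which a variation does nothing. -/
def carrier : Set (ℝ × ℝ) := tsupport V.θ ∪ tsupport V.η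

theorem isCompact_carrier : IsCompact V.carrier := IsCompact.union V.compact_θ V.compact_η

theorem fderiv_eq_zero_of_notMem_carrier {z : ℝ × ℝ} (hz : z ∉ V.carrier) :
    fderiv ℝ V.θ z = 0 ∧ fderiv ℝ V.η z = 0 := by
  constructor
  · exact image_eq_zero_of_notMem_tsupport fun h => hz (Or.inl (tsupport_fderiv_subset ℝ h))
  · exact image_eq_zero_of_notMem_tsupport fun h => hz (Or.inr (tsupport_fderiv_subset ℝ h))

variable {φ : ℝ × ℝ → ℝ} {ζ : ℝ → ℝ}

/-- The common majorant of all integrands produced by a variation. The cut-off is essential: over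
the whole fluid `1 + |∇φ|²` has infinite integral, since `∇φ` approaches `(1, 0)` in the mean square
sense. -/
theorem integrableOn_carrier_indicator (hadm : Admissible φ ζ) :
    IntegrableOn (V.carrier.indicator
      fun z => 1 + (grad ζ φ z).1 ^ 2 + (grad ζ φ z).2 ^ 2) (fluidInterior ζ) := by
  rw [IntegrableOn, integrable_indicator_iff V.isCompact_carrier.measurableSet, IntegrableOn,
    Measure.restrict_restrict V.isCompact_carrier.measurableSet]
  exact hadm.integrableOn_sq Set.inter_subset_right
    ((measure_mono Set.inter_subset_left).trans_lt V.isCompact_carrier.measure_lt_top)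

theorem aestronglyMeasurable_kineticVariationDensity (hadm : Admissible φ ζ) :
    AEStronglyMeasurable (V.kineticVariationDensity (grad ζ φ))
      (volume.restrict (fluidInterior ζ)) := by
  have m := hadm.aestronglyMeasurable_grad
  have m1 := m.fst
  have m2 := m.snd
  have c : ∀ {f : ℝ × ℝ → ℝ}, ContDiff ℝ ∞ f → ∀ v, AEStronglyMeasurable
      (fun z => fderiv ℝ f z v) (volume.restrict (fluidInterior ζ)) := fun hf v =>
    (contDiff_fderiv_apply hf v).continuous.aestronglyMeasurable
  exact ((m1.mul (c V.smooth_η _)).add (m2.mul (c V.smooth_η _))).add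
    ((((c V.smooth_θ _).mul (((m1.pow 2).sub (m2.pow 2)).sub aestronglyMeasurable_const)).sub
      (((((c V.smooth_θ _).const_mul 2)).mul m1).mul m2)).const_mul _)

theorem integrableOn_kineticVariationDensity (hadm : Admissible φ ζ) :
    IntegrableOn (V.kineticVariationDensity (grad ζ φ)) (fluidInterior ζ) := by
  obtain ⟨M, hM, hb⟩ := V.exists_bound
  refine ((V.integrableOn_carrier_indicator hadm).const_mul (5 * M)).mono'
    (V.aestronglyMeasurable_kineticVariationDensity hadm) (Eventually.of_forall fun z => ?_)
  by_cases hz : z ∈ V.carrier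
  · rw [Set.indicator_of_mem hz, Real.norm_eq_abs, kineticVariationDensity]
    obtain ⟨ha, hb, hc, hd⟩ := hb z
    generalize fderiv ℝ V.θ z (1, 0) = a at *
    generalize fderiv ℝ V.θ z (0, 1) = b at *
    generalize fderiv ℝ V.η z (1, 0) = c at *
    generalize fderiv ℝ V.η z (0, 1) = d at *
    generalize (grad ζ φ z).1 = p
    generalize (grad ζ φ z).2 = q
    have e1 : |p * c| ≤ (1 + p ^ 2 + q ^ 2) * M := by
      rw [abs_mul]
      gcongr
      rw [abs_le]
      constructor <;> nlinarith [sq_nonneg q, sq_nonneg (p - 1), sq_nonneg (p + 1)]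
    have e2 : |q * d| ≤ (1 + p ^ 2 + q ^ 2) * M := by
      rw [abs_mul]
      gcongr
      rw [abs_le]
      constructor <;> nlinarith [sq_nonneg p, sq_nonneg (q - 1), sq_nonneg (q + 1)]
    have e3 : |b * (p ^ 2 - q ^ 2 - 1)| ≤ M * (1 + p ^ 2 + q ^ 2) := by
      rw [abs_mul]
      gcongr
      rw [abs_le]
      constructor <;> nlinarith [sq_nonneg p, sq_nonneg q]
    have e4 : |a * (p * q)| ≤ M * (1 + p ^ 2 + q ^ 2) := by
      rw [abs_mul]
      gcongr
      rw [abs_le]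
      constructor <;> nlinarith [sq_nonneg (p - q), sq_nonneg (p + q)]
    rw [abs_le] at *
    constructor <;> linarith [e1.1, e1.2, e2.1, e2.2, e3.1, e3.2, e4.1, e4.2]
  · have h := V.fderiv_eq_zero_of_notMem_carrier hz
    simp [kineticVariationDensity, h.1, h.2, hz]

theorem aestronglyMeasurable_pulledKinetic (hadm : Admissible φ ζ) {ε : ℝ} :
    AEStronglyMeasurable (V.pulledKinetic ε (grad ζ φ)) (volume.restrict (fluidInterior ζ)) := by
  have m := hadm.aestronglyMeasurable_grad
  have c : ∀ {f : ℝ × ℝ → ℝ}, ContDiff ℝ ∞ f → ∀ v, AEStronglyMeasurable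
      (fun z => fderiv ℝ f z v) (volume.restrict (fluidInterior ζ)) := fun hf v =>
    (contDiff_fderiv_apply hf v).continuous.aestronglyMeasurable
  have m1 := m.fst.add ((c V.smooth_η (1, 0)).const_mul ε)
  have m2 := m.snd.add ((c V.smooth_η (0, 1)).const_mul ε)
  have J : AEStronglyMeasurable (V.jac ε) (volume.restrict (fluidInterior ζ)) :=
    (contDiff_jac (V := V)).continuous.aestronglyMeasurable
  have c1 := m1.sub ((((c V.smooth_θ (1, 0)).const_mul ε).div₀ J).mul m2)
  have c2 := m2.div₀ J
  exact J.mul ((((c1.pow 2).add (c2.pow 2)).sub aestronglyMeasurable_const).const_mul _)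

/-- The remainder of the first order expansion of the pulled back kinetic energy density. -/
def kineticRemainder (ε : ℝ) (g : ℝ × ℝ → ℝ × ℝ) (z : ℝ × ℝ) : ℝ :=
  V.pulledKinetic ε g z - 1 / 2 * ((g z).1 ^ 2 + (g z).2 ^ 2 - 1) -
    ε * V.kineticVariationDensity g z

/-- The pointwise estimate holds with one majorant for all small `ε`, and off the carrier the
remainder is identically zero. -/
theorem exists_kineticRemainder_bound (hadm : Admissible φ ζ) :
    ∃ C, ∀ ε, |ε| ≤ 1 → V.IsSmall ε →
      IntegrableOn (V.kineticRemainder ε (grad ζ φ)) (fluidInterior ζ) ∧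
      |∫ z in fluidInterior ζ, V.kineticRemainder ε (grad ζ φ) z| ≤ C * ε ^ 2 := by
  obtain ⟨M, hM, hb⟩ := V.exists_bound
  have I := V.integrableOn_carrier_indicator hadm
  set B := V.carrier.indicator fun z => 1 + (grad ζ φ z).1 ^ 2 + (grad ζ φ z).2 ^ 2 with hB
  refine ⟨15 * M ^ 4 * ∫ z in fluidInterior ζ, B z, fun ε hε hs => ?_⟩
  have pw : ∀ z, ‖V.kineticRemainder ε (grad ζ φ) z‖ ≤ 15 * M ^ 4 * ε ^ 2 * B z := by
    intro z
    by_cases hz : z ∈ V.carrier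
    · rw [hB, Set.indicator_of_mem hz]
      have h := kinetic_remainder (p := (grad ζ φ z).1) (q := (grad ζ φ z).2) hM (hb z).1
        (hb z).2.1 (hb z).2.2.1 (hb z).2.2.2 hε (hs.half_le_jac z)
      calc _ ≤ 15 * M ^ 4 * (1 + (grad ζ φ z).1 ^ 2 + (grad ζ φ z).2 ^ 2) * ε ^ 2 := h
        _ = _ := by ring
    · have h := V.fderiv_eq_zero_of_notMem_carrier hz
      simp [kineticRemainder, pulledKinetic, jac, pushGrad, variedGrad, kineticVariationDensity,
        h.1, h.2, hB, hz]
  have m : AEStronglyMeasurable (V.kineticRemainder ε (grad ζ φ))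
      (volume.restrict (fluidInterior ζ)) := by
    have m1 := hadm.aestronglyMeasurable_grad.fst
    have m2 := hadm.aestronglyMeasurable_grad.snd
    exact ((V.aestronglyMeasurable_pulledKinetic hadm).sub
      ((((m1.pow 2).add (m2.pow 2)).sub aestronglyMeasurable_const).const_mul _)).sub
      ((V.aestronglyMeasurable_kineticVariationDensity hadm).const_mul ε)
  refine ⟨(I.const_mul _).mono' m (Eventually.of_forall pw), ?_⟩
  refine (norm_integral_le_of_norm_le (I.const_mul (15 * M ^ 4 * ε ^ 2))
    (Eventually.of_forall pw)).trans (le_of_eq ?_)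
  rw [integral_const_mul]
  ring

end Variation

/-- The function `½ s₊²` has the derivative `s₊`, which is Lipschitz with constant 1. This replaces
a second derivative at `s = 0`. -/
theorem half_sq_posPart_remainder (s t : ℝ) :
    |1 / 2 * max (s + t) 0 ^ 2 - 1 / 2 * max s 0 ^ 2 - t * max s 0| ≤ 1 / 2 * t ^ 2 := by
  rw [abs_le]
  rcases le_total 0 s with h1 | h1 <;> rcases le_total 0 (s + t) with h2 | h2 <;>
    simp only [max_eq_left, max_eq_right, h1, h2] <;> constructor <;> nlinarith [sq_nonneg (s + t)]

theorem hasDerivAt_half_sq_posPart (s : ℝ) :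
    HasDerivAt (fun s : ℝ => 1 / 2 * max s 0 ^ 2) (max s 0) s := by
  have h : HasDerivAt (fun t : ℝ => 1 / 2 * max (s + t) 0 ^ 2) (max s 0) 0 :=
    hasDerivAt_zero_of_quadratic (C := 1 / 2) (Eventually.of_forall fun t => by
      simpa using half_sq_posPart_remainder s t)
  have h' : HasDerivAt (fun t : ℝ => 1 / 2 * max (s + t) 0 ^ 2) (max s 0) (s - s) := by
    rwa [sub_self]
  simpa using h'.comp_sub_const s s

/-- Fundamental theorem of calculus on an open interval. -/
theorem integral_Ioo_of_hasDerivAt {f f' : ℝ → ℝ} {a b : ℝ} (hab : a ≤ b)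
    (hf : ∀ y, HasDerivAt f (f' y) y) (hf' : Continuous f') :
    ∫ y in Set.Ioo a b, f' y = f b - f a := by
  rw [← integral_Ioc_eq_integral_Ioo, ← intervalIntegral.integral_of_le hab]
  exact intervalIntegral.integral_eq_sub_of_hasDerivAt (fun y _ => hf y)
    (hf'.intervalIntegrable _ _)

namespace Variation

variable (V : Variation) {φ : ℝ × ℝ → ℝ} {ζ : ℝ → ℝ}

/-- The variation `δζ (x) = θ(x, 1 + ζ x)` of the free surface. -/
def surfaceVariation (ζ : ℝ → ℝ) (x : ℝ) : ℝ := V.θ (x, 1 + ζ x)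

theorem continuous_surfaceVariation (hζ : Continuous ζ) : Continuous (V.surfaceVariation ζ) := by
  have := V.smooth_θ.continuous
  unfold surfaceVariation
  fun_prop

theorem hasCompactSupport_surfaceVariation : HasCompactSupport (V.surfaceVariation ζ) := by
  refine HasCompactSupport.intro (K := Prod.fst '' tsupport V.θ)
    (IsCompact.image V.compact_θ continuous_fst) fun x hx => ?_
  exact image_eq_zero_of_notMem_tsupport (f := V.θ) fun h => hx ⟨(x, 1 + ζ x), h, rfl⟩

theorem integrable_mul_surfaceVariation (hζ : Continuous ζ) {f : ℝ → ℝ} (hf : Continuous f) :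
    Integrable fun x => f x * V.surfaceVariation ζ x :=
  (hf.mul (V.continuous_surfaceVariation hζ)).integrable_of_hasCompactSupport
    V.hasCompactSupport_surfaceVariation.mul_left

/-- The change of the density `(y - 1)₊` along the variation, in the reference configuration. -/
def potentialChange (ε : ℝ) (z : ℝ × ℝ) : ℝ :=
  V.jac ε z * max ((V.deform ε z).2 - 1) 0 - max (z.2 - 1) 0

theorem continuous_potentialChange (ε : ℝ) : Continuous (V.potentialChange ε) := by
  have J : Continuous (V.jac ε) := contDiff_jac.continuous
  have T : Continuous (V.deform ε) := contDiff_deform.continuous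
  exact (J.mul ((T.snd.sub continuous_const).max continuous_const)).sub
    ((continuous_snd.sub continuous_const).max continuous_const)

theorem integrable_potentialChange (ε : ℝ) : Integrable (V.potentialChange ε) := by
  refine (V.continuous_potentialChange ε).integrable_of_hasCompactSupport ?_
  refine HasCompactSupport.intro V.isCompact_carrier fun z hz => ?_
  have h1 := (V.fderiv_eq_zero_of_notMem_carrier hz).1
  have h2 : V.θ z = 0 := image_eq_zero_of_notMem_tsupport fun h => hz (Or.inl h)
  simp [potentialChange, jac, deform, h1, h2]

/-- The integrand is the `y`-derivative of `½ (y + ε θ - 1)₊² - ½ (y - 1)₊²`. This primitive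
vanishes at `y = 0`, because the bottom is fixed, and its value at the top involves only the
surface. -/
theorem integral_potentialChange (hζ : Continuous ζ) (hpos : ∀ x, 0 < 1 + ζ x) (ε : ℝ) :
    ∫ z in fluidInterior ζ, V.potentialChange ε z =
      ∫ x, (1 / 2 * max (ζ x + ε * V.surfaceVariation ζ x) 0 ^ 2 - 1 / 2 * max (ζ x) 0 ^ 2) := by
  rw [setIntegral_fluidInterior hζ (V.integrable_potentialChange ε).integrableOn]
  congr 1
  funext x
  have hd : ∀ y, HasDerivAt (fun y => 1 / 2 * max (y + ε * V.θ (x, y) - 1) 0 ^ 2 -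
      1 / 2 * max (y - 1) 0 ^ 2) (V.potentialChange ε (x, y)) y := by
    intro y
    have h1 : HasDerivAt (fun y : ℝ => (x, y)) ((0 : ℝ), (1 : ℝ)) y :=
      (hasDerivAt_const y x).prodMk (hasDerivAt_id y)
    have h2 := (differentiable_θ (V := V) (x, y)).hasFDerivAt.comp_hasDerivAt y h1
    have h3 : HasDerivAt (fun y => y + ε * V.θ (x, y) - 1) (V.jac ε (x, y)) y :=
      ((hasDerivAt_id y).add (h2.const_mul ε)).sub_const 1
    have h4 := (hasDerivAt_half_sq_posPart (y + ε * V.θ (x, y) - 1)).comp y h3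
    have h5 := (hasDerivAt_half_sq_posPart (y - 1)).comp y ((hasDerivAt_id y).sub_const 1)
    refine (h4.sub h5).congr_deriv ?_
    simp only [potentialChange, deform]
    ring
  rw [integral_Ioo_of_hasDerivAt (hpos x).le hd
    ((V.continuous_potentialChange ε).comp (by fun_prop))]
  simp only [V.bottom_fixed, surfaceVariation]
  have e1 : 1 + ζ x + ε * V.θ (x, 1 + ζ x) - 1 = ζ x + ε * V.θ (x, 1 + ζ x) := by ring
  rw [e1, add_sub_cancel_left]
  simp

theorem abs_integral_potentialChange_sub_le (hζ : Continuous ζ) (hpos : ∀ x, 0 < 1 + ζ x)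
    (ε : ℝ) :
    |(∫ z in fluidInterior ζ, V.potentialChange ε z) -
        ε * ∫ x, max (ζ x) 0 * V.surfaceVariation ζ x| ≤
      (1 / 2 * ∫ x, V.surfaceVariation ζ x * V.surfaceVariation ζ x) * ε ^ 2 := by
  have c := V.continuous_surfaceVariation hζ
  have i1 : Integrable fun x => 1 / 2 * max (ζ x + ε * V.surfaceVariation ζ x) 0 ^ 2 -
      1 / 2 * max (ζ x) 0 ^ 2 := by
    refine Continuous.integrable_of_hasCompactSupport (by fun_prop) ?_
    refine HasCompactSupport.intro (V.hasCompactSupport_surfaceVariation (ζ := ζ)) fun x hx => ?_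
    rw [image_eq_zero_of_notMem_tsupport hx]
    simp
  have i2 : Integrable fun x => max (ζ x) 0 * V.surfaceVariation ζ x :=
    V.integrable_mul_surfaceVariation hζ (by fun_prop)
  have i3 := V.integrable_mul_surfaceVariation hζ c
  rw [V.integral_potentialChange hζ hpos, ← integral_const_mul, ← integral_sub i1 (i2.const_mul ε)]
  refine (norm_integral_le_of_norm_le (G := ℝ) (i3.const_mul (1 / 2 * ε ^ 2))
    (Eventually.of_forall fun x => ?_)).trans (le_of_eq ?_)
  · refine le_trans (le_of_eq ?_) ((half_sq_posPart_remainder (ζ x)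
      (ε * V.surfaceVariation ζ x)).trans (le_of_eq ?_))
    · rw [Real.norm_eq_abs]
      congr 1
      ring
    · ring
  · rw [integral_const_mul]
    ring

/-- The varied energy as an integral over the reference configuration. -/
theorem hamiltonian_potential_surface (lam : ℝ) (hadm : Admissible φ ζ) {ε : ℝ}
    (h : V.IsSmall ε) :
    hamiltonian lam (V.potential φ ε) (V.surface ζ ε) = ∫ z in fluidInterior ζ,
      (V.pulledKinetic ε (grad ζ φ) z +
        lam * (V.jac ε z * max ((V.deform ε z).2 - 1) 0)) := by
  have hζ := hadm.continuous_surface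
  have e : ∀ᵐ z ∂(volume.restrict (fluidInterior (V.surface ζ ε))),
      energyDensity lam (V.potential φ ε) (V.surface ζ ε) z =
        1 / 2 * ((V.pushGrad ε (V.variedGrad ε (grad ζ φ))
            (Function.invFun (V.deform ε) z)).1 ^ 2 +
          (V.pushGrad ε (V.variedGrad ε (grad ζ φ))
            (Function.invFun (V.deform ε) z)).2 ^ 2 - 1) + lam * max (z.2 - 1) 0 := by
    filter_upwards [h.grad_potential hadm] with z hz
    rw [energyDensity, kineticDensity, hz]
  rw [hamiltonian, restrict_fluidDomain (continuous_surface hζ), integral_congr_ae e,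
    ← h.image_fluidInterior, h.integral_image (isOpen_fluidInterior hζ).measurableSet]
  congr 1
  funext z
  rw [h.invFun_deform, pulledKinetic]
  ring

variable (φ ζ) in
/-- The first variation of the kinetic energy. -/
def kineticVariation : ℝ := ∫ z in fluidInterior ζ, V.kineticVariationDensity (grad ζ φ) z

theorem hasDerivAt_hamiltonian (lam : ℝ) (hadm : Admissible φ ζ)
    (hfin : HamiltonianFinite lam φ ζ) :
    HasDerivAt (fun ε => hamiltonian lam (V.potential φ ε) (V.surface ζ ε))
      (V.kineticVariation φ ζ + lam * ∫ x, max (ζ x) 0 * V.surfaceVariation ζ x) 0 := by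
  have hζ := hadm.continuous_surface
  obtain ⟨C, hC⟩ := V.exists_kineticRemainder_bound hadm
  set D := 1 / 2 * ∫ x, V.surfaceVariation ζ x * V.surfaceVariation ζ x with hD
  refine hasDerivAt_zero_of_quadratic (C := C + |lam| * D) ?_
  have hε1 : ∀ᶠ ε in 𝓝 (0 : ℝ), |ε| ≤ 1 := by
    have : Tendsto (fun ε : ℝ => |ε|) (𝓝 0) (𝓝 0) := by
      simpa using (continuous_abs (G := ℝ)).tendsto 0
    exact this.eventually (eventually_le_nhds one_pos)
  filter_upwards [V.eventually_isSmall, hε1] with ε hs h1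
  obtain ⟨iR, bR⟩ := hC ε h1 hs
  have iE : IntegrableOn (energyDensity lam φ ζ) (fluidInterior ζ) :=
    hfin.mono_set (fluidInterior_subset ζ)
  have iK := V.integrableOn_kineticVariationDensity hadm
  have iP : IntegrableOn (V.potentialChange ε) (fluidInterior ζ) :=
    (V.integrable_potentialChange ε).integrableOn
  have iEK : IntegrableOn (fun z => energyDensity lam φ ζ z +
      ε * V.kineticVariationDensity (grad ζ φ) z) (fluidInterior ζ) := iE.add (iK.const_mul ε)
  have iEKR : IntegrableOn (fun z => energyDensity lam φ ζ z +
      ε * V.kineticVariationDensity (grad ζ φ) z + V.kineticRemainder ε (grad ζ φ) z)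
      (fluidInterior ζ) := iEK.add iR
  have e0 : hamiltonian lam (V.potential φ 0) (V.surface ζ 0) =
      ∫ z in fluidInterior ζ, energyDensity lam φ ζ z := by
    rw [potential_zero, surface_zero, hamiltonian, restrict_fluidDomain hζ]
  -- Only the sum of kinetic and potential densities is assumed integrable, so the energy is not
  -- split into two integrals. The changes are added to the total density instead.
  have e1 : hamiltonian lam (V.potential φ ε) (V.surface ζ ε) =
      (∫ z in fluidInterior ζ, energyDensity lam φ ζ z) + ε * V.kineticVariation φ ζ +
        (∫ z in fluidInterior ζ, V.kineticRemainder ε (grad ζ φ) z) +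
        lam * ∫ z in fluidInterior ζ, V.potentialChange ε z := by
    rw [V.hamiltonian_potential_surface lam hadm hs, kineticVariation, ← integral_const_mul,
      ← integral_const_mul, ← integral_add iE (iK.const_mul ε),
      ← integral_add iEK iR,
      ← integral_add iEKR (iP.const_mul lam)]
    congr 1
    funext z
    simp only [kineticRemainder, potentialChange, energyDensity, kineticDensity]
    ring
  have bP := V.abs_integral_potentialChange_sub_le hζ hadm.depth_pos ε
  rw [← hD] at bP
  rw [e0, e1]
  have split : ∀ E K R P Q : ℝ, E + ε * K + R + lam * P - E - ε * (K + lam * Q) =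
      R + lam * (P - ε * Q) := by
    intros
    ring
  rw [split]
  calc _ ≤ C * ε ^ 2 + |lam| * (D * ε ^ 2) := by
        refine (abs_add_le _ _).trans (add_le_add bR ?_)
        rw [abs_mul]
        gcongr
    _ = _ := by ring

/-- The integral is exactly a quadratic polynomial in `ε`; integrability of `ζ²` is needed only for
its constant term. -/
theorem hasDerivAt_integral_sq_surface (hζ : Continuous ζ) (hint : Integrable fun x => ζ x ^ 2) :
    HasDerivAt (fun ε => ∫ x, V.surface ζ ε x ^ 2)
      (2 * ∫ x, ζ x * V.surfaceVariation ζ x) 0 := by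
  have i1 := V.integrable_mul_surfaceVariation hζ hζ
  have i2 := V.integrable_mul_surfaceVariation hζ (V.continuous_surfaceVariation hζ)
  have e : ∀ ε, ∫ x, V.surface ζ ε x ^ 2 = (∫ x, ζ x ^ 2) +
      ε * (2 * ∫ x, ζ x * V.surfaceVariation ζ x) +
      ε ^ 2 * ∫ x, V.surfaceVariation ζ x * V.surfaceVariation ζ x := by
    intro ε
    have i3 : Integrable fun x => ζ x ^ 2 + ε * (2 * (ζ x * V.surfaceVariation ζ x)) :=
      hint.add ((i1.const_mul 2).const_mul ε)
    rw [← integral_const_mul, ← integral_const_mul, ← integral_const_mul,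
      ← integral_add hint ((i1.const_mul 2).const_mul ε),
      ← integral_add i3 (i2.const_mul _)]
    congr 1
    funext x
    simp only [surface, surfaceVariation]
    ring
  refine hasDerivAt_zero_of_quadratic
    (C := |∫ x, V.surfaceVariation ζ x * V.surfaceVariation ζ x|)
    (Eventually.of_forall fun ε => le_of_eq ?_)
  rw [e, e]
  have split : ∀ A B C : ℝ, A + ε * B + ε ^ 2 * C - (A + 0 * B + 0 ^ 2 * C) - ε * B =
      C * ε ^ 2 := by
    intros
    ring
  rw [split, abs_mul, abs_of_nonneg (sq_nonneg ε)]

/-- With `lam = 0` the other functional is the kinetic part, so its derivative is reused and only `∫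
ζ²` is new. -/
theorem hasDerivAt_hamiltonianSq (lam : ℝ) (hadm : Admissible φ ζ)
    (hfin : HamiltonianSqFinite φ ζ) :
    HasDerivAt (fun ε => hamiltonianSq lam (V.potential φ ε) (V.surface ζ ε))
      (V.kineticVariation φ ζ + lam * ∫ x, ζ x * V.surfaceVariation ζ x) 0 := by
  have e0 : ∀ φ ζ, energyDensity 0 φ ζ = kineticDensity φ ζ := by
    intro φ ζ
    funext z
    simp [energyDensity]
  have f0 : HamiltonianFinite 0 φ ζ := by
    rw [HamiltonianFinite, e0]
    exact hfin.1
  have h1 := V.hasDerivAt_hamiltonian 0 hadm f0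
  have h2 := V.hasDerivAt_integral_sq_surface hadm.continuous_surface hfin.2
  have h3 := h1.add (h2.const_mul (lam / 2))
  have e : (fun ε => hamiltonianSq lam (V.potential φ ε) (V.surface ζ ε)) = fun ε =>
      hamiltonian 0 (V.potential φ ε) (V.surface ζ ε) +
        lam / 2 * ∫ x, V.surface ζ ε x ^ 2 := by
    funext ε
    rw [hamiltonianSq, hamiltonian, e0]
  rw [e]
  refine h3.congr_deriv ?_
  ring

end Variation

/-! ### Criticality as the vanishing of the first variation -/

/-- The first variation of the energy with head `κ` in the direction `V`. -/
def firstVariation (lam : ℝ) (φ : ℝ × ℝ → ℝ) (ζ κ : ℝ → ℝ) (V : Variation) : ℝ :=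
  V.kineticVariation φ ζ + lam * ∫ x, κ x * V.surfaceVariation ζ x

theorem isCritical_iff {H : (ℝ × ℝ → ℝ) → (ℝ → ℝ) → ℝ} {φ : ℝ × ℝ → ℝ} {ζ : ℝ → ℝ}
    {L : Variation → ℝ}
    (h : ∀ V, HasDerivAt (fun ε => H (V.potential φ ε) (V.surface ζ ε)) (L V) 0) :
    IsCritical H φ ζ ↔ ∀ V, L V = 0 :=
  ⟨fun hc V => (h V).unique (hc V), fun h0 V => h0 V ▸ h V⟩

theorem IsLocalMinimizer.isCritical {H : (ℝ × ℝ → ℝ) → (ℝ → ℝ) → ℝ} {φ : ℝ × ℝ → ℝ}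
    {ζ : ℝ → ℝ} {L : Variation → ℝ} (hm : IsLocalMinimizer H φ ζ)
    (h : ∀ V, HasDerivAt (fun ε => H (V.potential φ ε) (V.surface ζ ε)) (L V) 0) :
    IsCritical H φ ζ := by
  refine (isCritical_iff h).2 fun V => ?_
  have hl : IsLocalMin (fun ε => H (V.potential φ ε) (V.surface ζ ε)) 0 := by
    filter_upwards [hm V] with ε hε
    rwa [V.potential_zero, V.surface_zero]
  exact hl.hasDerivAt_eq_zero (h V)

/-! ### A radial mollifier that is a Laplacian -/

/-- The Laplacian `f_xx + f_yy` on the plane. -/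
def lap (f : ℝ × ℝ → ℝ) (z : ℝ × ℝ) : ℝ :=
  fderiv ℝ (fun w => fderiv ℝ f w (1, 0)) z (1, 0) +
    fderiv ℝ (fun w => fderiv ℝ f w (0, 1)) z (0, 1)

theorem contDiff_lap {f : ℝ × ℝ → ℝ} (hf : ContDiff ℝ ∞ f) : ContDiff ℝ ∞ (lap f) :=
  (Variation.contDiff_fderiv_apply (Variation.contDiff_fderiv_apply hf _) _).add
    (Variation.contDiff_fderiv_apply (Variation.contDiff_fderiv_apply hf _) _)

theorem fderiv_comp_smul_add {f : ℝ × ℝ → ℝ} (hf : Differentiable ℝ f) (a : ℝ) (b z v : ℝ × ℝ) :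
    fderiv ℝ (fun w => f (a • w + b)) z v = a * fderiv ℝ f (a • z + b) v := by
  have h1 : HasFDerivAt (fun w : ℝ × ℝ => a • w + b) (a • ContinuousLinearMap.id ℝ (ℝ × ℝ)) z :=
    ((hasFDerivAt_id z).const_smul a).add_const b
  have h2 := (hf (a • z + b)).hasFDerivAt.comp z h1
  have e : (fun w => f (a • w + b)) = f ∘ fun w : ℝ × ℝ => a • w + b := rfl
  rw [e, h2.fderiv]
  simp

theorem lap_comp_smul_add {f : ℝ × ℝ → ℝ} (hf : ContDiff ℝ ∞ f) (a : ℝ) (b z : ℝ × ℝ) :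
    lap (fun w => f (a • w + b)) z = a ^ 2 * lap f (a • z + b) := by
  have key : ∀ v, fderiv ℝ (fun w => fderiv ℝ (fun w => f (a • w + b)) w v) z v =
      a ^ 2 * fderiv ℝ (fun w => fderiv ℝ f w v) (a • z + b) v := by
    intro v
    have hd : Differentiable ℝ fun w => fderiv ℝ f w v :=
      (Variation.contDiff_fderiv_apply hf v).differentiable (by simp)
    have e : (fun w => fderiv ℝ (fun w => f (a • w + b)) w v) =
        fun w => a * fderiv ℝ f (a • w + b) v :=
      funext fun w => fderiv_comp_smul_add (hf.differentiable (by simp)) a b w v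
    have hd' : DifferentiableAt ℝ (fun w => fderiv ℝ f (a • w + b) v) z :=
      (hd.comp ((differentiable_id.const_smul a).add_const b)) z
    rw [e, fderiv_const_mul hd', smul_apply, fderiv_comp_smul_add hd, smul_eq_mul]
    ring
  simp only [lap, key]
  ring

theorem lap_sub_const {f g : ℝ × ℝ → ℝ} (hf : ContDiff ℝ ∞ f) (hg : ContDiff ℝ ∞ g) (c : ℝ)
    (z : ℝ × ℝ) : lap (fun w => f w - g w - c) z = lap f z - lap g z := by
  have e : ∀ v, (fun w => fderiv ℝ (fun w => f w - g w - c) w v) =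
      fun w => fderiv ℝ f w v - fderiv ℝ g w v := by
    intro v
    funext w
    rw [fderiv_sub_const, fderiv_fun_sub (hf.differentiable (by simp) w)
      (hg.differentiable (by simp) w), sub_apply]
  have hd : ∀ {f : ℝ × ℝ → ℝ}, ContDiff ℝ ∞ f → ∀ v,
      DifferentiableAt ℝ (fun w => fderiv ℝ f w v) z := fun hf v =>
    (Variation.contDiff_fderiv_apply hf v).differentiable (by simp) z
  simp only [lap, e]
  rw [fderiv_fun_sub (hd hf _) (hd hg _), fderiv_fun_sub (hd hf _) (hd hg _), sub_apply, sub_apply]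
  ring

/-- A smooth step from `0` on `s ≤ 1/2` to `1` on `s ≥ 1`. -/
def logStep (s : ℝ) : ℝ := Real.smoothTransition (2 * s - 1)

theorem contDiff_logStep : ContDiff ℝ ∞ logStep :=
  Real.smoothTransition.contDiff.comp ((contDiff_const.mul contDiff_id).sub contDiff_const)

theorem logStep_eq_zero {s : ℝ} (h : s ≤ 1 / 2) : logStep s = 0 :=
  Real.smoothTransition.zero_of_nonpos (by linarith)

theorem logStep_eq_one {s : ℝ} (h : 1 ≤ s) : logStep s = 1 :=
  Real.smoothTransition.one_of_one_le (by linarith)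

theorem monotone_logStep : Monotone logStep := fun a b h =>
  Real.smoothTransition.monotone (by linarith)

/-- The step vanishes for `s ≤ 1/2`, so the quotient is zero near the singularity. -/
theorem contDiff_logStep_div : ContDiff ℝ ∞ fun s => logStep s / s := by
  rw [contDiff_iff_contDiffAt]
  intro s
  rcases eq_or_ne s 0 with rfl | hs
  · refine (contDiffAt_const (c := (0 : ℝ))).congr_of_eventuallyEq ?_
    filter_upwards [eventually_le_nhds (by norm_num : (0 : ℝ) < 1 / 2)] with t ht
    rw [logStep_eq_zero ht, zero_div]
  · exact contDiff_logStep.contDiffAt.div contDiffAt_id hs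

/-- A smooth function on the line which equals `log` on `s ≥ 1`. -/
def smoothLog (s : ℝ) : ℝ := ∫ t in (1 : ℝ)..s, logStep t / t

theorem hasDerivAt_smoothLog (s : ℝ) : HasDerivAt smoothLog (logStep s / s) s :=
  intervalIntegral.integral_hasDerivAt_right
    (contDiff_logStep_div.continuous.intervalIntegrable _ _)
    (contDiff_logStep_div.continuous.stronglyMeasurableAtFilter _ _)
    contDiff_logStep_div.continuous.continuousAt

theorem contDiff_smoothLog : ContDiff ℝ ∞ smoothLog := by
  refine contDiff_infty_iff_deriv.2 ⟨fun s => (hasDerivAt_smoothLog s).differentiableAt, ?_⟩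
  have : deriv smoothLog = fun s => logStep s / s := funext fun s => (hasDerivAt_smoothLog s).deriv
  rw [this]
  exact contDiff_logStep_div

theorem smoothLog_eq_log {s : ℝ} (h : 1 ≤ s) : smoothLog s = Real.log s := by
  have e : smoothLog s = ∫ t in (1 : ℝ)..s, 1 / t := by
    refine intervalIntegral.integral_congr fun t ht => ?_
    rw [Set.uIcc_of_le h] at ht
    simp only [logStep_eq_one ht.1]
  rw [e, integral_one_div_of_pos one_pos (by linarith), div_one]

/-- The square of the Euclidean norm. -/
def normSq (z : ℝ × ℝ) : ℝ := z.1 ^ 2 + z.2 ^ 2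

theorem contDiff_normSq : ContDiff ℝ ∞ normSq :=
  (contDiff_fst.pow 2).add (contDiff_snd.pow 2)

theorem norm_sq_le_normSq (z : ℝ × ℝ) : ‖z‖ ^ 2 ≤ normSq z := by
  rw [Prod.norm_def, normSq]
  rcases max_choice ‖z.1‖ ‖z.2‖ with h | h <;> rw [h, Real.norm_eq_abs, sq_abs] <;>
    nlinarith [sq_nonneg z.1, sq_nonneg z.2]

theorem fderiv_comp_normSq {f f' : ℝ → ℝ} (hf : ∀ s, HasDerivAt f (f' s) s) (z v : ℝ × ℝ) :
    fderiv ℝ (fun w => f (normSq w)) z v = f' (normSq z) * (2 * z.1 * v.1 + 2 * z.2 * v.2) := by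
  have h1 : HasFDerivAt normSq ((2 * z.1) • ContinuousLinearMap.fst ℝ ℝ ℝ +
      (2 * z.2) • ContinuousLinearMap.snd ℝ ℝ ℝ) z := by
    have := ((hasFDerivAt_fst (𝕜 := ℝ) (p := z)).pow 2).add
      ((hasFDerivAt_snd (𝕜 := ℝ) (p := z)).pow 2)
    simp only [Nat.add_one_sub_one, pow_one, nsmul_eq_mul, Nat.cast_ofNat] at this
    exact this
  have h2 := (hf (normSq z)).comp_hasFDerivAt z h1
  have e : (fun w => f (normSq w)) = f ∘ normSq := rfl
  rw [e, h2.fderiv]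
  simp [mul_add]

/-- For a function `f` of `s = |z|²` the Laplacian is `4 (s f')'`, and here `s f' = logStep s`. -/
theorem lap_smoothLog_normSq (z : ℝ × ℝ) :
    lap (fun w => smoothLog (normSq w)) z = 4 * deriv logStep (normSq z) := by
  set B : ℝ → ℝ := fun s => logStep s / s with hB
  have dB : ∀ s, HasDerivAt B (deriv B s) s := fun s =>
    (contDiff_logStep_div.differentiable (by simp) s).hasDerivAt
  have eA : logStep = fun s => s * B s := by
    funext s
    rcases eq_or_ne s 0 with rfl | hs
    · rw [zero_mul, logStep_eq_zero (by norm_num)]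
    · rw [hB]
      field_simp
  have dA : deriv logStep (normSq z) = B (normSq z) + normSq z * deriv B (normSq z) := by
    have h : HasDerivAt logStep (1 * B (normSq z) + normSq z * deriv B (normSq z)) (normSq z) := by
      rw [eA]
      exact (hasDerivAt_id (normSq z)).mul (dB (normSq z))
    rw [h.deriv, one_mul]
  have e : ∀ v, (fun w => fderiv ℝ (fun w => smoothLog (normSq w)) w v) =
      fun w => B (normSq w) * (2 * w.1 * v.1 + 2 * w.2 * v.2) := fun v =>
    funext fun w => fderiv_comp_normSq hasDerivAt_smoothLog w v
  have dBn : DifferentiableAt ℝ (fun w => B (normSq w)) z :=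
    (contDiff_logStep_div.comp contDiff_normSq).differentiable (by simp) z
  have l1 : fderiv ℝ (fun w : ℝ × ℝ => 2 * w.1) z (1, 0) = 2 := by
    rw [fderiv_const_mul differentiableAt_fst]
    simp [fderiv_fst]
  have l2 : fderiv ℝ (fun w : ℝ × ℝ => 2 * w.2) z (0, 1) = 2 := by
    rw [fderiv_const_mul differentiableAt_snd]
    simp [fderiv_snd]
  rw [lap, e, e]
  simp only [mul_one, mul_zero, add_zero, zero_add]
  rw [Variation.fderiv_mul_apply dBn (differentiableAt_fst.const_mul 2),
    Variation.fderiv_mul_apply dBn (differentiableAt_snd.const_mul 2),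
    fderiv_comp_normSq dB, fderiv_comp_normSq dB, l1, l2, dA, normSq]
  ring

theorem deriv_logStep_nonneg (s : ℝ) : 0 ≤ deriv logStep s := monotone_logStep.deriv_nonneg

theorem deriv_logStep_eq_zero {s : ℝ} (h : 1 ≤ s) : deriv logStep s = 0 := by
  have hc : Continuous (deriv logStep) := contDiff_logStep.continuous_deriv (by simp)
  -- The end point `s = 1` is reached by continuity of the derivative.
  have hz : Set.EqOn (deriv logStep) 0 (Set.Ioi 1) := by
    intro t ht
    have : logStep =ᶠ[𝓝 t] fun _ => (1 : ℝ) := by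
      filter_upwards [lt_mem_nhds ht] with u hu using logStep_eq_one hu.le
    rw [this.deriv_eq]
    simp
  have := hz.closure hc continuous_const
  rw [closure_Ioi] at this
  exact this h

theorem exists_deriv_logStep_pos : ∃ s, 0 < s ∧ deriv logStep s ≠ 0 := by
  obtain ⟨s, hs, h⟩ := exists_deriv_eq_slope logStep (by norm_num : (0 : ℝ) < 1)
    contDiff_logStep.continuous.continuousOn
    (contDiff_logStep.differentiable (by simp)).differentiableOn
  refine ⟨s, hs.1, ?_⟩
  rw [h, logStep_eq_one le_rfl, logStep_eq_zero (by norm_num)]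
  norm_num

/-- The Laplacian of the regularized logarithm, a radial function supported in the unit disk. -/
def radialBump (z : ℝ × ℝ) : ℝ := lap (fun w => smoothLog (normSq w)) z

theorem contDiff_radialBump : ContDiff ℝ ∞ radialBump :=
  contDiff_lap (contDiff_smoothLog.comp contDiff_normSq)

/-- The norm of `ℝ × ℝ` is the maximum norm, while the bump is radial for the Euclidean one. As the
maximum norm is the smaller, the support also lies in its unit ball. -/
theorem radialBump_eq_zero {z : ℝ × ℝ} (h : 1 ≤ ‖z‖) : radialBump z = 0 := by
  rw [radialBump, lap_smoothLog_normSq, deriv_logStep_eq_zero, mul_zero]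
  exact (one_le_pow₀ h).trans (norm_sq_le_normSq z)

theorem hasCompactSupport_radialBump : HasCompactSupport radialBump :=
  HasCompactSupport.intro (isCompact_closedBall 0 1) fun z hz =>
    radialBump_eq_zero (by simpa using (not_le.1 (fun h => hz (by simpa using h))).le)

theorem integral_radialBump_pos : 0 < ∫ z, radialBump z := by
  obtain ⟨s, hs, h⟩ := exists_deriv_logStep_pos
  refine contDiff_radialBump.continuous.integral_pos_of_hasCompactSupport_nonneg_nonzero
    hasCompactSupport_radialBump (fun z => ?_) (x := (Real.sqrt s, 0)) ?_
  · rw [radialBump, lap_smoothLog_normSq]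
    exact mul_nonneg (by norm_num) (deriv_logStep_nonneg _)
  · rw [radialBump, lap_smoothLog_normSq]
    have : normSq (Real.sqrt s, 0) = s := by simp [normSq, Real.sq_sqrt hs.le]
    rw [this]
    exact mul_ne_zero (by norm_num) h

/-- The rescaled radial mollifier, of integral one and supported in the disk of radius `r`. -/
def radialMollifier (r : ℝ) (z : ℝ × ℝ) : ℝ :=
  (∫ z, radialBump z)⁻¹ * ((r⁻¹) ^ 2 * radialBump (r⁻¹ • z))

theorem contDiff_radialMollifier (r : ℝ) : ContDiff ℝ ∞ (radialMollifier r) :=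
  contDiff_const.mul (contDiff_const.mul (contDiff_radialBump.comp (contDiff_const_smul r⁻¹)))

theorem radialMollifier_eq_zero {r : ℝ} (hr : 0 < r) {z : ℝ × ℝ} (h : r ≤ ‖z‖) :
    radialMollifier r z = 0 := by
  rw [radialMollifier, radialBump_eq_zero, mul_zero, mul_zero]
  rw [norm_smul, norm_inv, Real.norm_of_nonneg hr.le, ← div_eq_inv_mul]
  exact (one_le_div hr).2 h

theorem hasCompactSupport_radialMollifier {r : ℝ} (hr : 0 < r) :
    HasCompactSupport (radialMollifier r) :=
  HasCompactSupport.intro (isCompact_closedBall 0 r) fun z hz =>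
    radialMollifier_eq_zero hr (not_le.1 (fun h => hz (by simpa using h))).le

theorem integral_radialMollifier {r : ℝ} (hr : 0 < r) : ∫ z, radialMollifier r z = 1 := by
  simp only [radialMollifier]
  rw [integral_const_mul, integral_const_mul, Measure.integral_comp_inv_smul]
  have : Module.finrank ℝ (ℝ × ℝ) = 2 := by simp
  rw [this, abs_of_nonneg (by positivity), smul_eq_mul]
  have := integral_radialBump_pos.ne'
  field_simp

theorem exists_radialMollifier_bound : ∃ C, ∀ r, 0 < r → ∀ z,
    |radialMollifier r z| ≤ C / r ^ 2 := by
  obtain ⟨C, hC⟩ := hasCompactSupport_radialBump.exists_bound_of_continuous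
    contDiff_radialBump.continuous
  refine ⟨(∫ z, radialBump z)⁻¹ * C, fun r hr z => ?_⟩
  have hp := integral_radialBump_pos
  rw [radialMollifier, abs_mul, abs_mul, abs_of_pos (inv_pos.2 hp), abs_of_nonneg (by positivity)]
  calc _ ≤ (∫ z, radialBump z)⁻¹ * ((r⁻¹) ^ 2 * C) := by
        gcongr
        exact hC _
    _ = _ := by
        field_simp

/-- The difference of two radial mollifiers is the Laplacian of a test function. -/
theorem exists_lap_eq_radialMollifier_sub {r s R : ℝ} (hr : 0 < r) (hs : 0 < s) (hrR : r ≤ R)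
    (hsR : s ≤ R) : ∃ G : ℝ × ℝ → ℝ, ContDiff ℝ ∞ G ∧ (∀ z, R ≤ ‖z‖ → G z = 0) ∧
      ∀ z, lap G z = radialMollifier r z - radialMollifier s z := by
  set c := (∫ z, radialBump z)⁻¹ with hc
  set u : ℝ × ℝ → ℝ := fun z => c * smoothLog (normSq z) with hu
  have su : ContDiff ℝ ∞ u := contDiff_const.mul (contDiff_smoothLog.comp contDiff_normSq)
  have lu : ∀ z, lap u z = c * radialBump z := by
    intro z
    have sl : ContDiff ℝ ∞ fun z => smoothLog (normSq z) :=
      contDiff_smoothLog.comp contDiff_normSq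
    have e : ∀ v, (fun w => fderiv ℝ u w v) =
        fun w => c * fderiv ℝ (fun z => smoothLog (normSq z)) w v := by
      intro v
      funext w
      rw [hu, fderiv_const_mul (sl.differentiable (by simp) w), smul_apply, smul_eq_mul]
    have d : ∀ v, DifferentiableAt ℝ (fun w => fderiv ℝ (fun z => smoothLog (normSq z)) w v) z :=
      fun v => (Variation.contDiff_fderiv_apply sl v).differentiable (by simp) z
    rw [lap, e, e, fderiv_const_mul (d _), fderiv_const_mul (d _), radialBump, lap, smul_apply,
      smul_apply, smul_eq_mul, smul_eq_mul, mul_add]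
  have sc : ∀ a : ℝ, ContDiff ℝ ∞ fun z => u (a • z + 0) := fun a =>
    su.comp ((contDiff_const_smul a).add contDiff_const)
  -- Where `‖z‖ ≥ R` both terms are genuine logarithms, so their difference is constant there;
  -- subtracting this constant makes the support compact.
  refine ⟨fun z => u (r⁻¹ • z + 0) - u (s⁻¹ • z + 0) -
    c * (Real.log ((r⁻¹) ^ 2) - Real.log ((s⁻¹) ^ 2)), ?_, fun z hz => ?_, fun z => ?_⟩
  · exact ((sc _).sub (sc _)).sub contDiff_const
  · have key : ∀ t, 0 < t → t ≤ R → u (t⁻¹ • z + 0) =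
        c * (Real.log ((t⁻¹) ^ 2) + Real.log (normSq z)) := by
      intro t ht htR
      have hz0 : t ^ 2 ≤ normSq z :=
        (pow_le_pow_left₀ ht.le (htR.trans hz) 2).trans (norm_sq_le_normSq z)
      have e : normSq (t⁻¹ • z + 0) = (t⁻¹) ^ 2 * normSq z := by
        simp only [normSq, add_zero, Prod.smul_fst, Prod.smul_snd, smul_eq_mul]
        ring
      have hpos : 0 < normSq z := lt_of_lt_of_le (by positivity) hz0
      rw [hu]
      simp only
      rw [e, smoothLog_eq_log, Real.log_mul (by positivity) hpos.ne']
      rw [inv_pow, ← div_eq_inv_mul]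
      exact (one_le_div (by positivity)).2 hz0
    simp only
    rw [key r hr hrR, key s hs hsR]
    ring
  · rw [lap_sub_const (sc _) (sc _), lap_comp_smul_add su, lap_comp_smul_add su, lu, lu]
    simp only [add_zero, radialMollifier, ← hc]
    ring

/-! ### Weyl's lemma -/

/-- `φ` is harmonic in the sense of distributions. -/
def IsWeaklyHarmonic (Ω : Set (ℝ × ℝ)) (φ : ℝ × ℝ → ℝ) : Prop :=
  LocallyIntegrableOn φ Ω ∧ ∀ η : ℝ × ℝ → ℝ, ContDiff ℝ ∞ η → HasCompactSupport η →
    tsupport η ⊆ Ω → ∫ z in Ω, φ z * lap η z = 0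

/-- The average of `φ` around `z`, weighted with the radial mollifier. -/
def mollify (Ω : Set (ℝ × ℝ)) (φ : ℝ × ℝ → ℝ) (r : ℝ) (z : ℝ × ℝ) : ℝ :=
  ∫ w in Ω, φ w * radialMollifier r (z - w)

section

variable {Ω : Set (ℝ × ℝ)} {φ : ℝ × ℝ → ℝ}

theorem _root_.Filter.EventuallyEq.lap_eq {f g : ℝ × ℝ → ℝ} {z : ℝ × ℝ} (h : f =ᶠ[𝓝 z] g) :
    lap f z = lap g z := by
  have e : ∀ v, (fun w => fderiv ℝ f w v) =ᶠ[𝓝 z] fun w => fderiv ℝ g w v := fun v => by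
    filter_upwards [h.eventuallyEq_nhds] with w hw
    rw [hw.fderiv_eq]
  rw [lap, lap, (e _).fderiv_eq, (e _).fderiv_eq]

/-- The test function is `G` reflected and moved to `z`; a reflection does not change the Laplacian.
-/
theorem IsWeaklyHarmonic.integral_mul_lap_sub_eq_zero (h : IsWeaklyHarmonic Ω φ)
    {G : ℝ × ℝ → ℝ} (hG : ContDiff ℝ ∞ G) {R : ℝ} (hR : ∀ w, R ≤ ‖w‖ → G w = 0)
    {z : ℝ × ℝ} (hz : Metric.closedBall z R ⊆ Ω) :
    ∫ w in Ω, φ w * lap G (z - w) = 0 := by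
  have e : ∀ w, lap (fun w => G ((-1 : ℝ) • w + z)) w = lap G (z - w) := by
    intro w
    rw [lap_comp_smul_add hG]
    simp [neg_add_eq_sub]
  have s : ContDiff ℝ ∞ fun w => G ((-1 : ℝ) • w + z) :=
    hG.comp ((contDiff_const_smul (-1 : ℝ)).add contDiff_const)
  have sub : tsupport (fun w => G ((-1 : ℝ) • w + z)) ⊆ Metric.closedBall z R := by
    refine closure_minimal (fun w hw => ?_) Metric.isClosed_closedBall
    by_contra hc
    rw [Metric.mem_closedBall, not_le, dist_comm, dist_eq_norm] at hc
    refine hw (hR _ ?_)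
    rw [neg_one_smul, neg_add_eq_sub]
    exact hc.le
  have := h.2 _ s ((isCompact_closedBall z R).of_isClosed_subset (isClosed_tsupport _) sub)
    (sub.trans hz)
  simpa only [e] using this

theorem integrableOn_mul_radialMollifier (hΩ : IsOpen Ω) (hφ : LocallyIntegrableOn φ Ω)
    {r : ℝ} (hr : 0 < r) {z : ℝ × ℝ} (hz : Metric.closedBall z r ⊆ Ω) :
    IntegrableOn (fun w => φ w * radialMollifier r (z - w)) Ω := by
  have sub : tsupport (fun w => radialMollifier r (z - w)) ⊆ Metric.closedBall z r := by
    refine closure_minimal (fun w hw => ?_) Metric.isClosed_closedBall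
    by_contra hc
    rw [Metric.mem_closedBall, not_le, dist_comm, dist_eq_norm] at hc
    exact hw (radialMollifier_eq_zero hr hc.le)
  exact LocallyIntegrableOn.mul_hasCompactSupport hΩ.measurableSet hφ
    ((contDiff_radialMollifier r).continuous.comp (continuous_const.sub continuous_id))
    ((isCompact_closedBall z r).of_isClosed_subset (isClosed_tsupport _) sub) (sub.trans hz)

/-- The weighted averages of a weakly harmonic function do not depend on the radius. -/
theorem IsWeaklyHarmonic.mollify_eq (hΩ : IsOpen Ω) (h : IsWeaklyHarmonic Ω φ) {r s : ℝ}
    (hr : 0 < r) (hrs : r ≤ s) {z : ℝ × ℝ} (hz : Metric.closedBall z s ⊆ Ω) :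
    mollify Ω φ r z = mollify Ω φ s z := by
  obtain ⟨G, sG, zG, lG⟩ := exists_lap_eq_radialMollifier_sub hr (hr.trans_le hrs) hrs le_rfl
  have e := h.integral_mul_lap_sub_eq_zero sG zG hz
  simp only [lG, mul_sub] at e
  rw [integral_sub (integrableOn_mul_radialMollifier hΩ h.1 hr
      ((Metric.closedBall_subset_closedBall hrs).trans hz))
    (integrableOn_mul_radialMollifier hΩ h.1 (hr.trans_le hrs) hz)] at e
  exact sub_eq_zero.1 e

open scoped Convolution in
theorem fderiv_convolution_apply {f ρ : ℝ × ℝ → ℝ} (hf : LocallyIntegrable f)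
    (hρ : ContDiff ℝ ∞ ρ) (hc : HasCompactSupport ρ) (z v : ℝ × ℝ) :
    fderiv ℝ (f ⋆[ContinuousLinearMap.mul ℝ ℝ, volume] ρ) z v =
      (f ⋆[ContinuousLinearMap.mul ℝ ℝ, volume] fun w => fderiv ℝ ρ w v) z := by
  rw [(hc.hasFDerivAt_convolution_right _ hf (hρ.of_le (by simp)) z).fderiv,
    convolution_precompR_apply _ hf (hc.fderiv ℝ) (hρ.continuous_fderiv (by simp))]

open scoped Convolution in
theorem lap_convolution {f ρ : ℝ × ℝ → ℝ} (hf : LocallyIntegrable f)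
    (hρ : ContDiff ℝ ∞ ρ) (hc : HasCompactSupport ρ) (z : ℝ × ℝ) :
    lap (f ⋆[ContinuousLinearMap.mul ℝ ℝ, volume] ρ) z = ∫ w, f w * lap ρ (z - w) := by
  have e : ∀ v, (fun w => fderiv ℝ (f ⋆[ContinuousLinearMap.mul ℝ ℝ, volume] ρ) w v) =
      f ⋆[ContinuousLinearMap.mul ℝ ℝ, volume] fun w => fderiv ℝ ρ w v := fun v =>
    funext fun w => fderiv_convolution_apply hf hρ hc w v
  have e2 : ∀ v, fderiv ℝ (fun w => fderiv ℝ
      (f ⋆[ContinuousLinearMap.mul ℝ ℝ, volume] ρ) w v) z v =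
      ∫ w, f w * fderiv ℝ (fun w => fderiv ℝ ρ w v) (z - w) v := by
    intro v
    rw [e, fderiv_convolution_apply hf (Variation.contDiff_fderiv_apply hρ v)
      (hc.fderiv_apply (𝕜 := ℝ) v)]
    rfl
  have i : ∀ v, Integrable fun w => f w * fderiv ℝ (fun w => fderiv ℝ ρ w v) (z - w) v := by
    intro v
    have hcs : HasCompactSupport fun w => fderiv ℝ (fun w => fderiv ℝ ρ w v) w v :=
      HasCompactSupport.fderiv_apply (𝕜 := ℝ) (hc.fderiv_apply (𝕜 := ℝ) v) v
    exact hcs.convolutionExists_right (ContinuousLinearMap.mul ℝ ℝ) hf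
      (Variation.contDiff_fderiv_apply (Variation.contDiff_fderiv_apply hρ v) v).continuous z
  simp only [lap, mul_add]
  rw [integral_add (i _) (i _), e2, e2]

/-- Weighted averages converge at almost every point. -/
theorem ae_tendsto_integral_mul_radialMollifier {f : ℝ × ℝ → ℝ} (hf : LocallyIntegrable f) :
    ∀ᵐ z, Tendsto (fun r => ∫ w, f w * radialMollifier r (z - w)) (𝓝[>] 0) (𝓝 (f z)) := by
  obtain ⟨C, hC⟩ := exists_radialMollifier_bound
  filter_upwards [(Besicovitch.vitaliFamily (volume : Measure (ℝ × ℝ))).ae_tendsto_average_norm_sub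
    hf] with z hz
  have h := hz.comp (Besicovitch.tendsto_filterAt volume z)
  -- A ball of radius `r` in the maximum norm has area `4 r²`, so the kernel bound `C / r²` is `4 C`
  -- divided by the area.
  have key := tendsto_integral_smul_of_tendsto_average_norm_sub
    (g := fun r w => radialMollifier r (z - w)) (4 * C) h
    (Eventually.of_forall fun r => hf.integrableOn_isCompact (isCompact_closedBall _ _))
    (tendsto_const_nhds.congr' ?_) ?_ ?_
  · simpa only [smul_eq_mul, mul_comm] using key
  · filter_upwards [self_mem_nhdsWithin] with r hr
    rw [integral_sub_left_eq_self (radialMollifier r), integral_radialMollifier hr]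
  · filter_upwards [self_mem_nhdsWithin] with r hr w hw
    by_contra hc
    rw [Metric.mem_closedBall, not_le, dist_comm, dist_eq_norm] at hc
    exact hw (radialMollifier_eq_zero hr hc.le)
  · filter_upwards [self_mem_nhdsWithin] with r hr w
    have hr : 0 < r := hr
    have : volume.real (Metric.closedBall z r) = 4 * r ^ 2 := by
      rw [← Prod.mk.eta (p := z), ← closedBall_prod_same, Measure.volume_eq_prod,
        measureReal_prod_prod, Real.volume_real_closedBall hr.le, Real.volume_real_closedBall hr.le]
      ring
    rw [this]
    refine (hC r hr _).trans (le_of_eq ?_)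
    field_simp

/-- **Weyl's lemma** in the plane. -/
theorem IsWeaklyHarmonic.exists_harmonic (hΩ : IsOpen Ω) (hne : Ωᶜ.Nonempty)
    (h : IsWeaklyHarmonic Ω φ) :
    ∃ f : ℝ × ℝ → ℝ, (∀ z ∈ Ω, ContDiffAt ℝ ∞ f z ∧ lap f =ᶠ[𝓝 z] 0) ∧
      ∀ᵐ z, z ∈ Ω → φ z = f z := by
  -- The representative at `z` is the average of radius `d z`, the largest scale used at that point.
  -- The distance is meaningful because the complement is nonempty.
  set d : ℝ × ℝ → ℝ := fun z => Metric.infDist z Ωᶜ / 2 with hd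
  have dpos : ∀ z ∈ Ω, 0 < d z := fun z hz =>
    half_pos ((hΩ.isClosed_compl.notMem_iff_infDist_pos hne).1 (fun hh => hh hz))
  have dsub : ∀ z ∈ Ω, Metric.closedBall z (d z) ⊆ Ω := fun z hz =>
    (Metric.closedBall_subset_ball (half_lt_self (by have := dpos z hz; simp only [hd] at this; linarith))).trans
      Metric.ball_infDist_compl_subset
  -- Near `z₀` the variable radius can be replaced by a fixed one and `φ` by a globally integrable
  -- function, so that the representative becomes a convolution with a smooth kernel.
  have local_rep : ∀ z₀ ∈ Ω, ∃ r > 0, ∃ g : ℝ × ℝ → ℝ, LocallyIntegrable g ∧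
      Metric.ball z₀ r ⊆ Ω ∧
      (∀ w ∈ Metric.ball z₀ r, g w = φ w) ∧
      ∀ z ∈ Metric.ball z₀ r, Metric.closedBall z r ⊆ Ω ∧
        mollify Ω φ (d z) z = mollify Ω φ r z ∧
        ∀ ρ : ℝ × ℝ → ℝ, (∀ w, r < ‖w‖ → ρ w = 0) →
          ∫ w in Ω, φ w * ρ (z - w) = ∫ w, g w * ρ (z - w) := by
    intro z₀ hz₀
    have hr : 0 < d z₀ / 2 := half_pos (dpos z₀ hz₀)
    set r := d z₀ / 2 with hrd
    set K := Metric.closedBall z₀ (2 * r) with hK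
    have hKΩ : K ⊆ Ω := by
      have : 2 * r = d z₀ := by rw [hrd]; ring
      rw [hK, this]
      exact dsub z₀ hz₀
    have ballK : Metric.ball z₀ r ⊆ K :=
      Metric.ball_subset_closedBall.trans (Metric.closedBall_subset_closedBall (by linarith))
    have cbK : ∀ z ∈ Metric.ball z₀ r, Metric.closedBall z r ⊆ K := by
      intro z hz w hw
      rw [Metric.mem_ball] at hz
      rw [Metric.mem_closedBall] at hw ⊢
      linarith [dist_triangle w z z₀]
    have hg : Integrable (K.indicator φ) :=
      (integrable_indicator_iff Metric.isClosed_closedBall.measurableSet).2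
        (h.1.integrableOn_compact_subset hKΩ (isCompact_closedBall _ _))
    refine ⟨r, hr, K.indicator φ, hg.locallyIntegrable, ballK.trans hKΩ,
      fun w hw => Set.indicator_of_mem (ballK hw) _, fun z hz => ⟨(cbK z hz).trans hKΩ, ?_, ?_⟩⟩
    · have hzΩ : z ∈ Ω := hKΩ (ballK hz)
      refine (h.mollify_eq hΩ hr ?_ (dsub z hzΩ)).symm
      have h1 : Metric.infDist z₀ Ωᶜ ≤ Metric.infDist z Ωᶜ + dist z₀ z :=
        Metric.infDist_le_infDist_add_dist
      rw [Metric.mem_ball, dist_comm] at hz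
      simp only [hd] at hrd ⊢
      linarith
    · intro ρ hρ
      rw [← integral_indicator hΩ.measurableSet]
      congr 1
      funext w
      by_cases hw : w ∈ K
      · rw [Set.indicator_of_mem (hKΩ hw), Set.indicator_of_mem hw]
      · have : ρ (z - w) = 0 := by
          refine hρ _ ?_
          by_contra hc
          refine hw (cbK z hz ?_)
          rw [Metric.mem_closedBall, dist_comm, dist_eq_norm]
          exact not_lt.1 hc
        simp [this, Set.indicator]
  refine ⟨fun z => mollify Ω φ (d z) z, fun z₀ hz₀ => ?_, ?_⟩
  · obtain ⟨r, hr, g, hg, -, -, H⟩ := local_rep z₀ hz₀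
    have eq : ∀ z ∈ Metric.ball z₀ r, mollify Ω φ (d z) z =
        MeasureTheory.convolution g (radialMollifier r) (ContinuousLinearMap.mul ℝ ℝ) volume z := by
      intro z hz
      rw [(H z hz).2.1]
      exact (H z hz).2.2 _ fun w hw => radialMollifier_eq_zero hr hw.le
    have sm := (hasCompactSupport_radialMollifier hr).contDiff_convolution_right (n := ⊤)
      (ContinuousLinearMap.mul ℝ ℝ) hg (contDiff_radialMollifier r)
    have ev : ∀ z ∈ Metric.ball z₀ r, (fun z => mollify Ω φ (d z) z) =ᶠ[𝓝 z]
        MeasureTheory.convolution g (radialMollifier r) (ContinuousLinearMap.mul ℝ ℝ) volume :=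
      fun z hz => Filter.eventuallyEq_of_mem (Metric.isOpen_ball.mem_nhds hz) eq
    have lapz : ∀ w, r < ‖w‖ → lap (radialMollifier r) w = 0 := by
      intro w hw
      have hz : radialMollifier r =ᶠ[𝓝 w] fun _ => 0 := by
        filter_upwards [continuous_norm.continuousAt.eventually (lt_mem_nhds hw)] with u hu
        exact radialMollifier_eq_zero hr hu.le
      rw [hz.lap_eq]
      simp [lap]
    refine ⟨sm.contDiffAt.congr_of_eventuallyEq (ev z₀ (Metric.mem_ball_self hr)), ?_⟩
    filter_upwards [Metric.ball_mem_nhds z₀ hr] with z hz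
    rw [(ev z hz).lap_eq, lap_convolution hg (contDiff_radialMollifier r) (hasCompactSupport_radialMollifier hr),
      ← (H z hz).2.2 _ lapz]
    exact h.integral_mul_lap_sub_eq_zero (contDiff_radialMollifier r)
      (fun w hw => radialMollifier_eq_zero hr hw) (H z hz).1
  -- At almost every point the averages tend to `φ z` as the radius shrinks, and they are
  -- independent of the radius. A locally null set is null.
  · have hnull : volume {z | z ∈ Ω ∧ φ z ≠ mollify Ω φ (d z) z} = 0 := by
      refine measure_null_of_locally_null _ fun z₀ hz₀ => ?_
      obtain ⟨r, hr, g, hg, -, gφ, H⟩ := local_rep z₀ hz₀.1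
      refine ⟨{z | z ∈ Ω ∧ φ z ≠ mollify Ω φ (d z) z} ∩ Metric.ball z₀ r,
        inter_mem_nhdsWithin _ (Metric.ball_mem_nhds z₀ hr), ?_⟩
      have hae := ae_tendsto_integral_mul_radialMollifier hg
      refine measure_mono_null ?_ (ae_iff.1 hae)
      rintro z ⟨⟨-, hne⟩, hz⟩ ht
      refine hne ?_
      rw [← gφ z hz, (H z hz).2.1]
      refine (tendsto_nhds_unique ht (tendsto_const_nhds.congr' ?_))
      filter_upwards [Ioc_mem_nhdsGT hr] with s hs
      rw [← h.mollify_eq hΩ hs.1 hs.2 (H z hz).1]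
      exact (H z hz).2.2 _ fun w hw => radialMollifier_eq_zero hs.1 (hs.2.trans hw.le)
    rw [ae_iff]
    refine measure_mono_null (fun z hz => ?_) hnull
    simpa using hz

end

/-! ### Harmonic functions on `ℂ` and on `ℝ × ℝ` -/

open InnerProductSpace in
theorem laplacian_eq_lap {h : ℂ → ℝ} {z : ℝ × ℝ} (hh : ContDiffAt ℝ 2 h (Complex.mk z.1 z.2)) :
    Laplacian.laplacian h (Complex.mk z.1 z.2) =
      lap (fun w : ℝ × ℝ => h (Complex.mk w.1 w.2)) z := by
  set E := Complex.equivRealProdCLM.symm with hE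
  have eE : ∀ w : ℝ × ℝ, E w = Complex.mk w.1 w.2 := fun w => rfl
  have d : DifferentiableAt ℝ (fderiv ℝ h) (Complex.mk z.1 z.2) :=
    (hh.fderiv_right (m := 1) (by norm_num)).differentiableAt one_ne_zero
  have e1 : ∀ (g : ℂ → ℝ) (w v : ℝ × ℝ), fderiv ℝ (fun w : ℝ × ℝ => g (Complex.mk w.1 w.2)) w v =
      fderiv ℝ g (Complex.mk w.1 w.2) (Complex.mk v.1 v.2) := by
    intro g w v
    have : (fun w : ℝ × ℝ => g (Complex.mk w.1 w.2)) = g ∘ E := rfl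
    rw [this, E.comp_right_fderiv]
    rfl
  have e2 : ∀ v : ℝ × ℝ, fderiv ℝ (fun w : ℝ × ℝ => fderiv ℝ
      (fun w : ℝ × ℝ => h (Complex.mk w.1 w.2)) w v) z v =
      iteratedFDeriv ℝ 2 h (Complex.mk z.1 z.2) ![Complex.mk v.1 v.2, Complex.mk v.1 v.2] := by
    intro v
    simp only [e1 h]
    rw [e1 (fun w => fderiv ℝ h w (Complex.mk v.1 v.2)), fderiv_clm_apply d
      (differentiableAt_const _), iteratedFDeriv_two_apply]
    simp
  rw [laplacian_eq_iteratedFDeriv_complexPlane, lap, e2, e2]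
  rfl

/-- `f` is a classical harmonic representative of `φ` on `Ω`. -/
structure HarmonicRep (Ω : Set (ℝ × ℝ)) (φ f : ℝ × ℝ → ℝ) : Prop where
  contDiffOn : ContDiffOn ℝ 2 f Ω
  lap_eq_zero : ∀ z ∈ Ω, lap f z = 0
  ae_eq : φ =ᵐ[volume.restrict Ω] f

theorem IsHarmonicInside.exists_harmonicRep {φ : ℝ × ℝ → ℝ} {ζ : ℝ → ℝ} (hζ : Continuous ζ)
    (h : IsHarmonicInside φ ζ) : ∃ f, HarmonicRep (fluidInterior ζ) φ f := by
  obtain ⟨g, hg, hae⟩ := h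
  rw [interior_fluidDomain hζ] at hg hae
  refine ⟨fun w => g (Complex.mk w.1 w.2), fun z hz => ?_, fun z hz => ?_, ?_⟩
  · have h1 : ContDiffAt ℝ 2 g (Complex.mk z.1 z.2) := (hg _ (by exact hz)).1
    exact (h1.comp z
      (Complex.equivRealProdCLM.symm.contDiff (n := 2)).contDiffAt).contDiffWithinAt
  · have h1 := hg (Complex.mk z.1 z.2) (by exact hz)
    rw [← laplacian_eq_lap h1.1]
    exact h1.2.self_of_nhds
  · rw [Filter.EventuallyEq, ae_restrict_iff' (isOpen_fluidInterior hζ).measurableSet]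
    exact hae

theorem IsWeaklyHarmonic.isHarmonicInside {φ : ℝ × ℝ → ℝ} {ζ : ℝ → ℝ} (hζ : Continuous ζ)
    (h : IsWeaklyHarmonic (fluidInterior ζ) φ) : IsHarmonicInside φ ζ := by
  obtain ⟨f, hf, hae⟩ := h.exists_harmonic (isOpen_fluidInterior hζ)
    ⟨(0, 0), fun hh => lt_irrefl _ hh.1⟩
  refine ⟨fun w => f (w.re, w.im), fun w hw => ?_, ?_⟩
  · rw [interior_fluidDomain hζ] at hw
    have hw' : (w.re, w.im) ∈ fluidInterior ζ := hw
    have sm : ∀ w : ℂ, (w.re, w.im) ∈ fluidInterior ζ →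
        ContDiffAt ℝ 2 (fun w : ℂ => f (w.re, w.im)) w := fun w hw =>
      (contDiffAt_infty.1 (hf _ hw).1 2).comp w
        (Complex.equivRealProdCLM.contDiff (n := 2)).contDiffAt
    have cont : Continuous fun w : ℂ => (w.re, w.im) := Complex.continuous_re.prodMk
      Complex.continuous_im
    refine ⟨sm w hw', ?_⟩
    filter_upwards [cont.continuousAt.eventually ((isOpen_fluidInterior hζ).mem_nhds hw')]
      with u hu
    have := laplacian_eq_lap (z := (u.re, u.im)) (sm u hu)
    simp only [Complex.eta] at this
    rw [this]
    exact (hf _ hu).2.self_of_nhds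
  · rw [interior_fluidDomain hζ]
    exact hae

/-! ### Critical points are weakly harmonic -/

/-- The variation that only changes the potential. -/
def potentialVariation (η : ℝ × ℝ → ℝ) (h : ContDiff ℝ ∞ η) (hc : HasCompactSupport η) :
    Variation where
  θ := fun _ => 0
  η := η
  smooth_θ := contDiff_const
  smooth_η := h
  compact_θ := HasCompactSupport.zero
  compact_η := hc
  bottom_fixed := fun _ => rfl

theorem firstVariation_potentialVariation (lam : ℝ) (φ : ℝ × ℝ → ℝ) (ζ κ : ℝ → ℝ)
    (η : ℝ × ℝ → ℝ) (h : ContDiff ℝ ∞ η) (hc : HasCompactSupport η) :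
    firstVariation lam φ ζ κ (potentialVariation η h hc) = ∫ z in fluidInterior ζ,
      ((grad ζ φ z).1 * fderiv ℝ η z (1, 0) + (grad ζ φ z).2 * fderiv ℝ η z (0, 1)) := by
  simp [firstVariation, Variation.kineticVariation, Variation.kineticVariationDensity,
    Variation.surfaceVariation, potentialVariation]

/-- A critical point of the energy is weakly harmonic. -/
theorem isWeaklyHarmonic_of_firstVariation_eq_zero {lam : ℝ} {φ : ℝ × ℝ → ℝ} {ζ κ : ℝ → ℝ}
    (hadm : Admissible φ ζ) (h : ∀ V, firstVariation lam φ ζ κ V = 0) :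
    IsWeaklyHarmonic (fluidInterior ζ) φ := by
  have W := hadm.hasWeakGrad
  have M := (isOpen_fluidInterior hadm.continuous_surface).measurableSet
  refine ⟨W.1, fun η hη hc hs => ?_⟩
  have e := h (potentialVariation η hη hc)
  rw [firstVariation_potentialVariation] at e
  have sm : ∀ v, ContDiff ℝ ∞ fun z => fderiv ℝ η z v := Variation.contDiff_fderiv_apply hη
  have cs : ∀ v, HasCompactSupport fun z => fderiv ℝ η z v := fun v => hc.fderiv_apply (𝕜 := ℝ) v
  have ts : ∀ v, tsupport (fun z => fderiv ℝ η z v) ⊆ fluidInterior ζ := fun v =>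
    (tsupport_fderiv_apply_subset ℝ v).trans hs
  have i : ∀ {d : ℝ × ℝ → ℝ} (v : ℝ × ℝ), LocallyIntegrableOn d (fluidInterior ζ) →
      IntegrableOn (fun z => d z * fderiv ℝ η z v) (fluidInterior ζ) := fun v hd =>
    LocallyIntegrableOn.mul_hasCompactSupport M hd (sm v).continuous (cs v) (ts v)
  have i2 : ∀ v, IntegrableOn (fun z => φ z * fderiv ℝ (fun w => fderiv ℝ η w v) z v)
      (fluidInterior ζ) := fun v =>
    LocallyIntegrableOn.mul_hasCompactSupport M W.1
      (Variation.contDiff_fderiv_apply (sm v) v).continuous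
      (HasCompactSupport.fderiv_apply (𝕜 := ℝ) (cs v) v)
      ((tsupport_fderiv_apply_subset ℝ v).trans (ts v))
  rw [integral_add (i _ (LocallyIntegrableOn.fst W.2.1)) (i _ (LocallyIntegrableOn.snd W.2.1))] at e
  -- The weak gradient is tested with `η_x` and `η_y`, which gives `∬ φ Δη = -∬ ∇φ · ∇η`.
  simp only [lap, mul_add]
  rw [integral_add (i2 _) (i2 _), (W.2.2 _ (sm (1, 0)) (cs _) (ts _)).1,
    (W.2.2 _ (sm (0, 1)) (cs _) (ts _)).2, ← neg_add, e, neg_zero]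

/-! ### One-sided limits and averages on an interval -/

section Interval

variable {w w' : ℝ → ℝ} {a b : ℝ}

/-- Inside the interval `w` coincides with a primitive of an integrable function, and such a
primitive is continuous up to the ends. -/
theorem exists_tendsto_endpoints (hab : a < b) (hw : ∀ y ∈ Set.Ioo a b, HasDerivAt w (w' y) y)
    (hi : IntegrableOn w' (Set.Ioo a b)) :
    (∃ p, Tendsto w (𝓝[<] b) (𝓝 p)) ∧ ∃ β, Tendsto w (𝓝[>] a) (𝓝 β) := by
  have hii : IntervalIntegrable w' volume a b :=
    (intervalIntegrable_iff_integrableOn_Ioo_of_le hab.le).2 hi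
  obtain ⟨m, hm⟩ := exists_between hab
  have hmI : m ∈ Set.uIcc a b := by rw [Set.uIcc_of_le hab.le]; exact ⟨hm.1.le, hm.2.le⟩
  have hc : ContinuousOn (fun y => w m + ∫ t in m..y, w' t) (Set.Icc a b) := by
    rw [← Set.uIcc_of_le hab.le]
    exact continuousOn_const.add (intervalIntegral.continuousOn_primitive_interval' hii hmI)
  have he : ∀ y ∈ Set.Ioo a b, w m + ∫ t in m..y, w' t = w y := by
    intro y hy
    have hsub : Set.uIcc m y ⊆ Set.Ioo a b := (Set.ordConnected_Ioo).uIcc_subset hm hy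
    rw [intervalIntegral.integral_eq_sub_of_hasDerivAt (fun t ht => hw t (hsub ht))
      (hii.mono_set (hsub.trans (by rw [Set.uIcc_of_le hab.le]; exact Set.Ioo_subset_Icc_self)))]
    ring
  constructor
  · refine ⟨_, ((hc b (Set.right_mem_Icc.2 hab.le)).mono_left ?_).congr' ?_⟩
    · rw [← nhdsWithin_Ioo_eq_nhdsLT hab]
      exact nhdsWithin_mono _ Set.Ioo_subset_Icc_self
    · filter_upwards [Ioo_mem_nhdsLT hab] with y hy using he y hy
  · refine ⟨_, ((hc a (Set.left_mem_Icc.2 hab.le)).mono_left ?_).congr' ?_⟩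
    · rw [← nhdsWithin_Ioo_eq_nhdsGT hab]
      exact nhdsWithin_mono _ Set.Ioo_subset_Icc_self
    · filter_upwards [Ioo_mem_nhdsGT hab] with y hy using he y hy

theorem integral_Ioo_eq_of_tendsto {p β : ℝ} (hab : a < b)
    (hw : ∀ y ∈ Set.Ioo a b, HasDerivAt w (w' y) y) (hi : IntegrableOn w' (Set.Ioo a b))
    (hp : Tendsto w (𝓝[<] b) (𝓝 p)) (hβ : Tendsto w (𝓝[>] a) (𝓝 β)) :
    ∫ y in Set.Ioo a b, w' y = p - β := by
  rw [← integral_Ioc_eq_integral_Ioo, ← intervalIntegral.integral_of_le hab.le]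
  exact intervalIntegral.integral_eq_sub_of_hasDerivAt_of_tendsto hab hw
    ((intervalIntegrable_iff_integrableOn_Ioo_of_le hab.le).2 hi) hβ hp

theorem tendsto_average_of_forall_le {g l r : ℝ → ℝ} {p : ℝ} (hlr : ∀ s, r s - l s = s)
    (hint : ∀ᶠ s in 𝓝[>] (0 : ℝ), IntervalIntegrable g volume (l s) (r s))
    (h : ∀ ε > 0, ∀ᶠ s in 𝓝[>] (0 : ℝ), ∀ᵐ y, y ∈ Set.uIoc (l s) (r s) → ‖g y - p‖ ≤ ε) :
    Tendsto (fun s => s⁻¹ * ∫ y in (l s)..(r s), g y) (𝓝[>] 0) (𝓝 p) := by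
  rw [Metric.tendsto_nhds]
  intro ε hε
  filter_upwards [hint, h (ε / 2) (half_pos hε), self_mem_nhdsWithin] with s h1 h2 hs
  have hs : 0 < s := hs
  have e : (s⁻¹ * ∫ y in (l s)..(r s), g y) - p = s⁻¹ * ∫ y in (l s)..(r s), (g y - p) := by
    rw [intervalIntegral.integral_sub h1 intervalIntegrable_const,
      intervalIntegral.integral_const, hlr, smul_eq_mul]
    field_simp
  rw [dist_eq_norm, e, norm_mul, norm_inv, Real.norm_of_nonneg hs.le]
  have h3 := intervalIntegral.norm_integral_le_of_norm_le_const_ae h2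
  rw [hlr, abs_of_pos hs] at h3
  calc _ ≤ s⁻¹ * (ε / 2 * s) := by gcongr
    _ = ε / 2 := by field_simp
    _ < ε := half_lt_self hε

variable {g : ℝ → ℝ} {p : ℝ}

/-- `g` stands for a slice of `grad`, known only almost everywhere, and `w` for its classical
representative. Traces are defined by averages so that this ambiguity does not matter. -/
theorem tendsto_average_left (hab : a < b) (hw : Tendsto w (𝓝[<] b) (𝓝 p))
    (hg : ∀ᵐ y, y ∈ Set.Ioo a b → g y = w y) (hi : IntegrableOn g (Set.Ioo a b)) :
    (∀ᶠ s in 𝓝[>] (0 : ℝ), IntervalIntegrable g volume (b - s) b) ∧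
      Tendsto (fun s => s⁻¹ * ∫ y in (b - s)..b, g y) (𝓝[>] 0) (𝓝 p) := by
  have ev : ∀ᶠ s in 𝓝[>] (0 : ℝ), s ∈ Set.Ioo 0 (b - a) := Ioo_mem_nhdsGT (by linarith)
  have int : ∀ᶠ s in 𝓝[>] (0 : ℝ), IntervalIntegrable g volume (b - s) b := by
    filter_upwards [ev] with s hs
    rw [intervalIntegrable_iff_integrableOn_Ioo_of_le (by linarith [hs.1])]
    exact hi.mono_set (Set.Ioo_subset_Ioo_left (by linarith [hs.2]))
  refine ⟨int, tendsto_average_of_forall_le (fun s => by ring) int fun ε hε => ?_⟩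
  have h1 : ∀ᶠ y in 𝓝[<] b, ‖w y - p‖ < ε := by
    have := Metric.tendsto_nhds.1 hw ε hε
    simpa only [dist_eq_norm] using this
  obtain ⟨l, hl, hlb⟩ := (mem_nhdsLT_iff_exists_Ioo_subset).1 h1
  have ev2 : ∀ᶠ s in 𝓝[>] (0 : ℝ), s ∈ Set.Ioo 0 (b - l) :=
    Ioo_mem_nhdsGT (by have : l < b := hl; linarith)
  filter_upwards [ev, ev2] with s hs hs2
  filter_upwards [hg, Measure.ae_ne volume b] with y hy hne hyI
  rw [Set.uIoc_of_le (by linarith [hs.1])] at hyI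
  have hyb : y < b := lt_of_le_of_ne hyI.2 hne
  rw [hy ⟨by linarith [hyI.1, hs.2], hyb⟩]
  exact le_of_lt (hlb ⟨by linarith [hyI.1, hs2.2], hyb⟩)

theorem tendsto_average_right (hab : a < b) (hw : Tendsto w (𝓝[>] a) (𝓝 p))
    (hg : ∀ᵐ y, y ∈ Set.Ioo a b → g y = w y) (hi : IntegrableOn g (Set.Ioo a b)) :
    (∀ᶠ s in 𝓝[>] (0 : ℝ), IntervalIntegrable g volume a (a + s)) ∧
      Tendsto (fun s => s⁻¹ * ∫ y in a..(a + s), g y) (𝓝[>] 0) (𝓝 p) := by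
  have ev : ∀ᶠ s in 𝓝[>] (0 : ℝ), s ∈ Set.Ioo 0 (b - a) := Ioo_mem_nhdsGT (by linarith)
  have int : ∀ᶠ s in 𝓝[>] (0 : ℝ), IntervalIntegrable g volume a (a + s) := by
    filter_upwards [ev] with s hs
    rw [intervalIntegrable_iff_integrableOn_Ioo_of_le (by linarith [hs.1])]
    exact hi.mono_set (Set.Ioo_subset_Ioo_right (by linarith [hs.2]))
  refine ⟨int, tendsto_average_of_forall_le (fun s => by ring) int fun ε hε => ?_⟩
  have h1 : ∀ᶠ y in 𝓝[>] a, ‖w y - p‖ < ε := by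
    have := Metric.tendsto_nhds.1 hw ε hε
    simpa only [dist_eq_norm] using this
  obtain ⟨u, hu, hua⟩ := (mem_nhdsGT_iff_exists_Ioo_subset).1 h1
  have ev2 : ∀ᶠ s in 𝓝[>] (0 : ℝ), s ∈ Set.Ioo 0 (u - a) :=
    Ioo_mem_nhdsGT (by have : a < u := hu; linarith)
  filter_upwards [ev, ev2] with s hs hs2
  filter_upwards [hg] with y hy hyI
  rw [Set.uIoc_of_le (by linarith [hs.1])] at hyI
  rw [hy ⟨hyI.1, by linarith [hyI.2, hs.2]⟩]
  exact le_of_lt (hua ⟨hyI.1, by linarith [hyI.2, hs2.2]⟩)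

end Interval

/-! ### Green's formula in the fluid domain -/

section Green

variable {ζ : ℝ → ℝ} {u : ℝ × ℝ → ℝ} {τ β : ℝ → ℝ}

/-- `τ` and `β` are the boundary values of `w` along almost every vertical segment. -/
def HasBoundaryValues (ζ : ℝ → ℝ) (w : ℝ × ℝ → ℝ) (τ β : ℝ → ℝ) : Prop :=
  ∀ᵐ x, Tendsto (fun y => w (x, y)) (𝓝[<] (1 + ζ x)) (𝓝 (τ x)) ∧
    Tendsto (fun y => w (x, y)) (𝓝[>] 0) (𝓝 (β x))

theorem hasDerivAt_slice (hζ : Continuous ζ) (hu : ContDiffOn ℝ 1 u (fluidInterior ζ)) {x y : ℝ}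
    (hy : y ∈ Set.Ioo 0 (1 + ζ x)) :
    HasDerivAt (fun y => u (x, y)) (fderiv ℝ u (x, y) (0, 1)) y := by
  have hd : DifferentiableAt ℝ u (x, y) :=
    (hu.contDiffAt ((isOpen_fluidInterior hζ).mem_nhds ⟨hy.1, hy.2⟩)).differentiableAt one_ne_zero
  have h1 : HasDerivAt (fun y : ℝ => (x, y)) ((0 : ℝ), (1 : ℝ)) y :=
    (hasDerivAt_const y x).prodMk (hasDerivAt_id y)
  exact hd.hasFDerivAt.comp_hasDerivAt y h1

theorem setIntegral_fderiv_snd (hζ : Continuous ζ) (hpos : ∀ x, 0 < 1 + ζ x)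
    (hu : ContDiffOn ℝ 1 u (fluidInterior ζ))
    (hi : IntegrableOn (fun z => fderiv ℝ u z (0, 1)) (fluidInterior ζ))
    (hb : HasBoundaryValues ζ u τ β) :
    ∫ z in fluidInterior ζ, fderiv ℝ u z (0, 1) = ∫ x, (τ x - β x) := by
  rw [setIntegral_fluidInterior hζ hi]
  refine integral_congr_ae ?_
  filter_upwards [ae_integrableOn_slice hζ hi, hb] with x hx hbx
  exact integral_Ioo_eq_of_tendsto (hpos x) (fun y hy => hasDerivAt_slice hζ hu hy) hx hbx.1 hbx.2

theorem fderiv_eq_zero_of_lt_abs_fst {R : ℝ} (hR : ∀ z, R < |z.1| → u z = 0) {z : ℝ × ℝ}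
    (hz : R < |z.1|) : fderiv ℝ u z = 0 := by
  have : u =ᶠ[𝓝 z] fun _ => 0 := by
    have ho : IsOpen {z : ℝ × ℝ | R < |z.1|} :=
      isOpen_lt continuous_const (continuous_abs.comp continuous_fst)
    filter_upwards [ho.mem_nhds hz] with w hw using hR w hw
  rw [this.fderiv_eq]
  simp

/-- With `y = t (1 + ζ)` the fluid becomes the strip `0 < t < 1`. For fixed `t`, the `x`-derivative
of `(1 + ζ) u(x, t (1 + ζ))` is `(1 + ζ)` times `u_x + ζ' / (1 + ζ) ∂_y(y u)`, and its integral over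
the line is zero. The factor `1 + ζ` is the Jacobian, so the bracket integrates to zero over the
fluid. The vertical integral of `∂_y(y u)` is `(1 + ζ) τ`, the weight `y` removing the bottom value.
Only limits along vertical lines are used, and `u` is never evaluated on the boundary. -/
theorem setIntegral_fderiv_fst (hζ : ContDiff ℝ 1 ζ) (hpos : ∀ x, 0 < 1 + ζ x)
    (hu : ContDiffOn ℝ 1 u (fluidInterior ζ)) (hu0 : IntegrableOn u (fluidInterior ζ))
    (hu1 : IntegrableOn (fun z => fderiv ℝ u z (1, 0)) (fluidInterior ζ))
    (hu2 : IntegrableOn (fun z => fderiv ℝ u z (0, 1)) (fluidInterior ζ))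
    {R : ℝ} (hR : ∀ z, R < |z.1| → u z = 0) (hb : HasBoundaryValues ζ u τ β) :
    ∫ z in fluidInterior ζ, fderiv ℝ u z (1, 0) = -∫ x, deriv ζ x * τ x := by
  have ζc := hζ.continuous
  have ζ'c : Continuous (deriv ζ) := hζ.continuous_deriv le_rfl
  have O := isOpen_fluidInterior ζc
  have M := O.measurableSet
  have dζ : ∀ x, HasDerivAt (fun x => 1 + ζ x) (deriv ζ x) x := fun x =>
    ((hζ.differentiable one_ne_zero x).hasDerivAt).const_add 1
  have cc : Continuous fun x => 1 + ζ x := continuous_const.add ζc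
  have qc : Continuous fun x => deriv ζ x / (1 + ζ x) := ζ'c.div cc fun x => (hpos x).ne'
  have uc : ∀ v, ContinuousOn (fun z => fderiv ℝ u z v) (fluidInterior ζ) := fun v =>
    (hu.continuousOn_fderiv_of_isOpen O le_rfl).clm_apply continuousOn_const
  have z0 : ∀ z : ℝ × ℝ, R < |z.1| → fderiv ℝ u z = 0 := fun z hz =>
    fderiv_eq_zero_of_lt_abs_fst hR hz
  -- integrability of the weighted densities
  obtain ⟨A, hA⟩ := (isCompact_Icc (a := -R) (b := R)).exists_bound_of_continuousOn cc.continuousOn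
  obtain ⟨B, hB⟩ := (isCompact_Icc (a := -R) (b := R)).exists_bound_of_continuousOn qc.continuousOn
  -- This is `∂_y(y u)`.
  set n : ℝ × ℝ → ℝ := fun z => u z + z.2 * fderiv ℝ u z (0, 1) with hn
  have iyu : IntegrableOn (fun z => z.2 * fderiv ℝ u z (0, 1)) (fluidInterior ζ) := by
    refine (hu2.norm.const_mul A).mono'
      ((continuousOn_snd.mul (uc _)).aestronglyMeasurable M) ?_
    filter_upwards [ae_restrict_mem M] with z hz
    by_cases h : |z.1| ≤ R
    · have h1 := hA z.1 (abs_le.1 h)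
      rw [norm_mul]
      gcongr
      rw [Real.norm_of_nonneg hz.1.le]
      exact hz.2.le.trans ((le_abs_self _).trans h1)
    · simp [z0 z (not_le.1 h)]
  have i_n : IntegrableOn n (fluidInterior ζ) := hu0.add iyu
  have i_m : IntegrableOn (fun z => deriv ζ z.1 / (1 + ζ z.1) * n z) (fluidInterior ζ) := by
    refine (i_n.norm.const_mul B).mono' (ContinuousOn.aestronglyMeasurable
      ((qc.comp continuous_fst).continuousOn.mul
        (hu.continuousOn.add (continuousOn_snd.mul (uc _)))) M) (Eventually.of_forall fun z => ?_)
    by_cases h : |z.1| ≤ R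
    · rw [norm_mul]
      gcongr
      exact hB z.1 (abs_le.1 h)
    · simp [hn, z0 z (not_le.1 h), hR z (not_le.1 h)]
  -- flattening of the domain
  set Φ : ℝ × ℝ → ℝ × ℝ := fun z => (z.1, z.2 * (1 + ζ z.1)) with hΦ
  set S : Set (ℝ × ℝ) := Set.univ ×ˢ Set.Ioo (0 : ℝ) 1 with hS
  have MS : MeasurableSet S := MeasurableSet.univ.prod measurableSet_Ioo
  have mem : ∀ {x t : ℝ}, t ∈ Set.Ioo (0 : ℝ) 1 → (x, t * (1 + ζ x)) ∈ fluidInterior ζ := by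
    intro x t ht
    exact ⟨mul_pos ht.1 (hpos x), by have := hpos x; simp only; nlinarith [ht.2]⟩
  have im : Φ '' S = fluidInterior ζ := by
    ext ⟨x, y⟩
    constructor
    · rintro ⟨⟨x', t⟩, ⟨-, ht⟩, e⟩
      rw [← e]
      exact mem ht
    · intro hz
      have hc := hpos x
      refine ⟨(x, y / (1 + ζ x)), ⟨trivial, div_pos hz.1 hc, (div_lt_one hc).2 hz.2⟩, ?_⟩
      simp only [hΦ]
      rw [div_mul_cancel₀ _ hc.ne']
  have inj : Set.InjOn Φ S := by
    rintro ⟨x, t⟩ - ⟨x', t'⟩ - e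
    simp only [hΦ, Prod.mk.injEq] at e
    obtain ⟨rfl, e⟩ := e
    rw [mul_right_cancel₀ (hpos x).ne' e]
  have dΦ : ∀ z ∈ S, HasFDerivWithinAt Φ (shearDeriv (z.2 * deriv ζ z.1) (1 + ζ z.1)) S z := by
    intro z _
    have h1 : HasFDerivAt (fun z : ℝ × ℝ => 1 + ζ z.1)
        (deriv ζ z.1 • ContinuousLinearMap.fst ℝ ℝ ℝ) z :=
      (dζ z.1).comp_hasFDerivAt z hasFDerivAt_fst
    have h2 := (hasFDerivAt_snd (𝕜 := ℝ) (p := z)).mul h1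
    have h3 := (hasFDerivAt_shear h2.differentiableAt).hasFDerivWithinAt (s := S)
    have e : fderiv ℝ (fun z : ℝ × ℝ => z.2 * (1 + ζ z.1)) z = z.2 • deriv ζ z.1 •
        ContinuousLinearMap.fst ℝ ℝ ℝ + (1 + ζ z.1) • ContinuousLinearMap.snd ℝ ℝ ℝ :=
      h2.fderiv
    have e' : (fun z : ℝ × ℝ => z.2) * (fun z : ℝ × ℝ => 1 + ζ z.1) =
      fun z : ℝ × ℝ => z.2 * (1 + ζ z.1) := rfl
    simp only [e', e] at h3
    simpa [hΦ] using h3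
  set k : ℝ × ℝ → ℝ := fun z => fderiv ℝ u z (1, 0) + deriv ζ z.1 / (1 + ζ z.1) * n z with hk
  have i_k : IntegrableOn k (fluidInterior ζ) := hu1.add i_m
  have iW := (integrableOn_image_iff_integrableOn_abs_det_fderiv_smul volume MS dΦ inj k).1
    (by rw [im]; exact i_k)
  have eW := integral_image_eq_integral_abs_det_fderiv_smul volume MS dΦ inj k
  simp only [det_shearDeriv, abs_of_pos (hpos _), smul_eq_mul] at iW eW
  have slice0 : ∀ t ∈ Set.Ioo (0 : ℝ) 1, ∫ x, (1 + ζ x) * k (Φ (x, t)) = 0 := by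
    intro t ht
    have γc : Continuous fun x => (x, t * (1 + ζ x)) :=
      continuous_id.prodMk (continuous_const.mul cc)
    have cu : Continuous fun x => u (x, t * (1 + ζ x)) :=
      hu.continuousOn.comp_continuous γc fun x => mem ht
    have cu' : ∀ v, Continuous fun x => fderiv ℝ u (x, t * (1 + ζ x)) v := fun v =>
      (uc v).comp_continuous γc fun x => mem ht
    have hd : ∀ x, HasDerivAt (fun x => (1 + ζ x) * u (x, t * (1 + ζ x)))
        ((1 + ζ x) * k (Φ (x, t))) x := by
      intro x
      have h1 : HasDerivAt (fun x => (x, t * (1 + ζ x))) (1, t * deriv ζ x) x :=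
        (hasDerivAt_id x).prodMk ((dζ x).const_mul t)
      have hdu : DifferentiableAt ℝ u (x, t * (1 + ζ x)) :=
        (hu.contDiffAt (O.mem_nhds (mem ht))).differentiableAt one_ne_zero
      have h2 := hdu.hasFDerivAt.comp_hasDerivAt x h1
      rw [clm_apply_eq] at h2
      refine ((dζ x).mul h2).congr_deriv ?_
      have := (hpos x).ne'
      simp only [hk, hn, hΦ, Function.comp]
      field_simp
      ring
    have kc : Continuous fun x => (1 + ζ x) * k (Φ (x, t)) := by
      simp only [hk, hn, hΦ]
      exact cc.mul ((cu' _).add (qc.mul (cu.add ((continuous_const.mul cc).mul (cu' _)))))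
    refine integral_eq_zero_of_hasDerivAt_of_integrable hd ?_ ?_
    · refine kc.integrable_of_hasCompactSupport (HasCompactSupport.intro
        (isCompact_Icc (a := -R) (b := R)) fun x hx => ?_)
      have hx' : R < |x| := not_le.1 fun h => hx (abs_le.1 h)
      simp [hk, hn, hΦ, z0 (x, t * (1 + ζ x)) hx', hR (x, t * (1 + ζ x)) hx']
    · refine (cc.mul cu).integrable_of_hasCompactSupport (HasCompactSupport.intro
        (isCompact_Icc (a := -R) (b := R)) fun x hx => ?_)
      have hx' : R < |x| := not_le.1 fun h => hx (abs_le.1 h)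
      simp [hR (x, t * (1 + ζ x)) hx']
  have k0 : ∫ z in fluidInterior ζ, k z = 0 := by
    rw [← im, eW]
    rw [hS, IntegrableOn, Measure.volume_eq_prod, ← Measure.prod_restrict] at iW
    rw [hS, Measure.volume_eq_prod, ← Measure.prod_restrict, integral_prod_symm _ iW]
    rw [Measure.restrict_univ]
    exact setIntegral_eq_zero_of_forall_eq_zero slice0
  have m0 : ∫ z in fluidInterior ζ, deriv ζ z.1 / (1 + ζ z.1) * n z = ∫ x, deriv ζ x * τ x := by
    rw [setIntegral_fluidInterior ζc i_m]
    refine integral_congr_ae ?_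
    filter_upwards [ae_integrableOn_slice ζc i_n, hb] with x hx hbx
    rw [integral_const_mul]
    have h1 : ∫ y in Set.Ioo 0 (1 + ζ x), n (x, y) = (1 + ζ x) * τ x - 0 * β x := by
      refine integral_Ioo_eq_of_tendsto (w := fun y => y * u (x, y)) (hpos x) (fun y hy => ?_) hx
        ?_ ?_
      · refine ((hasDerivAt_id y).mul (hasDerivAt_slice ζc hu hy)).congr_deriv ?_
        simp [hn]
      · exact (tendsto_id.mono_left nhdsWithin_le_nhds).mul hbx.1
      · exact (tendsto_id.mono_left nhdsWithin_le_nhds).mul hbx.2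
    rw [h1]
    have := (hpos x).ne'
    field_simp
    ring
  have key : ∫ z in fluidInterior ζ, k z = (∫ z in fluidInterior ζ, fderiv ℝ u z (1, 0)) +
      ∫ z in fluidInterior ζ, deriv ζ z.1 / (1 + ζ z.1) * n z := integral_add hu1 i_m
  rw [k0, m0] at key
  linarith

end Green

/-! ### Functions that are regular up to the boundary in the integral sense -/

/-- The bounded part `|x| ≤ R` of the fluid. -/
def strip (ζ : ℝ → ℝ) (R : ℝ) : Set (ℝ × ℝ) := fluidInterior ζ ∩ {z | |z.1| ≤ R}

theorem measurableSet_abs_fst_le (R : ℝ) : MeasurableSet {z : ℝ × ℝ | |z.1| ≤ R} :=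
  (isClosed_le (continuous_abs.comp continuous_fst) continuous_const).measurableSet

theorem measurableSet_strip {ζ : ℝ → ℝ} (hζ : Continuous ζ) (R : ℝ) : MeasurableSet (strip ζ R) :=
  (isOpen_fluidInterior hζ).measurableSet.inter (measurableSet_abs_fst_le R)

theorem volume_strip_lt_top {ζ : ℝ → ℝ} (hζ : Continuous ζ) (R : ℝ) : volume (strip ζ R) < ⊤ := by
  obtain ⟨A, hA⟩ := (isCompact_Icc (a := -R) (b := R)).exists_bound_of_continuousOn
    (continuous_const.add hζ : Continuous fun x => 1 + ζ x).continuousOn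
  have hs : strip ζ R ⊆ Set.Icc (-R) R ×ˢ Set.Icc 0 A := fun z hz =>
    ⟨abs_le.1 hz.2, hz.1.1.le, hz.1.2.le.trans ((le_abs_self _).trans (hA z.1 (abs_le.1 hz.2)))⟩
  exact (measure_mono hs).trans_lt (isCompact_Icc.prod isCompact_Icc).measure_lt_top

theorem integrableOn_indicator_strip {ζ : ℝ → ℝ} {f : ℝ × ℝ → ℝ} {R : ℝ}
    (hf : IntegrableOn f (strip ζ R)) :
    IntegrableOn ({z : ℝ × ℝ | |z.1| ≤ R}.indicator f) (fluidInterior ζ) := by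
  rw [IntegrableOn, integrable_indicator_iff (measurableSet_abs_fst_le R), IntegrableOn,
    Measure.restrict_restrict (measurableSet_abs_fst_le R), Set.inter_comm]
  exact hf

/-- Exhaustion by integer widths leaves only countably many exceptional null sets. -/
theorem ae_integrableOn_slice_of_strip {ζ : ℝ → ℝ} {f : ℝ × ℝ → ℝ} (hζ : Continuous ζ)
    (hf : ∀ R, IntegrableOn f (strip ζ R)) :
    ∀ᵐ x, IntegrableOn (fun y => f (x, y)) (Set.Ioo 0 (1 + ζ x)) := by
  have h : ∀ n : ℕ, ∀ᵐ x, IntegrableOn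
      (fun y => {z : ℝ × ℝ | |z.1| ≤ n}.indicator f (x, y)) (Set.Ioo 0 (1 + ζ x)) := fun n =>
    ae_integrableOn_slice hζ (integrableOn_indicator_strip (hf n))
  filter_upwards [ae_all_iff.2 h] with x hx
  obtain ⟨n, hn⟩ := exists_nat_ge |x|
  refine (hx n).congr_fun (fun y _ => ?_) measurableSet_Ioo
  exact Set.indicator_of_mem (s := {z : ℝ × ℝ | |z.1| ≤ n}) hn f

theorem integrableOn_inter_of_isCompact {ζ : ℝ → ℝ} {f : ℝ × ℝ → ℝ}
    (hf : ∀ R, IntegrableOn f (strip ζ R)) {K : Set (ℝ × ℝ)} (hK : IsCompact K) :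
    IntegrableOn f (fluidInterior ζ ∩ K) := by
  obtain ⟨R, hR⟩ := hK.isBounded.exists_norm_le
  exact (hf R).mono_set fun z hz => ⟨hz.1, (norm_fst_le z).trans (hR z hz.2)⟩

theorem locallyIntegrable_of_forall_Icc {p : ℝ → ℝ}
    (h : ∀ R, IntegrableOn p (Set.Icc (-R) R)) : LocallyIntegrable p := by
  refine locallyIntegrable_iff.2 fun k hk => ?_
  obtain ⟨R, hR⟩ := hk.isBounded.exists_norm_le
  exact (h R).mono_set fun x hx => abs_le.1 (hR x hx)

/-- `w` is `C¹` in the fluid and is integrable together with its first derivatives over the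
bounded parts of the fluid. -/
structure RegularInside (ζ : ℝ → ℝ) (w : ℝ × ℝ → ℝ) : Prop where
  contDiffOn : ContDiffOn ℝ 1 w (fluidInterior ζ)
  integrableOn : ∀ R, IntegrableOn w (strip ζ R)
  integrableOn_fst : ∀ R, IntegrableOn (fun z => fderiv ℝ w z (1, 0)) (strip ζ R)
  integrableOn_snd : ∀ R, IntegrableOn (fun z => fderiv ℝ w z (0, 1)) (strip ζ R)

section

variable {ζ : ℝ → ℝ} {w : ℝ × ℝ → ℝ} {p β : ℝ → ℝ}

theorem RegularInside.exists_hasBoundaryValues (hζ : Continuous ζ) (hpos : ∀ x, 0 < 1 + ζ x)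
    (hw : RegularInside ζ w) : ∃ p β, HasBoundaryValues ζ w p β := by
  -- On the null set of slices without an integrable derivative the boundary values are arbitrary.
  have h : ∀ x, ∃ q : ℝ × ℝ, IntegrableOn (fun y => fderiv ℝ w (x, y) (0, 1))
      (Set.Ioo 0 (1 + ζ x)) → Tendsto (fun y => w (x, y)) (𝓝[<] (1 + ζ x)) (𝓝 q.1) ∧
        Tendsto (fun y => w (x, y)) (𝓝[>] 0) (𝓝 q.2) := by
    intro x
    by_cases hi : IntegrableOn (fun y => fderiv ℝ w (x, y) (0, 1)) (Set.Ioo 0 (1 + ζ x))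
    · obtain ⟨⟨p, hp⟩, β, hβ⟩ := exists_tendsto_endpoints (hpos x)
        (fun y hy => hasDerivAt_slice hζ hw.contDiffOn hy) hi
      exact ⟨(p, β), fun _ => ⟨hp, hβ⟩⟩
    · exact ⟨0, fun h => absurd h hi⟩
  choose q hq using h
  exact ⟨fun x => (q x).1, fun x => (q x).2,
    (ae_integrableOn_slice_of_strip hζ hw.integrableOn_snd).mono fun x hx => hq x hx⟩

/-- Vertical integration of `∂_y(y w)` gives `(1 + ζ) p`, which isolates the surface value;
integration of `w_y` gives `p - β`. Slice integrals of integrable functions are integrable in `x`.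
-/
theorem RegularInside.locallyIntegrable_boundaryValues (hζ : Continuous ζ)
    (hpos : ∀ x, 0 < 1 + ζ x) (hw : RegularInside ζ w) (hb : HasBoundaryValues ζ w p β) :
    LocallyIntegrable p ∧ LocallyIntegrable β := by
  have cc : Continuous fun x => 1 + ζ x := continuous_const.add hζ
  have O := isOpen_fluidInterior hζ
  have cont : ContinuousOn (fun z => z.2 * fderiv ℝ w z (0, 1)) (fluidInterior ζ) :=
    continuousOn_snd.mul ((hw.contDiffOn.continuousOn_fderiv_of_isOpen O le_rfl).clm_apply
      continuousOn_const)
  have iy : ∀ R, IntegrableOn (fun z => z.2 * fderiv ℝ w z (0, 1)) (strip ζ R) := by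
    intro R
    obtain ⟨A, hA⟩ := (isCompact_Icc (a := -R) (b := R)).exists_bound_of_continuousOn
      cc.continuousOn
    refine ((hw.integrableOn_snd R).norm.const_mul A).mono'
      ((cont.mono Set.inter_subset_left).aestronglyMeasurable (measurableSet_strip hζ R)) ?_
    filter_upwards [ae_restrict_mem (measurableSet_strip hζ R)] with z hz
    rw [norm_mul]
    gcongr
    rw [Real.norm_of_nonneg hz.1.1.le]
    exact hz.1.2.le.trans ((le_abs_self _).trans (hA z.1 (abs_le.1 hz.2)))
  have i_n : ∀ R, IntegrableOn (fun z => w z + z.2 * fderiv ℝ w z (0, 1)) (strip ζ R) :=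
    fun R => (hw.integrableOn R).add (iy R)
  have slice : ∀ {f : ℝ × ℝ → ℝ} {q : ℝ → ℝ}, (∀ R, IntegrableOn f (strip ζ R)) →
      (∀ᵐ x, ∫ y in Set.Ioo 0 (1 + ζ x), f (x, y) = q x) → LocallyIntegrable q := by
    intro f q hf hq
    refine locallyIntegrable_of_forall_Icc fun R => ?_
    have h := integrable_slice_integral hζ (integrableOn_indicator_strip (hf R))
    refine (h.integrableOn (s := Set.Icc (-R) R)).congr ?_
    rw [Filter.EventuallyEq, ae_restrict_iff' measurableSet_Icc]
    filter_upwards [hq] with x hx hxR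
    rw [← hx]
    refine setIntegral_congr_fun measurableSet_Ioo fun y _ => ?_
    exact Set.indicator_of_mem (s := {z : ℝ × ℝ | |z.1| ≤ R}) (abs_le.2 hxR) f
  have sl1 := ae_integrableOn_slice_of_strip hζ i_n
  have sl2 := ae_integrableOn_slice_of_strip hζ hw.integrableOn_snd
  have h1 : LocallyIntegrable fun x => (1 + ζ x) * p x := by
    refine slice i_n ?_
    filter_upwards [sl1, hb] with x hx hbx
    have := integral_Ioo_eq_of_tendsto (w := fun y => y * w (x, y)) (p := (1 + ζ x) * p x)
      (β := 0 * β x) (hpos x) (fun y hy => ?_) hx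
      ((tendsto_id.mono_left nhdsWithin_le_nhds).mul hbx.1)
      ((tendsto_id.mono_left nhdsWithin_le_nhds).mul hbx.2)
    · rw [this]
      ring
    · refine ((hasDerivAt_id y).mul (hasDerivAt_slice hζ hw.contDiffOn hy)).congr_deriv ?_
      simp
  have h2 : LocallyIntegrable fun x => p x - β x := by
    refine slice hw.integrableOn_snd ?_
    filter_upwards [sl2, hb] with x hx hbx
    exact integral_Ioo_eq_of_tendsto (hpos x)
      (fun y hy => hasDerivAt_slice hζ hw.contDiffOn hy) hx hbx.1 hbx.2
  have hp : LocallyIntegrable p := by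
    refine locallyIntegrable_of_forall_Icc fun R => ?_
    have h3 := (h1.integrableOn_isCompact (isCompact_Icc (a := -R) (b := R))).continuousOn_mul
      (cc.inv₀ fun x => (hpos x).ne').continuousOn isCompact_Icc
    refine h3.congr_fun (fun x _ => ?_) measurableSet_Icc
    exact inv_mul_cancel_left₀ (hpos x).ne' (p x)
  refine ⟨hp, ?_⟩
  have h4 := hp.sub h2
  have e : (p - fun x => p x - β x) = β := by
    funext x
    simp
  rwa [e] at h4

/-- **Green's formula**, tested with a smooth function that need not vanish on the boundary. -/
theorem RegularInside.green (hζ : ContDiff ℝ 1 ζ) (hpos : ∀ x, 0 < 1 + ζ x)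
    (hw : RegularInside ζ w) (hb : HasBoundaryValues ζ w p β) {ψ : ℝ × ℝ → ℝ}
    (hψ : ContDiff ℝ ∞ ψ) (hc : HasCompactSupport ψ) :
    ((∫ z in fluidInterior ζ, w z * fderiv ℝ ψ z (1, 0)) +
        ∫ z in fluidInterior ζ, fderiv ℝ w z (1, 0) * ψ z =
      -∫ x, deriv ζ x * (p x * ψ (x, 1 + ζ x))) ∧
    ((∫ z in fluidInterior ζ, w z * fderiv ℝ ψ z (0, 1)) +
        ∫ z in fluidInterior ζ, fderiv ℝ w z (0, 1) * ψ z =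
      ∫ x, (p x * ψ (x, 1 + ζ x) - β x * ψ (x, 0))) := by
  have O := isOpen_fluidInterior hζ.continuous
  have M := O.measurableSet
  have I : ∀ {d χ : ℝ × ℝ → ℝ}, (∀ R, IntegrableOn d (strip ζ R)) → Continuous χ →
      HasCompactSupport χ → IntegrableOn (fun z => d z * χ z) (fluidInterior ζ) := fun hd h1 h2 =>
    IntegrableOn.mul_hasCompactSupport M h1 h2 (integrableOn_inter_of_isCompact hd h2)
  have ψc : ∀ v, Continuous fun z => fderiv ℝ ψ z v := fun v =>
    (Variation.contDiff_fderiv_apply hψ v).continuous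
  have ψs : ∀ v, HasCompactSupport fun z => fderiv ℝ ψ z v := fun v => hc.fderiv_apply (𝕜 := ℝ) v
  have e : ∀ v, Set.EqOn (fun z => w z * fderiv ℝ ψ z v + fderiv ℝ w z v * ψ z)
      (fun z => fderiv ℝ (fun z => w z * ψ z) z v) (fluidInterior ζ) := by
    intro v z hz
    have := Variation.fderiv_mul_apply
      ((hw.contDiffOn.contDiffAt (O.mem_nhds hz)).differentiableAt one_ne_zero)
      (hψ.differentiable (by simp) z) v
    simp only
    rw [this]
    ring
  have i1 := (I hw.integrableOn (ψc (1, 0)) (ψs _)).add (I hw.integrableOn_fst hψ.continuous hc)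
  have i2 := (I hw.integrableOn (ψc (0, 1)) (ψs _)).add (I hw.integrableOn_snd hψ.continuous hc)
  have j1 := i1.congr_fun (e (1, 0)) M
  have j2 := i2.congr_fun (e (0, 1)) M
  have hu : ContDiffOn ℝ 1 (fun z => w z * ψ z) (fluidInterior ζ) :=
    hw.contDiffOn.mul (hψ.of_le (by simp)).contDiffOn
  have hbu : HasBoundaryValues ζ (fun z => w z * ψ z) (fun x => p x * ψ (x, 1 + ζ x))
      fun x => β x * ψ (x, 0) := by
    filter_upwards [hb] with x hx
    have hψx : Continuous fun y => ψ (x, y) := hψ.continuous.comp (by fun_prop)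
    exact ⟨hx.1.mul (hψx.continuousAt.tendsto.mono_left nhdsWithin_le_nhds),
      hx.2.mul (hψx.continuousAt.tendsto.mono_left nhdsWithin_le_nhds)⟩
  obtain ⟨R, hR⟩ := IsCompact.isBounded hc |>.exists_norm_le
  have hR' : ∀ z : ℝ × ℝ, R < |z.1| → w z * ψ z = 0 := by
    intro z hz
    rw [image_eq_zero_of_notMem_tsupport (f := ψ), mul_zero]
    exact fun h => absurd ((norm_fst_le z).trans (hR z h)) (not_le.2 hz)
  rw [← integral_add (I hw.integrableOn (ψc (1, 0)) (ψs _)) (I hw.integrableOn_fst hψ.continuous hc),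
    ← integral_add (I hw.integrableOn (ψc (0, 1)) (ψs _)) (I hw.integrableOn_snd hψ.continuous hc),
    setIntegral_congr_fun M (e (1, 0)), setIntegral_congr_fun M (e (0, 1))]
  exact ⟨setIntegral_fderiv_fst hζ hpos hu (I hw.integrableOn hψ.continuous hc) j1 j2 hR' hbu,
    setIntegral_fderiv_snd hζ.continuous hpos hu j2 hbu⟩

/-- `w` is `C¹` in the fluid and is square integrable together with its first derivatives over the
bounded parts of the fluid. -/
structure SqRegularInside (ζ : ℝ → ℝ) (w : ℝ × ℝ → ℝ) : Prop where
  contDiffOn : ContDiffOn ℝ 1 w (fluidInterior ζ)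
  integrableOn : ∀ R, IntegrableOn (fun z => w z ^ 2) (strip ζ R)
  integrableOn_fst : ∀ R, IntegrableOn (fun z => fderiv ℝ w z (1, 0) ^ 2) (strip ζ R)
  integrableOn_snd : ∀ R, IntegrableOn (fun z => fderiv ℝ w z (0, 1) ^ 2) (strip ζ R)

/-- By the product rule and `|f g| ≤ f² + g²`. Square integrability of the second derivatives of the
potential is needed here, so that quadratic expressions in the velocity obey Green's formula. -/
theorem SqRegularInside.mul (hζ : Continuous ζ) {v : ℝ × ℝ → ℝ} (hv : SqRegularInside ζ v)
    (hw : SqRegularInside ζ w) : RegularInside ζ (fun z => v z * w z) := by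
  have O := isOpen_fluidInterior hζ
  have prod : ∀ {f g : ℝ × ℝ → ℝ} {R : ℝ}, ContinuousOn f (fluidInterior ζ) →
      ContinuousOn g (fluidInterior ζ) → IntegrableOn (fun z => f z ^ 2) (strip ζ R) →
      IntegrableOn (fun z => g z ^ 2) (strip ζ R) → IntegrableOn (fun z => f z * g z)
        (strip ζ R) := by
    intro f g R hf hg if2 ig2
    refine (if2.add ig2).mono' (((hf.mul hg).mono Set.inter_subset_left).aestronglyMeasurable
      (measurableSet_strip hζ R)) (Eventually.of_forall fun z => ?_)
    rw [Real.norm_eq_abs, abs_le]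
    simp only [Pi.add_apply]
    constructor <;> nlinarith [sq_nonneg (f z + g z), sq_nonneg (f z - g z), sq_nonneg (f z),
      sq_nonneg (g z)]
  have cd : ∀ {f : ℝ × ℝ → ℝ}, ContDiffOn ℝ 1 f (fluidInterior ζ) → ∀ a : ℝ × ℝ,
      ContinuousOn (fun z => fderiv ℝ f z a) (fluidInterior ζ) := fun hf a =>
    (hf.continuousOn_fderiv_of_isOpen O le_rfl).clm_apply continuousOn_const
  have e : ∀ a R, Set.EqOn (fun z => v z * fderiv ℝ w z a + w z * fderiv ℝ v z a)
      (fun z => fderiv ℝ (fun z => v z * w z) z a) (strip ζ R) := fun a R z hz =>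
    (Variation.fderiv_mul_apply
      ((hv.contDiffOn.contDiffAt (O.mem_nhds hz.1)).differentiableAt one_ne_zero)
      ((hw.contDiffOn.contDiffAt (O.mem_nhds hz.1)).differentiableAt one_ne_zero) a).symm
  refine ⟨hv.contDiffOn.mul hw.contDiffOn, fun R => ?_, fun R => ?_, fun R => ?_⟩
  · exact prod hv.contDiffOn.continuousOn hw.contDiffOn.continuousOn (hv.integrableOn R)
      (hw.integrableOn R)
  · exact ((prod hv.contDiffOn.continuousOn (cd hw.contDiffOn _) (hv.integrableOn R)
      (hw.integrableOn_fst R)).add (prod hw.contDiffOn.continuousOn (cd hv.contDiffOn _)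
      (hw.integrableOn R) (hv.integrableOn_fst R))).congr_fun (e _ R) (measurableSet_strip hζ R)
  · exact ((prod hv.contDiffOn.continuousOn (cd hw.contDiffOn _) (hv.integrableOn R)
      (hw.integrableOn_snd R)).add (prod hw.contDiffOn.continuousOn (cd hv.contDiffOn _)
      (hw.integrableOn R) (hv.integrableOn_snd R))).congr_fun (e _ R) (measurableSet_strip hζ R)

theorem sqRegularInside_one (hζ : Continuous ζ) : SqRegularInside ζ (fun _ => 1) where
  contDiffOn := contDiffOn_const
  integrableOn R := integrableOn_const (volume_strip_lt_top hζ R).ne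
  integrableOn_fst R := by simp
  integrableOn_snd R := by simp

/-- Multiplication by 1, which is square integrable because the strips have finite area. -/
theorem SqRegularInside.regularInside (hζ : Continuous ζ) (hw : SqRegularInside ζ w) :
    RegularInside ζ w := by
  simpa using hw.mul hζ (sqRegularInside_one hζ)

theorem RegularInside.sub (hζ : Continuous ζ) {v : ℝ × ℝ → ℝ} (hv : RegularInside ζ v)
    (hw : RegularInside ζ w) : RegularInside ζ (fun z => v z - w z) := by
  have O := isOpen_fluidInterior hζ
  have e : ∀ a R, Set.EqOn (fun z => fderiv ℝ v z a - fderiv ℝ w z a)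
      (fun z => fderiv ℝ (fun z => v z - w z) z a) (strip ζ R) := by
    intro a R z hz
    simp only
    rw [fderiv_fun_sub
      ((hv.contDiffOn.contDiffAt (O.mem_nhds hz.1)).differentiableAt one_ne_zero)
      ((hw.contDiffOn.contDiffAt (O.mem_nhds hz.1)).differentiableAt one_ne_zero), sub_apply]
  exact ⟨hv.contDiffOn.sub hw.contDiffOn, fun R => (hv.integrableOn R).sub (hw.integrableOn R),
    fun R => ((hv.integrableOn_fst R).sub (hw.integrableOn_fst R)).congr_fun (e _ R)
      (measurableSet_strip hζ R),
    fun R => ((hv.integrableOn_snd R).sub (hw.integrableOn_snd R)).congr_fun (e _ R)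
      (measurableSet_strip hζ R)⟩

end

/-! ### Traces and boundary test functions -/

section Traces

variable {ζ : ℝ → ℝ} {g w : ℝ × ℝ → ℝ} {τ τ' β β' : ℝ → ℝ}

theorem HasBoundaryValues.hasSurfaceTrace (hζ : Continuous ζ) (hpos : ∀ x, 0 < 1 + ζ x)
    (hb : HasBoundaryValues ζ w τ β) (hg : g =ᵐ[volume.restrict (fluidInterior ζ)] w)
    (hi : ∀ R, IntegrableOn g (strip ζ R)) : HasSurfaceTrace ζ g τ := by
  filter_upwards [hb, ae_slice hζ hg, ae_integrableOn_slice_of_strip hζ hi] with x h1 h2 h3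
  exact tendsto_average_left (hpos x) h1.1 h2 h3

theorem HasBoundaryValues.hasBottomTrace (hζ : Continuous ζ) (hpos : ∀ x, 0 < 1 + ζ x)
    (hb : HasBoundaryValues ζ w τ β) (hg : g =ᵐ[volume.restrict (fluidInterior ζ)] w)
    (hi : ∀ R, IntegrableOn g (strip ζ R)) : HasBottomTrace g β := by
  filter_upwards [hb, ae_slice hζ hg, ae_integrableOn_slice_of_strip hζ hi] with x h1 h2 h3
  simpa only [zero_add] using tendsto_average_right (hpos x) h1.2 h2 h3

theorem HasSurfaceTrace.ae_eq (h : HasSurfaceTrace ζ g τ) (h' : HasSurfaceTrace ζ g τ') :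
    τ =ᵐ[volume] τ' := by
  filter_upwards [h, h'] with x h1 h2 using tendsto_nhds_unique h1.2 h2.2

theorem HasBottomTrace.ae_eq (h : HasBottomTrace g β) (h' : HasBottomTrace g β') :
    β =ᵐ[volume] β' := by
  filter_upwards [h, h'] with x h1 h2 using tendsto_nhds_unique h1.2 h2.2

theorem HasBottomTrace.congr (h : HasBottomTrace g β) (e : β =ᵐ[volume] β') :
    HasBottomTrace g β' := by
  filter_upwards [h, e] with x h1 h2
  exact ⟨h1.1, h2 ▸ h1.2⟩

end Traces

section TestFunctions

variable {ζ : ℝ → ℝ} {a c : ℝ → ℝ}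

theorem contDiff_mul_prod (ha : ContDiff ℝ ∞ a) (hc : ContDiff ℝ ∞ c) :
    ContDiff ℝ ∞ fun z : ℝ × ℝ => a z.1 * c z.2 :=
  (ha.comp contDiff_fst).mul (hc.comp contDiff_snd)

theorem hasCompactSupport_mul_prod (ha : HasCompactSupport a) (hc : HasCompactSupport c) :
    HasCompactSupport fun z : ℝ × ℝ => a z.1 * c z.2 := by
  refine HasCompactSupport.intro (K := tsupport a ×ˢ tsupport c) (IsCompact.prod ha hc)
    fun z hz => ?_
  by_cases h : z.1 ∈ tsupport a
  · rw [image_eq_zero_of_notMem_tsupport (f := c) fun h' => hz ⟨h, h'⟩, mul_zero]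
  · rw [image_eq_zero_of_notMem_tsupport h, zero_mul]

theorem exists_depth_bounds (hζ : Continuous ζ) (hpos : ∀ x, 0 < 1 + ζ x)
    (ha : HasCompactSupport a) :
    ∃ m M, 0 < m ∧ m < M ∧ ∀ x, a x ≠ 0 → m ≤ 1 + ζ x ∧ 1 + ζ x ≤ M := by
  have cc : Continuous fun x => 1 + ζ x := continuous_const.add hζ
  obtain ⟨M, hM⟩ := (IsCompact.image ha cc).bddAbove
  have hm : ∃ m, 0 < m ∧ ∀ x ∈ tsupport a, m ≤ 1 + ζ x := by
    rcases (tsupport a).eq_empty_or_nonempty with he | hn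
    · exact ⟨1, one_pos, fun x hx => by simp [he] at hx⟩
    · obtain ⟨y, _, hy⟩ := IsCompact.exists_isMinOn ha hn cc.continuousOn
      exact ⟨1 + ζ y, hpos y, fun x hx => hy hx⟩
  obtain ⟨m, hm0, hm⟩ := hm
  -- Enlarging the upper bound makes `m < M` strict, as the radii of the bump function require.
  refine ⟨m, max M (m + 1), hm0, (lt_add_one m).trans_le (le_max_right _ _), fun x hx => ?_⟩
  have hx' : x ∈ tsupport a := subset_tsupport a hx
  exact ⟨hm x hx', (hM ⟨x, hx', rfl⟩).trans (le_max_left _ _)⟩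

/-- Every test function on the free surface extends to a test function vanishing on the bottom. -/
theorem exists_surface_test (hζ : Continuous ζ) (hpos : ∀ x, 0 < 1 + ζ x) (ha : ContDiff ℝ ∞ a)
    (hc : HasCompactSupport a) : ∃ ψ : ℝ × ℝ → ℝ, ContDiff ℝ ∞ ψ ∧ HasCompactSupport ψ ∧
      (∀ x, ψ (x, 1 + ζ x) = a x) ∧ ∀ x, ψ (x, 0) = 0 := by
  obtain ⟨m, M, hm, hmM, hb⟩ := exists_depth_bounds hζ hpos hc
  -- The inner ball is exactly `[m, M]`, the range of depths over the support of `a`; the outer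
  -- radius `M / 2` is below the distance `(m + M) / 2` to the bottom.
  let c : ContDiffBump ((m + M) / 2) := ⟨(M - m) / 2, M / 2, by linarith, by linarith⟩
  refine ⟨fun z => a z.1 * c z.2, contDiff_mul_prod ha c.contDiff,
    hasCompactSupport_mul_prod hc c.hasCompactSupport, fun x => ?_, fun x => ?_⟩
  · by_cases hx : a x = 0
    · simp [hx]
    · have h := hb x hx
      simp only
      rw [c.one_of_mem_closedBall, mul_one]
      rw [Metric.mem_closedBall, Real.dist_eq, abs_le]
      constructor <;> simp only [c] <;> linarith
  · simp only
    rw [c.zero_of_le_dist, mul_zero]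
    rw [Real.dist_eq, zero_sub, abs_neg, abs_of_pos (by linarith)]
    simp only [c]
    linarith

/-- Every test function on the bottom extends to a test function vanishing on the free surface. -/
theorem exists_bottom_test (hζ : Continuous ζ) (hpos : ∀ x, 0 < 1 + ζ x) (ha : ContDiff ℝ ∞ a)
    (hc : HasCompactSupport a) : ∃ ψ : ℝ × ℝ → ℝ, ContDiff ℝ ∞ ψ ∧ HasCompactSupport ψ ∧
      (∀ x, ψ (x, 1 + ζ x) = 0) ∧ ∀ x, ψ (x, 0) = a x := by
  obtain ⟨m, M, hm, hmM, hb⟩ := exists_depth_bounds hζ hpos hc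
  -- The bump dies at height `m`, which the surface does not go below over the support of `a`.
  let c : ContDiffBump (0 : ℝ) := ⟨m / 2, m, by linarith, by linarith⟩
  refine ⟨fun z => a z.1 * c z.2, contDiff_mul_prod ha c.contDiff,
    hasCompactSupport_mul_prod hc c.hasCompactSupport, fun x => ?_, fun x => ?_⟩
  · by_cases hx : a x = 0
    · simp [hx]
    · have h := hb x hx
      simp only
      rw [c.zero_of_le_dist, mul_zero]
      rw [Real.dist_eq, sub_zero, abs_of_pos (hpos x)]
      exact h.1
  · simp only
    rw [c.one_of_mem_closedBall, mul_one]
    exact Metric.mem_closedBall_self c.rIn_pos.le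

theorem ae_eq_zero_of_forall_integral_mul_test {f : ℝ → ℝ} (hf : LocallyIntegrable f)
    (h : ∀ a : ℝ → ℝ, ContDiff ℝ ∞ a → HasCompactSupport a → ∫ x, f x * a x = 0) :
    ∀ᵐ x, f x = 0 :=
  ae_eq_zero_of_integral_contDiff_smul_eq_zero hf fun a ha hc => by
    simpa [mul_comm] using h a ha hc

end TestFunctions

/-! ### The first variation as a boundary integral -/

/-- The velocity `(P, Q)` of a harmonic potential, square integrable with its derivatives on bounded
parts of the fluid, with boundary values `(p, q)` on the surface and `(p₀, q₀)` on the bottom. -/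
structure HasBoundaryVelocity (φ : ℝ × ℝ → ℝ) (ζ : ℝ → ℝ) (P Q : ℝ × ℝ → ℝ) (p q p₀ q₀ : ℝ → ℝ) :
    Prop where
  grad_ae_eq : grad ζ φ =ᵐ[volume.restrict (fluidInterior ζ)] fun z => (P z, Q z)
  sqRegular_fst : SqRegularInside ζ P
  sqRegular_snd : SqRegularInside ζ Q
  div_eq_zero : ∀ z ∈ fluidInterior ζ, fderiv ℝ P z (1, 0) + fderiv ℝ Q z (0, 1) = 0
  curl_eq_zero : ∀ z ∈ fluidInterior ζ, fderiv ℝ P z (0, 1) = fderiv ℝ Q z (1, 0)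
  boundary_fst : HasBoundaryValues ζ P p p₀
  boundary_snd : HasBoundaryValues ζ Q q q₀

/-- The velocity is the classical gradient of the harmonic representative. By uniqueness of weak
gradients, its classical derivatives inherit the bounds on the weak second derivatives. Zero
divergence is Laplace's equation, zero curl the symmetry of second derivatives. -/
theorem exists_hasBoundaryVelocity {φ : ℝ × ℝ → ℝ} {ζ : ℝ → ℝ} (hadm : Admissible φ ζ)
    (hH : IsH2 φ ζ) (hh : IsHarmonicInside φ ζ) :
    ∃ P Q p q p₀ q₀, HasBoundaryVelocity φ ζ P Q p q p₀ q₀ := by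
  have hζ := hadm.continuous_surface
  have O := isOpen_fluidInterior hζ
  obtain ⟨f, hf⟩ := hh.exists_harmonicRep hζ
  have cd : ∀ v, ContDiffOn ℝ 1 (fun z => fderiv ℝ f z v) (fluidInterior ζ) := fun v =>
    (hf.contDiffOn.fderiv_of_isOpen O (by norm_num)).clm_apply contDiffOn_const
  have hg : grad ζ φ =ᵐ[volume.restrict (fluidInterior ζ)] classicalGrad f :=
    HasWeakGrad.ae_eq O (hadm.hasWeakGrad.congr_left O hf.ae_eq)
      (hasWeakGrad_classicalGrad O (hf.contDiffOn.of_le (by norm_num)))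
  obtain ⟨g₁, g₂, h1, h2, hint⟩ := hH
  rw [interior_fluidDomain hζ] at h1 h2
  have e1 : (fun z => (grad ζ φ z).1) =ᵐ[volume.restrict (fluidInterior ζ)]
      fun z => fderiv ℝ f z (1, 0) := hg.mono fun z hz => by simp only [hz, classicalGrad]
  have e2 : (fun z => (grad ζ φ z).2) =ᵐ[volume.restrict (fluidInterior ζ)]
      fun z => fderiv ℝ f z (0, 1) := hg.mono fun z hz => by simp only [hz, classicalGrad]
  have k1 := HasWeakGrad.ae_eq O (h1.congr_left O e1) (hasWeakGrad_classicalGrad O (cd _))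
  have k2 := HasWeakGrad.ae_eq O (h2.congr_left O e2) (hasWeakGrad_classicalGrad O (cd _))
  have sub : ∀ R, strip ζ R ⊆ fluidInterior ζ := fun R => Set.inter_subset_left
  have sub' : ∀ R, strip ζ R ⊆ fluidDomain ζ ∩ {z | |z.1| ≤ R} := fun R =>
    Set.inter_subset_inter_left _ (fluidInterior_subset ζ)
  have dom : ∀ {F : ℝ × ℝ → ℝ} {d : ℝ × ℝ → ℝ} {R : ℝ}, IntegrableOn F (strip ζ R) →
      ContinuousOn d (fluidInterior ζ) →
      (∀ᵐ z ∂(volume.restrict (fluidInterior ζ)), d z ^ 2 ≤ F z) →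
      IntegrableOn (fun z => d z ^ 2) (strip ζ R) := by
    intro F d R hF hd hle
    refine hF.mono' (((hd.pow 2).mono (sub R)).aestronglyMeasurable (measurableSet_strip hζ R)) ?_
    filter_upwards [ae_restrict_of_ae_restrict_of_subset (sub R) hle] with z hz
    rwa [Real.norm_eq_abs, abs_of_nonneg (sq_nonneg _)]
  have iE : ∀ R, IntegrableOn (fun z => 1 + (grad ζ φ z).1 ^ 2 + (grad ζ φ z).2 ^ 2)
    (strip ζ R) := fun R => hadm.integrableOn_sq (sub R) (volume_strip_lt_top hζ R)
  have iH := fun R => (hint R).mono_set (sub' R)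
  have cdd : ∀ u v, ContinuousOn (fun z => fderiv ℝ (fun z => fderiv ℝ f z u) z v)
      (fluidInterior ζ) := fun u v =>
    ((cd u).continuousOn_fderiv_of_isOpen O le_rfl).clm_apply continuousOn_const
  have sP : SqRegularInside ζ fun z => fderiv ℝ f z (1, 0) := by
    refine ⟨cd _, fun R => dom (iE R) (cd _).continuousOn ?_, fun R => dom (iH R) (cdd _ _) ?_,
      fun R => dom (iH R) (cdd _ _) ?_⟩
    · filter_upwards [e1] with z hz
      rw [← hz]
      nlinarith [sq_nonneg (grad ζ φ z).2]
    · filter_upwards [k1] with z hz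
      rw [hz, classicalGrad]
      nlinarith [sq_nonneg (fderiv ℝ (fun z => fderiv ℝ f z (1, 0)) z (0, 1)),
        sq_nonneg (g₂ z).1, sq_nonneg (g₂ z).2]
    · filter_upwards [k1] with z hz
      rw [hz, classicalGrad]
      nlinarith [sq_nonneg (fderiv ℝ (fun z => fderiv ℝ f z (1, 0)) z (1, 0)),
        sq_nonneg (g₂ z).1, sq_nonneg (g₂ z).2]
  have sQ : SqRegularInside ζ fun z => fderiv ℝ f z (0, 1) := by
    refine ⟨cd _, fun R => dom (iE R) (cd _).continuousOn ?_, fun R => dom (iH R) (cdd _ _) ?_,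
      fun R => dom (iH R) (cdd _ _) ?_⟩
    · filter_upwards [e2] with z hz
      rw [← hz]
      nlinarith [sq_nonneg (grad ζ φ z).1]
    · filter_upwards [k2] with z hz
      rw [hz, classicalGrad]
      nlinarith [sq_nonneg (fderiv ℝ (fun z => fderiv ℝ f z (0, 1)) z (0, 1)),
        sq_nonneg (g₁ z).1, sq_nonneg (g₁ z).2]
    · filter_upwards [k2] with z hz
      rw [hz, classicalGrad]
      nlinarith [sq_nonneg (fderiv ℝ (fun z => fderiv ℝ f z (0, 1)) z (1, 0)),
        sq_nonneg (g₁ z).1, sq_nonneg (g₁ z).2]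
  obtain ⟨p, p₀, hp⟩ := (sP.regularInside hζ).exists_hasBoundaryValues hζ hadm.depth_pos
  obtain ⟨q, q₀, hq⟩ := (sQ.regularInside hζ).exists_hasBoundaryValues hζ hadm.depth_pos
  exact ⟨_, _, p, q, p₀, q₀, hg, sP, sQ, hf.lap_eq_zero, fun z hz =>
    fderiv_fderiv_apply_comm (hf.contDiffOn.contDiffAt (O.mem_nhds hz)) _ _, hp, hq⟩

theorem LocallyIntegrable.continuous_mul {f g : ℝ → ℝ} (hf : LocallyIntegrable f)
    (hg : Continuous g) : LocallyIntegrable fun x => g x * f x :=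
  locallyIntegrable_of_forall_Icc fun _ =>
    (hf.integrableOn_isCompact isCompact_Icc).continuousOn_mul hg.continuousOn isCompact_Icc

/-- The restriction of a test function to the free surface. -/
theorem integrable_mul_comp_surface {ζ f : ℝ → ℝ} (hζ : Continuous ζ) (hf : LocallyIntegrable f)
    {ψ : ℝ × ℝ → ℝ} (hψ : ContDiff ℝ ∞ ψ) (hc : HasCompactSupport ψ) :
    Integrable fun x => f x * ψ (x, 1 + ζ x) := by
  have hψc := hψ.continuous
  refine hf.integrable_smul_right_of_hasCompactSupport (g := fun x => ψ (x, 1 + ζ x))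
    (by fun_prop) (HasCompactSupport.intro (K := Prod.fst '' tsupport ψ)
      (IsCompact.image hc continuous_fst) fun x hx => ?_)
  exact image_eq_zero_of_notMem_tsupport (f := ψ) fun h => hx ⟨_, h, rfl⟩

namespace HasBoundaryVelocity

variable {φ : ℝ × ℝ → ℝ} {ζ : ℝ → ℝ} {P Q : ℝ × ℝ → ℝ} {p q p₀ q₀ : ℝ → ℝ}

/-- The constant is written `1 * 1` so that every summand is a product of two square integrable
functions. -/
theorem regular_bernoulli (hζ : Continuous ζ) (H : HasBoundaryVelocity φ ζ P Q p q p₀ q₀) :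
    RegularInside ζ fun z => P z * P z - Q z * Q z - 1 * 1 :=
  ((H.sqRegular_fst.mul hζ H.sqRegular_fst).sub hζ (H.sqRegular_snd.mul hζ H.sqRegular_snd)).sub hζ
    ((sqRegularInside_one hζ).mul hζ (sqRegularInside_one hζ))

theorem boundary_bernoulli (H : HasBoundaryVelocity φ ζ P Q p q p₀ q₀) :
    HasBoundaryValues ζ (fun z => P z * P z - Q z * Q z - 1 * 1)
      (fun x => p x * p x - q x * q x - 1 * 1) (fun x => p₀ x * p₀ x - q₀ x * q₀ x - 1 * 1) := by
  filter_upwards [H.boundary_fst, H.boundary_snd] with x h1 h2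
  exact ⟨((h1.1.mul h1.1).sub (h2.1.mul h2.1)).sub tendsto_const_nhds,
    ((h1.2.mul h1.2).sub (h2.2.mul h2.2)).sub tendsto_const_nhds⟩

theorem boundary_mul (H : HasBoundaryVelocity φ ζ P Q p q p₀ q₀) :
    HasBoundaryValues ζ (fun z => P z * Q z) (fun x => p x * q x) fun x => p₀ x * q₀ x := by
  filter_upwards [H.boundary_fst, H.boundary_snd] with x h1 h2
  exact ⟨h1.1.mul h2.1, h1.2.mul h2.2⟩

/-- The kinematic defect of the boundary velocity at the free surface. -/
theorem locallyIntegrable_kinematic (hζ : ContDiff ℝ 1 ζ) (hpos : ∀ x, 0 < 1 + ζ x)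
    (H : HasBoundaryVelocity φ ζ P Q p q p₀ q₀) :
    LocallyIntegrable fun x => q x - deriv ζ x * p x :=
  ((H.sqRegular_snd.regularInside hζ.continuous).locallyIntegrable_boundaryValues hζ.continuous
    hpos H.boundary_snd).1.sub (LocallyIntegrable.continuous_mul
      ((H.sqRegular_fst.regularInside hζ.continuous).locallyIntegrable_boundaryValues
        hζ.continuous hpos H.boundary_fst).1 (hζ.continuous_deriv le_rfl))

/-- The normal component of the momentum flux at the free surface. -/
theorem locallyIntegrable_momentum (hζ : ContDiff ℝ 1 ζ) (hpos : ∀ x, 0 < 1 + ζ x)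
    (H : HasBoundaryVelocity φ ζ P Q p q p₀ q₀) : LocallyIntegrable fun x =>
      1 / 2 * (p x * p x - q x * q x - 1 * 1) + deriv ζ x * (p x * q x) :=
  (LocallyIntegrable.continuous_mul
    ((H.regular_bernoulli hζ.continuous).locallyIntegrable_boundaryValues hζ.continuous hpos
      H.boundary_bernoulli).1 continuous_const).add (LocallyIntegrable.continuous_mul
    ((H.sqRegular_fst.mul hζ.continuous H.sqRegular_snd).locallyIntegrable_boundaryValues
      hζ.continuous hpos H.boundary_mul).1 (hζ.continuous_deriv le_rfl))

theorem locallyIntegrable_bottom (hζ : Continuous ζ) (hpos : ∀ x, 0 < 1 + ζ x)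
    (H : HasBoundaryVelocity φ ζ P Q p q p₀ q₀) : LocallyIntegrable q₀ :=
  ((H.sqRegular_snd.regularInside hζ).locallyIntegrable_boundaryValues hζ hpos H.boundary_snd).2

/-- Green's formula for both components: the area terms cancel because the divergence vanishes,
which leaves the flux through the surface and the bottom. -/
theorem integral_potential_terms (hζ : ContDiff ℝ 1 ζ) (hpos : ∀ x, 0 < 1 + ζ x)
    (H : HasBoundaryVelocity φ ζ P Q p q p₀ q₀) {ψ : ℝ × ℝ → ℝ} (hψ : ContDiff ℝ ∞ ψ)
    (hc : HasCompactSupport ψ) :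
    (∫ z in fluidInterior ζ, P z * fderiv ℝ ψ z (1, 0)) +
        ∫ z in fluidInterior ζ, Q z * fderiv ℝ ψ z (0, 1) =
      (∫ x, (q x - deriv ζ x * p x) * ψ (x, 1 + ζ x)) - ∫ x, q₀ x * ψ (x, 0) := by
  have ζc := hζ.continuous
  have rP := H.sqRegular_fst.regularInside ζc
  have rQ := H.sqRegular_snd.regularInside ζc
  have g1 := (rP.green hζ hpos H.boundary_fst hψ hc).1
  have g2 := (rQ.green hζ hpos H.boundary_snd hψ hc).2
  have e : ∫ z in fluidInterior ζ, fderiv ℝ Q z (0, 1) * ψ z =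
      -∫ z in fluidInterior ζ, fderiv ℝ P z (1, 0) * ψ z := by
    rw [← integral_neg]
    refine setIntegral_congr_fun (isOpen_fluidInterior ζc).measurableSet fun z hz => ?_
    rw [eq_neg_of_add_eq_zero_right (H.div_eq_zero z hz)]
    ring
  have lp := (rP.locallyIntegrable_boundaryValues ζc hpos H.boundary_fst).1
  have lq := (rQ.locallyIntegrable_boundaryValues ζc hpos H.boundary_snd).1
  have i1 := integrable_mul_comp_surface ζc lq hψ hc
  have i2 := integrable_mul_comp_surface ζc
    (LocallyIntegrable.continuous_mul lp (hζ.continuous_deriv le_rfl)) hψ hc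
  -- The bottom is treated as the surface of elevation `-1`.
  have i3 : Integrable fun x => q₀ x * ψ (x, 0) := by
    simpa using integrable_mul_comp_surface (ζ := fun _ => -1) continuous_const
      (H.locallyIntegrable_bottom ζc hpos) hψ hc
  rw [integral_sub i1 i3] at g2
  simp only [sub_mul]
  rw [integral_sub i1 i2]
  simp only [mul_assoc]
  linarith

/-- Conservation of momentum: zero divergence and curl give `∂ₓ(PQ) = ½ ∂_y(P² - Q² - 1)`, so the
area terms cancel. The bottom contributes nothing as `ψ` vanishes there. -/
theorem integral_displacement_terms (hζ : ContDiff ℝ 1 ζ) (hpos : ∀ x, 0 < 1 + ζ x)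
    (H : HasBoundaryVelocity φ ζ P Q p q p₀ q₀) {ψ : ℝ × ℝ → ℝ} (hψ : ContDiff ℝ ∞ ψ)
    (hc : HasCompactSupport ψ) (h0 : ∀ x, ψ (x, 0) = 0) :
    1 / 2 * (∫ z in fluidInterior ζ, (P z * P z - Q z * Q z - 1 * 1) * fderiv ℝ ψ z (0, 1)) -
        ∫ z in fluidInterior ζ, P z * Q z * fderiv ℝ ψ z (1, 0) =
      ∫ x, (1 / 2 * (p x * p x - q x * q x - 1 * 1) + deriv ζ x * (p x * q x)) *
        ψ (x, 1 + ζ x) := by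
  have ζc := hζ.continuous
  have O := isOpen_fluidInterior ζc
  have rE := H.regular_bernoulli ζc
  have rM := H.sqRegular_fst.mul ζc H.sqRegular_snd
  have g1 := (rE.green hζ hpos H.boundary_bernoulli hψ hc).2
  have g2 := (rM.green hζ hpos H.boundary_mul hψ hc).1
  have e : ∫ z in fluidInterior ζ, fderiv ℝ (fun z => P z * Q z) z (1, 0) * ψ z =
      1 / 2 * ∫ z in fluidInterior ζ,
        fderiv ℝ (fun z => P z * P z - Q z * Q z - 1 * 1) z (0, 1) * ψ z := by
    rw [← integral_const_mul]
    refine setIntegral_congr_fun O.measurableSet fun z hz => ?_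
    have dP := (H.sqRegular_fst.contDiffOn.contDiffAt (O.mem_nhds hz)).differentiableAt one_ne_zero
    have dQ := (H.sqRegular_snd.contDiffOn.contDiffAt (O.mem_nhds hz)).differentiableAt one_ne_zero
    rw [fderiv_sub_const, fderiv_fun_sub (dP.fun_mul dP) (dQ.fun_mul dQ), sub_apply,
      Variation.fderiv_mul_apply dP dQ, Variation.fderiv_mul_apply dP dP,
      Variation.fderiv_mul_apply dQ dQ, H.curl_eq_zero z hz,
      eq_neg_of_add_eq_zero_left (H.div_eq_zero z hz)]
    ring
  have lE := (rE.locallyIntegrable_boundaryValues ζc hpos H.boundary_bernoulli).1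
  have lM := (rM.locallyIntegrable_boundaryValues ζc hpos H.boundary_mul).1
  have i1 := integrable_mul_comp_surface ζc (LocallyIntegrable.continuous_mul lE
    (continuous_const (y := (1 / 2 : ℝ)))) hψ hc
  have i2 := integrable_mul_comp_surface ζc
    (LocallyIntegrable.continuous_mul lM (hζ.continuous_deriv le_rfl)) hψ hc
  simp only [h0, mul_zero, sub_zero] at g1
  simp only [add_mul]
  rw [integral_add i1 i2]
  simp only [mul_assoc] at g2 ⊢
  rw [integral_const_mul]
  linear_combination 1 / 2 * g1 - g2 + e

/-- The first variation of the kinetic energy as a boundary integral. -/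
theorem kineticVariation_eq (hζ : ContDiff ℝ 1 ζ) (hpos : ∀ x, 0 < 1 + ζ x)
    (H : HasBoundaryVelocity φ ζ P Q p q p₀ q₀) (V : Variation) :
    V.kineticVariation φ ζ =
      (∫ x, (q x - deriv ζ x * p x) * V.η (x, 1 + ζ x)) - (∫ x, q₀ x * V.η (x, 0)) +
        ∫ x, (1 / 2 * (p x * p x - q x * q x - 1 * 1) + deriv ζ x * (p x * q x)) *
          V.θ (x, 1 + ζ x) := by
  have ζc := hζ.continuous
  have M := (isOpen_fluidInterior ζc).measurableSet
  have I : ∀ {d ψ : ℝ × ℝ → ℝ}, RegularInside ζ d → ContDiff ℝ ∞ ψ → HasCompactSupport ψ →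
      ∀ v, IntegrableOn (fun z => d z * fderiv ℝ ψ z v) (fluidInterior ζ) := fun hd h1 h2 v =>
    IntegrableOn.mul_hasCompactSupport M (Variation.contDiff_fderiv_apply h1 v).continuous
      (h2.fderiv_apply (𝕜 := ℝ) v) (integrableOn_inter_of_isCompact hd.integrableOn
        (h2.fderiv_apply (𝕜 := ℝ) v))
  have i1 := I (H.sqRegular_fst.regularInside ζc) V.smooth_η V.compact_η (1, 0)
  have i2 := I (H.sqRegular_snd.regularInside ζc) V.smooth_η V.compact_η (0, 1)
  have i3 := I (H.regular_bernoulli ζc) V.smooth_θ V.compact_θ (0, 1)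
  have i4 := I (H.sqRegular_fst.mul ζc H.sqRegular_snd) V.smooth_θ V.compact_θ (1, 0)
  have i5 : IntegrableOn (fun z => P z * fderiv ℝ V.η z (1, 0) + Q z * fderiv ℝ V.η z (0, 1))
      (fluidInterior ζ) := i1.add i2
  have i6 : IntegrableOn (fun z =>
      1 / 2 * ((P z * P z - Q z * Q z - 1 * 1) * fderiv ℝ V.θ z (0, 1)) -
        P z * Q z * fderiv ℝ V.θ z (1, 0)) (fluidInterior ζ) := (i3.const_mul (1 / 2)).sub i4
  rw [← H.integral_potential_terms hζ hpos V.smooth_η V.compact_η,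
    ← H.integral_displacement_terms hζ hpos V.smooth_θ V.compact_θ V.bottom_fixed,
    ← integral_const_mul, ← integral_add i1 i2, ← integral_sub (i3.const_mul (1 / 2)) i4,
    ← integral_add i5 i6]
  refine integral_congr_ae ?_
  filter_upwards [H.grad_ae_eq] with z hz
  simp only [Variation.kineticVariationDensity, hz]
  ring

end HasBoundaryVelocity

/-! ### Critical points and Euler's equations -/

section Main

variable {lam : ℝ} {φ : ℝ × ℝ → ℝ} {ζ κ : ℝ → ℝ} {P Q : ℝ × ℝ → ℝ} {p q p₀ q₀ : ℝ → ℝ}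

theorem HasBoundaryVelocity.firstVariation_eq (hζ : ContDiff ℝ 1 ζ) (hpos : ∀ x, 0 < 1 + ζ x)
    (hκ : Continuous κ) (H : HasBoundaryVelocity φ ζ P Q p q p₀ q₀) (V : Variation) :
    firstVariation lam φ ζ κ V =
      (∫ x, (q x - deriv ζ x * p x) * V.η (x, 1 + ζ x)) - (∫ x, q₀ x * V.η (x, 0)) +
        ∫ x, (1 / 2 * (p x * p x - q x * q x - 1 * 1) + deriv ζ x * (p x * q x) + lam * κ x) *
          V.θ (x, 1 + ζ x) := by
  have i1 := integrable_mul_comp_surface hζ.continuous (H.locallyIntegrable_momentum hζ hpos)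
    V.smooth_θ V.compact_θ
  have i2 := (V.integrable_mul_surfaceVariation hζ.continuous hκ).const_mul lam
  rw [firstVariation, H.kineticVariation_eq hζ hpos V, add_assoc, ← integral_const_mul,
    ← integral_add i1 i2]
  congr 2
  funext x
  rw [Variation.surfaceVariation]
  ring

/-- The three boundary integrals are isolated by variations with prescribed boundary values: `η`
supported near the surface, `η` supported near the bottom, and `θ` alone. -/
theorem HasBoundaryVelocity.forall_firstVariation_eq_zero_iff (hζ : ContDiff ℝ 1 ζ)
    (hpos : ∀ x, 0 < 1 + ζ x) (hκ : Continuous κ) (H : HasBoundaryVelocity φ ζ P Q p q p₀ q₀) :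
    (∀ V, firstVariation lam φ ζ κ V = 0) ↔
      (∀ᵐ x, q x = p x * deriv ζ x) ∧ (∀ᵐ x, q₀ x = 0) ∧
        ∀ᵐ x, (p x ^ 2 + q x ^ 2) / 2 + lam * κ x = 1 / 2 := by
  constructor
  · intro h
    have h1 : ∀ᵐ x, q x - deriv ζ x * p x = 0 := by
      refine ae_eq_zero_of_forall_integral_mul_test (H.locallyIntegrable_kinematic hζ hpos)
        fun a ha hc => ?_
      obtain ⟨ψ, s1, s2, s3, s4⟩ := exists_surface_test hζ.continuous hpos ha hc
      have e := h (potentialVariation ψ s1 s2)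
      rw [H.firstVariation_eq hζ hpos hκ] at e
      simpa [potentialVariation, s3, s4] using e
    have h2 : ∀ᵐ x, q₀ x = 0 := by
      refine ae_eq_zero_of_forall_integral_mul_test (H.locallyIntegrable_bottom hζ.continuous hpos)
        fun a ha hc => ?_
      obtain ⟨ψ, s1, s2, s3, s4⟩ := exists_bottom_test hζ.continuous hpos ha hc
      have e := h (potentialVariation ψ s1 s2)
      rw [H.firstVariation_eq hζ hpos hκ] at e
      simpa [potentialVariation, s3, s4] using e
    have h3 : ∀ᵐ x, 1 / 2 * (p x * p x - q x * q x - 1 * 1) + deriv ζ x * (p x * q x) +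
        lam * κ x = 0 := by
      refine ae_eq_zero_of_forall_integral_mul_test ((H.locallyIntegrable_momentum hζ hpos).add
        (hκ.const_mul lam).locallyIntegrable) fun a ha hc => ?_
      obtain ⟨ψ, s1, s2, s3, s4⟩ := exists_surface_test hζ.continuous hpos ha hc
      -- A pure displacement; it is admissible because the extension vanishes on the bottom.
      have e := h ⟨ψ, fun _ => 0, s1, contDiff_const, s2, HasCompactSupport.zero, s4⟩
      rw [H.firstVariation_eq hζ hpos hκ] at e
      simpa [s3] using e
    refine ⟨?_, h2, ?_⟩
    · filter_upwards [h1] with x hx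
      linarith
    · filter_upwards [h1, h3] with x hx hx'
      -- The kinematic condition turns `ζ' p q` into `q²`, which changes the sign of `q²` in the
      -- momentum flux.
      linear_combination hx' + q x * hx
  · rintro ⟨h1, h2, h3⟩ V
    rw [H.firstVariation_eq hζ hpos hκ, integral_eq_zero_of_ae, integral_eq_zero_of_ae,
      integral_eq_zero_of_ae]
    · simp
    · filter_upwards [h1, h3] with x hx hx'
      rw [Pi.zero_apply]
      refine mul_eq_zero_of_left ?_ _
      linear_combination hx' - q x * hx
    · filter_upwards [h2] with x hx
      rw [hx, zero_mul, Pi.zero_apply]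
    · filter_upwards [h1] with x hx
      rw [hx, Pi.zero_apply]
      ring

/-- Traces are unique almost everywhere, so the conditions may be read off from the vertical limits.
-/
theorem HasBoundaryVelocity.eulerEquations_iff (hadm : Admissible φ ζ)
    (hh : IsHarmonicInside φ ζ) (H : HasBoundaryVelocity φ ζ P Q p q p₀ q₀) :
    EulerEquations lam φ ζ κ ↔ (∀ᵐ x, q x = p x * deriv ζ x) ∧ (∀ᵐ x, q₀ x = 0) ∧
        ∀ᵐ x, (p x ^ 2 + q x ^ 2) / 2 + lam * κ x = 1 / 2 := by
  have hζ := hadm.continuous_surface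
  have hpos := hadm.depth_pos
  have e1 : (fun z => (grad ζ φ z).1) =ᵐ[volume.restrict (fluidInterior ζ)] P :=
    H.grad_ae_eq.mono fun z hz => by simp only [hz]
  have e2 : (fun z => (grad ζ φ z).2) =ᵐ[volume.restrict (fluidInterior ζ)] Q :=
    H.grad_ae_eq.mono fun z hz => by simp only [hz]
  have i1 : ∀ R, IntegrableOn (fun z => (grad ζ φ z).1) (strip ζ R) := fun R =>
    ((H.sqRegular_fst.regularInside hζ).integrableOn R).congr
      (ae_restrict_of_ae_restrict_of_subset Set.inter_subset_left e1.symm)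
  have i2 : ∀ R, IntegrableOn (fun z => (grad ζ φ z).2) (strip ζ R) := fun R =>
    ((H.sqRegular_snd.regularInside hζ).integrableOn R).congr
      (ae_restrict_of_ae_restrict_of_subset Set.inter_subset_left e2.symm)
  have t1 := H.boundary_fst.hasSurfaceTrace hζ hpos e1 i1
  have t2 := H.boundary_snd.hasSurfaceTrace hζ hpos e2 i2
  have t3 := H.boundary_snd.hasBottomTrace hζ hpos e2 i2
  constructor
  · rintro ⟨-, hb, p', q', hp, hq, hk, hB⟩
    refine ⟨?_, t3.ae_eq hb, ?_⟩
    · filter_upwards [t1.ae_eq hp, t2.ae_eq hq, hk] with x a b c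
      rwa [a, b]
    · filter_upwards [t1.ae_eq hp, t2.ae_eq hq, hB] with x a b c
      rwa [a, b]
  · rintro ⟨h1, h2, h3⟩
    exact ⟨hh, t3.congr h2, p, q, t1, t2, h1, h3⟩

/-- For flows that are regular up to the boundary, the first variation vanishes if and only if
Euler's equations hold. -/
theorem forall_firstVariation_eq_zero_iff_eulerEquations (hadm : Admissible φ ζ)
    (hζ : ContDiff ℝ 1 ζ) (hH : IsH2 φ ζ) (hκ : Continuous κ) :
    (∀ V, firstVariation lam φ ζ κ V = 0) ↔ EulerEquations lam φ ζ κ := by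
  -- Boundary values are available only once `φ` is known to be harmonic. This follows from either
  -- side of the equivalence, by Weyl's lemma or by definition.
  have key : IsHarmonicInside φ ζ →
      ((∀ V, firstVariation lam φ ζ κ V = 0) ↔ EulerEquations lam φ ζ κ) := fun hh => by
    obtain ⟨P, Q, p, q, p₀, q₀, H⟩ := exists_hasBoundaryVelocity hadm hH hh
    rw [H.forall_firstVariation_eq_zero_iff hζ hadm.depth_pos hκ, H.eulerEquations_iff hadm hh]
  exact ⟨fun h => (key ((isWeaklyHarmonic_of_firstVariation_eq_zero hadm h).isHarmonicInside
    hadm.continuous_surface)).1 h, fun h => (key h.1).2 h⟩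

/-- The Euler–Lagrange equations of a functional with first variation `firstVariation`. -/
theorem eulerLagrange {H : (ℝ × ℝ → ℝ) → (ℝ → ℝ) → ℝ} (hadm : Admissible φ ζ) (hκ : Continuous κ)
    (hd : ∀ V : Variation, HasDerivAt (fun ε => H (V.potential φ ε) (V.surface ζ ε))
      (firstVariation lam φ ζ κ V) 0) :
    (IsCritical H φ ζ → IsHarmonicInside φ ζ) ∧
      (IsLocalMinimizer H φ ζ → IsHarmonicInside φ ζ) ∧
      (ContDiff ℝ 1 ζ → IsH2 φ ζ →
        (IsCritical H φ ζ ↔ EulerEquations lam φ ζ κ) ∧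
        (IsLocalMinimizer H φ ζ → EulerEquations lam φ ζ κ)) := by
  have h1 : IsCritical H φ ζ → IsHarmonicInside φ ζ := fun h =>
    (isWeaklyHarmonic_of_firstVariation_eq_zero hadm ((isCritical_iff hd).1 h)).isHarmonicInside
      hadm.continuous_surface
  have h2 : ContDiff ℝ 1 ζ → IsH2 φ ζ → (IsCritical H φ ζ ↔ EulerEquations lam φ ζ κ) :=
    fun hζ hH => (isCritical_iff hd).trans
      (forall_firstVariation_eq_zero_iff_eulerEquations hadm hζ hH hκ)
  exact ⟨h1, fun h => h1 (h.isCritical hd), fun hζ hH =>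
    ⟨h2 hζ hH, fun h => (h2 hζ hH).1 (h.isCritical hd)⟩⟩

end Main

end WaterWave

end

theorem theorem1 (lam : ℝ) (φ : ℝ × ℝ → ℝ) (ζ : ℝ → ℝ) (hadm : WaterWave.Admissible φ ζ) :
    -- The functional with potential energy density `lam (y - 1)₊`: its Bernoulli condition has
    -- the head `lam * max ζ 0`, which is `lam * ζ` wherever `ζ ≥ 0`.
    (WaterWave.HamiltonianFinite lam φ ζ →
      (WaterWave.IsCritical (WaterWave.hamiltonian lam) φ ζ →
        WaterWave.IsHarmonicInside φ ζ) ∧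
      (WaterWave.IsLocalMinimizer (WaterWave.hamiltonian lam) φ ζ →
        WaterWave.IsHarmonicInside φ ζ) ∧
      (ContDiff ℝ 1 ζ → WaterWave.IsH2 φ ζ →
        (WaterWave.IsCritical (WaterWave.hamiltonian lam) φ ζ ↔
          WaterWave.EulerEquations lam φ ζ (fun x => max (ζ x) 0)) ∧
        (WaterWave.IsLocalMinimizer (WaterWave.hamiltonian lam) φ ζ →
          WaterWave.EulerEquations lam φ ζ (fun x => max (ζ x) 0)) ∧
        ((∀ x, 0 ≤ ζ x) →
          (WaterWave.IsCritical (WaterWave.hamiltonian lam) φ ζ ↔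
            WaterWave.EulerEquations lam φ ζ ζ) ∧
          (WaterWave.IsLocalMinimizer (WaterWave.hamiltonian lam) φ ζ →
            WaterWave.EulerEquations lam φ ζ ζ)))) ∧
    -- The same functional with the potential energy written `(lam / 2) ∫ ζ²`: no sign condition.
    (WaterWave.HamiltonianSqFinite φ ζ →
      (WaterWave.IsCritical (WaterWave.hamiltonianSq lam) φ ζ →
        WaterWave.IsHarmonicInside φ ζ) ∧
      (WaterWave.IsLocalMinimizer (WaterWave.hamiltonianSq lam) φ ζ →
        WaterWave.IsHarmonicInside φ ζ) ∧
      (ContDiff ℝ 1 ζ → WaterWave.IsH2 φ ζ →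
        (WaterWave.IsCritical (WaterWave.hamiltonianSq lam) φ ζ ↔
          WaterWave.EulerEquations lam φ ζ ζ) ∧
        (WaterWave.IsLocalMinimizer (WaterWave.hamiltonianSq lam) φ ζ →
          WaterWave.EulerEquations lam φ ζ ζ))) := by
  have hζ := hadm.continuous_surface
  refine ⟨fun hfin => ?_, fun hfin => ?_⟩
  · obtain ⟨h1, h2, h3⟩ := WaterWave.eulerLagrange hadm (hζ.max continuous_const)
      fun V => V.hasDerivAt_hamiltonian lam hadm hfin
    refine ⟨h1, h2, fun hζ1 hH => ⟨(h3 hζ1 hH).1, (h3 hζ1 hH).2, fun hpos => ?_⟩⟩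
    have e : (fun x => max (ζ x) 0) = ζ := funext fun x => max_eq_left (hpos x)
    have h := h3 hζ1 hH
    rwa [e] at h
  · exact WaterWave.eulerLagrange hadm hζ fun V => V.hasDerivAt_hamiltonianSq lam hadm hfin
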